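/- **Setting.** Let $M>0$, $|a|<M$ (subextreme Kerr), $r_\pm=M\pm\sqrt{M^2-a^2}$, $\kappa_+=\dfrac{r_+-r_-}{2(r_+^2+a^2)}$, $\Omega=\dfrac{a}{r_+^2+a^2}$, $\beta=2\pi/\kappa_+$, and let $s\in\{0,1,2\}$. A *section of spin weight $s$* over $\mathbb R\times S^2$ is a smooth function on $\mathbb R\times SO(3)$ ($SO(3)$ = bundle of oriented orthonormal frames $(X,Y)$ of $S^2$) that is multiplied by $e^{is\alpha}$ when $X+iY$ is replaced by $e^{i\alpha}(X+iY)$; its component at polar coordinates $(\theta,\varphi)$ is its value at the frame $(\partial_\theta,\frac1{\sin\theta}\partial_\varphi)$. Write $\langle x\rangle=\sqrt{1+x^2}$, $\hat f(z)=\frac1{\sqrt{2\pi}}\int_{\mathbb R} e^{izx}f(x)\,dx$ $(z\in\mathbb C)$, $D_x=i\partial_x$, and $1_{\mathbb R_+}(D_x)$ for the Fourier multiplier given by the indicator function of $[0,\infty)$. Put $$A_s=2^{-2s}\big(L^+_{-s+1}\cdots L^+_{s}\,L^-_{-s+1}\cdots L^-_{s}-144\,\delta_{s,2}M^2\partial_t^2\big),\qquad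 L_n^\pm=\partial_\theta\pm i\Big(a\sin\theta\,\partial_t+\tfrac{1}{\sin\theta}\partial_\varphi\Big)+n\cot\theta .$$ **Horizon** $\mathcal H=\mathbb R_U\times S^2_{\theta,\varphi_+}$ (components in the Kruskal tetrad). $\mathcal S_s(\mathcal H)$ is the space of pairs $\phi=(\phi_s,\overline{\phi_{-s}})$ of sections of spin weight $s$, of boost weights $s$ and $-s$, that vanish for large $U$ and for which there is $d>1$ such that for all $n\in\mathbb N_0$ there is $C$ with $$|\partial_U^n\phi_s|\,(\log\langle U\rangle)^{d+n}\le C\langle U\rangle^{s-n},\qquad |\partial_U^n\overline{\phi_{-s}}|\,(\log\langle U\rangle)^{d+n}\le C\langle U\rangle^{-s-n};$$ $\mathcal S_s(\mathcal H_-)$ consists of those that vanish for $U\ge U_0$ for some $U_0<0$. On boost weight $-s$ the Killing field $\partial_t$ in $A_s$ acts as the Lie derivative, $-\kappa_+(U\partial_U+s)-\Omega\,\partial_{\varphi_+}$. With $\varrho_+^2=r_+^2+a^2\cos^2\theta$, $\zeta=r_+-ia\cos\theta$ and þ$'=\frac{r_+-M}{\varrho_+^2}\partial_U$, the physical space $\mathcal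 S_{s,p}(\mathcal H)$ is the set of $\phi\in\mathcal S_s(\mathcal H)$ with $\overline{\phi_{-s}}=\bar\zeta^{2s}$þ$'^{\,2s}(\zeta^{2s}\phi_s)$ and $\overline{\phi_{-s}}\in\operatorname{Ran}A_s$ ($A_s$ acting on all smooth sections of spin weight $s$). Put $\mathcal U_s\phi_s=\frac{\varrho_+^{2s}}{(r_+-M)^s}$þ$'^{\,s}\phi_s$, $\widetilde{\mathcal U}_s\overline{\phi_{-s}}=(r_+-M)^{2s}\,\mathcal U_s\phi_s$, and $$w^+_{\mathcal H}(\phi,\psi)=2\int_{\mathbb R\times S^2}\Big[\overline{\mathcal U_s\phi_s}\,1_{\mathbb R_+}(D_U)D_U\,\widetilde{\mathcal U}_s\overline{\psi_{-s}}+\overline{\widetilde{\mathcal U}_s\overline{\phi_{-s}}}\,1_{\mathbb R_+}(D_U)D_U\,\mathcal U_s\psi_s\Big](r_+^2+a^2)\,dU\,d^2\omega,$$ $$\sigma_{\mathcal H}(\phi,\psi)=2(-1)^s\int_{\mathbb R\times S^2}\big[\overline{\phi_s}\,\partial_U\overline{\psi_{-s}}+\phi_{-s}\,\partial_U\psi_s\big](r_+^2+a^2)\,dU\,d^2\omega,\qquad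 w^-_{\mathcal H}=w^+_{\mathcal H}-i\sigma_{\mathcal H}.$$ The push-forward $\mathfrak Y^*_{\mathcal H,b}$ along the time-$b$ flow $U\mapsto e^{-\kappa_+b}U$ of $v_{\mathcal H}=\partial_t+\Omega\partial_\varphi=-\kappa_+U\partial_U$ maps $(\phi_s,\overline{\phi_{-s}})$ to $\big(e^{-s\kappa_+b}\phi_s(e^{\kappa_+b}U,\cdot),\;e^{s\kappa_+b}\,\overline{\phi_{-s}}(e^{\kappa_+b}U,\cdot)\big)$. **Past null infinity** $\mathcal I_-=\mathbb R_t\times S^2_{\theta,\varphi^*}$ (components in the conformally rescaled Kinnersley tetrad). Say that $F$ has decay $p$ if it vanishes for large $t$ and $\partial_t^nF=O(\langle t\rangle^{-p-n+\varepsilon})$ for all $n\in\mathbb N_0$, $\varepsilon>0$. $\mathcal S_s(\mathcal I_-)$ is the space of pairs $\psi=(\psi_s,\overline{\psi_{-s}})$ of sections of spin weight $s$ with $\psi_s$ of decay $2+2s$ and $\overline{\psi_{-s}}$ of decay $2$. Let þ$=2\partial_t$. The physical space $\mathcal S_{s,p}(\mathcal I_-)$ is the set of $\psi\in\mathcal S_s(\mathcal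 I_-)$ for which $\overline{\psi_{-s}}$ is in the range of $A_s$ (acting on sections of spin weight $s$ and decay $2$) and $\psi_s=$þ$^{2s}A_s^{-1}\overline{\psi_{-s}}$, i.e. there is a (then unique) section $\chi=:A_s^{-1}\overline{\psi_{-s}}$ of spin weight $s$ and decay $2$ with $A_s\chi=\overline{\psi_{-s}}$ and þ$^{2s}\chi=\psi_s$. Put $\mathcal W_s\overline{\psi_{-s}}=$þ$^s\overline{\psi_{-s}}$, $\widetilde{\mathcal W}_s\psi_s=$þ$^sA_s^{-1}\overline{\psi_{-s}}$, and $$w^+_{\mathcal I}(\phi,\psi)=2\int_{\mathbb R\times S^2}\Big[\overline{\widetilde{\mathcal W}_s\phi_s}\,1_{\mathbb R_+}(D_t)D_t\,\mathcal W_s\overline{\psi_{-s}}+\overline{\mathcal W_s\overline{\phi_{-s}}}\,1_{\mathbb R_+}(D_t)D_t\,\widetilde{\mathcal W}_s\psi_s\Big]dt\,d^2\omega,$$ $$\sigma_{\mathcal I}(\phi,\psi)=2(-1)^s\int_{\mathbb R\times S^2}\big[\overline{\phi_s}\,\partial_t\overline{\psi_{-s}}+\phi_{-s}\,\partial_t\psi_s\big]dt\,d^2\omega,\qquad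 w^-_{\mathcal I}=w^+_{\mathcal I}-i\sigma_{\mathcal I}.$$ The push-forward $\mathfrak Y^*_{\mathcal I,b}$ along the flow of $\partial_t$ maps $\psi$ to $\psi(\cdot-b,\cdot)$. **Proposition.** 1. $w^\pm_{\mathcal H}$ satisfy the KMS condition with respect to $v_{\mathcal H}$ at inverse temperature $\beta=2\pi/\kappa_+$: for all $\phi,\phi'\in\mathcal S_{s,p}(\mathcal H)\cap\mathcal S_s(\mathcal H_-)$ and both signs, (a) $w^\pm_{\mathcal H}(\mathfrak Y^*_{\mathcal H,b}\phi,\mathfrak Y^*_{\mathcal H,b}\phi')=w^\pm_{\mathcal H}(\phi,\phi')$ for all $b\in\mathbb R$; (b) $b\mapsto w^\pm_{\mathcal H}(\phi,\mathfrak Y^*_{\mathcal H,b}\phi')$ is bounded on $\mathbb R$; (c) for all $f\in C_0^\infty(\mathbb R;\mathbb R)$, with both integrals absolutely convergent, $$\int_{\mathbb R}\hat f(b)\,w^\pm_{\mathcal H}(\phi,\mathfrak Y^*_{\mathcal H,b}\phi')\,db=\int_{\mathbb R}\hat f(b\pm i\beta)\,w^\mp_{\mathcal H}(\phi,\mathfrak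 Y^*_{\mathcal H,b}\phi')\,db .$$ 2. $w^\pm_{\mathcal I}$ satisfy the ground state condition with respect to $\partial_t$: for all $\psi,\psi'\in\mathcal S_{s,p}(\mathcal I_-)$ and both signs, (a) $w^\pm_{\mathcal I}(\mathfrak Y^*_{\mathcal I,b}\psi,\mathfrak Y^*_{\mathcal I,b}\psi')=w^\pm_{\mathcal I}(\psi,\psi')$ for all $b\in\mathbb R$; (b) $b\mapsto w^\pm_{\mathcal I}(\psi,\mathfrak Y^*_{\mathcal I,b}\psi')$ is bounded on $\mathbb R$; (c) for all $f\in C_0^\infty(\mathbb R^*_\pm;\mathbb R)$, with absolute convergence, $$\int_{\mathbb R}\hat f(b)\,w^\pm_{\mathcal I}(\psi,\mathfrak Y^*_{\mathcal I,b}\psi')\,db=0 .$$ -/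

import Mathlib

open scoped ContDiff

noncomputable section

namespace KerrTeukolsky

/-- A subextreme Kerr black hole: mass `M > 0` and rotation parameter `a` with `|a| < M`. -/
structure Kerr where
  M : ℝ
  a : ℝ
  M_pos : 0 < M
  abs_a_lt : |a| < M

namespace Kerr

variable (K : Kerr)

/-- Radius of the event horizon. -/
def rPlus : ℝ := K.M + √(K.M ^ 2 - K.a ^ 2)

/-- Radius of the inner horizon. -/
def rMinus : ℝ := K.M - √(K.M ^ 2 - K.a ^ 2)

/-- `r₊² + a²`. -/
def area : ℝ := K.rPlus ^ 2 + K.a ^ 2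

/-- Surface gravity `κ₊ = (r₊ - r₋) / (2 (r₊² + a²))` of the event horizon. -/
def kappa : ℝ := (K.rPlus - K.rMinus) / (2 * K.area)

/-- Angular velocity `a / (r₊² + a²)` of the horizon: `v_H = ∂_t + Ω ∂_φ`. -/
def Omega : ℝ := K.a / K.area

/-- The inverse temperature `β = 2π / κ₊`. -/
def beta : ℝ := 2 * Real.pi / K.kappa

end Kerr

/-! ### Spin-weighted functions on `ℝ × S²`

Both boundaries are of the form `ℝ × S²`: the long horizon is `ℝ_U × S²_{θ,φ₊}`, past null infinity
is `ℝ_t × S²_{θ,φ*}`.  The oriented orthonormal frame bundle of `S²` is `SO(3)`: the matrix with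
columns `X, Y, ω` is the frame `(X, Y)` of the tangent space at `ω`. -/

/-- The bundle of oriented orthonormal frames of the unit sphere. -/
abbrev Frame : Type := Matrix.specialOrthogonalGroup (Fin 3) ℝ

/-- Rotation by `α` about the third axis. -/
def rotZ (α : ℝ) : Frame :=
  ⟨!![Real.cos α, -Real.sin α, 0; Real.sin α, Real.cos α, 0; 0, 0, 1], by
    rw [Matrix.mem_specialOrthogonalGroup_iff, Matrix.mem_orthogonalGroup_iff]
    have h := Real.sin_sq_add_cos_sq α
    constructor
    · ext i j
      fin_cases i <;> fin_cases j <;>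
        simp [Matrix.mul_apply, Fin.sum_univ_three] <;> nlinarith
    · rw [Matrix.det_fin_three]
      simp
      nlinarith⟩

/-- Rotation by `θ` about the second axis. -/
def rotY (θ : ℝ) : Frame :=
  ⟨!![Real.cos θ, 0, Real.sin θ; 0, 1, 0; -Real.sin θ, 0, Real.cos θ], by
    rw [Matrix.mem_specialOrthogonalGroup_iff, Matrix.mem_orthogonalGroup_iff]
    have h := Real.sin_sq_add_cos_sq θ
    constructor
    · ext i j
      fin_cases i <;> fin_cases j <;>
        simp [Matrix.mul_apply, Fin.sum_univ_three] <;> nlinarith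
    · rw [Matrix.det_fin_three]
      simp
      nlinarith⟩

/-- The frame `(∂_θ, (sin θ)⁻¹ ∂_φ)` at the point with polar coordinates `(θ, φ)`; it is the frame
that corresponds to the vector `m` of the Kinnersley (and of the Kruskal) tetrad. -/
def frame (θ φ : ℝ) : Frame := rotZ φ * rotY θ

/-- `cos θ` of the base point of a frame. -/
def cosTheta (R : Frame) : ℝ := (R : Matrix (Fin 3) (Fin 3) ℝ) 2 2

/-- Functions on `ℝ × SO(3)`. -/
abbrev Field : Type := ℝ → Frame → ℂ

/-- `F` is a smooth section over `ℝ × S²` of the bundle of functions of spin weight `s`, that is, a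
smooth function on `ℝ × SO(3)` which gets multiplied by `exp (i s α)` when `X + i Y` is replaced by
`exp (i α) (X + i Y)`.  (Right multiplication by `rotZ α` replaces it by `exp (-i α) (X + i Y)`.)
Smoothness is tested in the Euler angle charts centred at all `R`; these cover `SO(3)`. -/
structure IsSpinSection (s : ℕ) (F : Field) : Prop where
  equivariant : ∀ (x : ℝ) (R : Frame) (α : ℝ),
    F x (R * rotZ α) = Complex.exp (-(Complex.I * s * α)) * F x R
  smooth : ∀ R : Frame, ContDiff ℝ ∞ (fun p : ℝ × ℝ × ℝ × ℝ =>
    F p.1 (R * rotZ p.2.1 * rotY p.2.2.1 * rotZ p.2.2.2))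

/-- The derivative along the `ℝ`-factor. -/
def dX (F : Field) : Field := fun x R => deriv (fun y => F y R) x

/-- The component of a section with respect to the Kinnersley (Kruskal) frame, as a function of
`(x, θ, φ)` for `0 < θ < π`. -/
def component (F : Field) : ℝ → ℝ → ℝ → ℂ := fun x θ φ => F x (frame θ φ)

/-- `∫_{ℝ × S²} G dx d²ω` for `G` that descends to `ℝ × S²`. -/
def boundaryIntegral (G : Field) : ℂ :=
  ∫ p : ℝ × ℝ × ℝ in Set.univ ×ˢ (Set.Ioo 0 Real.pi ×ˢ Set.Ioo 0 (2 * Real.pi)),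
    component G p.1 p.2.1 p.2.2 * (Real.sin p.2.1 : ℂ)

/-! ### The operator `A_s` -/

/-- A sign `±`. -/
inductive Sgn where
  | plus
  | minus

namespace Sgn

/-- The number `±1`. -/
def val : Sgn → ℝ
  | plus => 1
  | minus => -1

/-- The opposite sign. -/
def flip : Sgn → Sgn
  | plus => minus
  | minus => plus

end Sgn

/-- The operator `L_n^± = ∂_θ ± i (a sin θ ∂_t + (sin θ)⁻¹ ∂_φ) + n cot θ`, where the action `T` of
the Killing field `∂_t` is a parameter (it depends on the scaling of the tetrad). -/
def opL (K : Kerr) (T : (ℝ → ℝ → ℝ → ℂ) → (ℝ → ℝ → ℝ → ℂ)) (σ : Sgn) (n : ℝ)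
    (f : ℝ → ℝ → ℝ → ℂ) : ℝ → ℝ → ℝ → ℂ := fun x θ φ =>
  deriv (fun θ₁ => f x θ₁ φ) θ
    + σ.val * Complex.I * ((K.a * Real.sin θ : ℝ) * T f x θ φ
        + ((Real.sin θ)⁻¹ : ℝ) * deriv (fun φ₁ => f x θ φ₁) φ)
    + (n * (Real.cos θ / Real.sin θ) : ℝ) * f x θ φ

/-- `L^±_{s-j+1} ⋯ L^±_{s-1} L^±_s` (`j` factors, the rightmost one acts first). -/
def opLChain (K : Kerr) (T : (ℝ → ℝ → ℝ → ℂ) → (ℝ → ℝ → ℝ → ℂ)) (σ : Sgn) (s : ℕ) :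
    ℕ → (ℝ → ℝ → ℝ → ℂ) → (ℝ → ℝ → ℝ → ℂ)
  | 0, f => f
  | j + 1, f => opL K T σ ((s : ℝ) - j) (opLChain K T σ s j f)

/-- `A_s = 2^{-2s} (L⁺_{-s+1} ⋯ L⁺_s L⁻_{-s+1} ⋯ L⁻_s - 144 δ_{s,2} M² ∂_t²)` on components. -/
def opA (K : Kerr) (T : (ℝ → ℝ → ℝ → ℂ) → (ℝ → ℝ → ℝ → ℂ)) (s : ℕ)
    (f : ℝ → ℝ → ℝ → ℂ) : ℝ → ℝ → ℝ → ℂ := fun x θ φ =>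
  ((2 : ℂ) ^ (2 * s))⁻¹ *
    (opLChain K T .plus s (2 * s) (opLChain K T .minus s (2 * s) f) x θ φ
      - if s = 2 then 144 * (K.M : ℂ) ^ 2 * T (T f) x θ φ else 0)

/-- `∂_t` at past null infinity, in coordinates `(t, θ, φ*)` and the conformally rescaled Kinnersley
tetrad. -/
def killingScri (f : ℝ → ℝ → ℝ → ℂ) : ℝ → ℝ → ℝ → ℂ := fun t θ φ =>
  deriv (fun t₁ => f t₁ θ φ) t

/-- The Lie derivative along `∂_t = -κ₊ U ∂_U - Ω ∂_{φ₊}` on functions of boost weight `-s` on the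
horizon, in coordinates `(U, θ, φ₊)` and in the Kruskal tetrad.  Components of boost weight `w` in the
Kruskal tetrad are `|U|^w` times those in the `∂_t`-invariant Kinnersley tetrad, hence `-κ₊ U ∂_U`
becomes `-κ₊ (U ∂_U - w)`, with `w = -s`. -/
def killingHorizon (K : Kerr) (s : ℕ) (f : ℝ → ℝ → ℝ → ℂ) : ℝ → ℝ → ℝ → ℂ := fun U θ φ =>
  -(K.kappa : ℂ) * (U * deriv (fun U₁ => f U₁ θ φ) U + s * f U θ φ)
    - (K.Omega : ℂ) * deriv (fun φ₁ => f U θ φ₁) φ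

/-- `A_s χ = ψ` for sections over past null infinity.  (Sections are determined by their components
away from the axis `sin θ = 0`.) -/
def AScriEq (K : Kerr) (s : ℕ) (χ ψ : Field) : Prop :=
  ∀ t θ φ : ℝ, 0 < θ → θ < Real.pi →
    opA K killingScri s (component χ) t θ φ = component ψ t θ φ

/-- `A_s χ = ψ` for sections over the horizon. -/
def AHorizonEq (K : Kerr) (s : ℕ) (χ ψ : Field) : Prop :=
  ∀ U θ φ : ℝ, 0 < θ → θ < Real.pi →
    opA K (killingHorizon K s) s (component χ) U θ φ = component ψ U θ φ

/-! ### Fourier transform and functional calculus of `D = i d/dx` -/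

/-- `f̂(z) = (2π)^{-1/2} ∫ e^{i z x} f(x) dx`, for complex `z`. -/
def fourierT (f : ℝ → ℂ) (z : ℂ) : ℂ :=
  (√(2 * Real.pi) : ℂ)⁻¹ * ∫ x : ℝ, Complex.exp (Complex.I * z * x) * f x

/-- The operator `q(D) = F⁻¹ q(k) F` for `D = i d/dx`; indeed `F (D f) (k) = k f̂(k)`. -/
def functionOfD (q : ℝ → ℂ) (f : ℝ → ℂ) (x : ℝ) : ℂ :=
  (√(2 * Real.pi) : ℂ)⁻¹ * ∫ k : ℝ, Complex.exp (-(Complex.I * k * x)) * (q k * fourierT f k)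

/-- `1_{ℝ₊}(D) D` along the `ℝ`-factor, where `ℝ₊ = [0, ∞)` and `D = i ∂_x`. -/
def posD (F : Field) : Field := fun x R =>
  functionOfD (Set.indicator (Set.Ici 0) 1) (fun y => Complex.I * dX F y R) x

/-- The Japanese bracket. -/
def bracket (x : ℝ) : ℝ := √(1 + x ^ 2)

/-! ### The horizon

All sections over the horizon are expressed in the Kruskal tetrad, as functions of `U` and a frame of
`S²_{θ,φ₊}`.  A pair `φ` stands for `(φ_s, conj φ_{-s})`; `φ.1` has boost weight `s`, `φ.2` has boost
weight `-s`, and both have spin weight `s`. -/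

/-- The space `S_s(H)`. -/
def horizonSpace (s : ℕ) : Set (Field × Field) :=
  {φ | IsSpinSection s φ.1 ∧ IsSpinSection s φ.2 ∧
    ∃ d : ℝ, 1 < d ∧ (∃ U₀ : ℝ, ∀ U > U₀, ∀ R, φ.1 U R = 0 ∧ φ.2 U R = 0) ∧
      ∀ n : ℕ, ∃ C : ℝ, ∀ (U : ℝ) (R : Frame),
        ‖(dX^[n] φ.1) U R‖ * Real.log (bracket U) ^ (d + n) ≤ C * bracket U ^ ((s : ℝ) - n) ∧
        ‖(dX^[n] φ.2) U R‖ * Real.log (bracket U) ^ (d + n) ≤ C * bracket U ^ (-(s : ℝ) - n)}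

/-- The space `S_s(H₋)` of the elements of `S_s(H)` supported in `U < U₀` for some `U₀ < 0`. -/
def leftHorizonSpace (s : ℕ) : Set (Field × Field) :=
  {φ | φ ∈ horizonSpace s ∧ ∃ U₀ < (0 : ℝ), ∀ U ≥ U₀, ∀ R, φ.1 U R = 0 ∧ φ.2 U R = 0}

/-- `ϱ₊² = r₊² + a² cos² θ`. -/
def rhoSq (K : Kerr) (R : Frame) : ℝ := K.rPlus ^ 2 + K.a ^ 2 * cosTheta R ^ 2

/-- `ζ = r - i a cos θ` on the horizon. -/
def zeta (K : Kerr) (R : Frame) : ℂ := K.rPlus - Complex.I * K.a * cosTheta R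

/-- The operator þ′ on the horizon in the Kruskal tetrad, `((r₊ - M) / ϱ₊²) ∂_U`. -/
def thoPrime (K : Kerr) (F : Field) : Field := fun U R =>
  ((K.rPlus - K.M) / rhoSq K R : ℝ) * dX F U R

/-- `B_s f = (conj ζ)^{2s} þ′^{2s} (ζ^{2s} f)`. -/
def opB (K : Kerr) (s : ℕ) (F : Field) : Field := fun U R =>
  (starRingEnd ℂ) (zeta K R) ^ (2 * s) *
    ((thoPrime K)^[2 * s] (fun u Q => zeta K Q ^ (2 * s) * F u Q)) U R

/-- The physical boundary space `S_{s,p}(H)`. -/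
def physHorizonSpace (K : Kerr) (s : ℕ) : Set (Field × Field) :=
  {φ | φ ∈ horizonSpace s ∧ (∃ χ, IsSpinSection s χ ∧ AHorizonEq K s χ φ.2) ∧ φ.2 = opB K s φ.1}

/-- `U_s φ_s = (ϱ₊^{2s} / (r₊ - M)^s) þ′^s φ_s`. -/
def opU (K : Kerr) (s : ℕ) (F : Field) : Field := fun U R =>
  (rhoSq K R ^ s / (K.rPlus - K.M) ^ s : ℝ) * ((thoPrime K)^[s] F) U R

/-- The operator `Ũ_s conj φ_{-s} = (r₊ - M)^{2s} U_s φ_s`, as a function of the element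
`φ = (φ_s, conj φ_{-s})` of the physical space (each component determines `φ`). -/
def opUTilde (K : Kerr) (s : ℕ) (φ : Field × Field) : Field := fun U R =>
  ((K.rPlus - K.M) ^ (2 * s) : ℝ) * opU K s φ.1 U R

/-- The two-point function `w⁺_H`. -/
def wHorizonPlus (K : Kerr) (s : ℕ) (φ ψ : Field × Field) : ℂ :=
  2 * boundaryIntegral (fun U R =>
    ((starRingEnd ℂ) (opU K s φ.1 U R) * posD (opUTilde K s ψ) U R
      + (starRingEnd ℂ) (opUTilde K s φ U R) * posD (opU K s ψ.1) U R) * K.area)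

/-- The charged symplectic form `σ_H(φ, ψ) = 2 (-1)^s ∫ ⟨φ, ∂_U ψ⟩ (r₊² + a²) dU d²ω`, with the
hermitian form `⟨φ, ψ⟩ = conj φ_s conj ψ_{-s} + φ_{-s} ψ_s`. -/
def sigmaHorizon (K : Kerr) (s : ℕ) (φ ψ : Field × Field) : ℂ :=
  2 * (-1) ^ s * boundaryIntegral (fun U R =>
    ((starRingEnd ℂ) (φ.1 U R) * dX ψ.2 U R
      + (starRingEnd ℂ) (φ.2 U R) * dX ψ.1 U R) * K.area)

/-- The two-point functions `w^±_H`, with `w⁻_H = w⁺_H - i σ_H`. -/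
def wHorizon (K : Kerr) (s : ℕ) : Sgn → Field × Field → Field × Field → ℂ
  | .plus, φ, ψ => wHorizonPlus K s φ ψ
  | .minus, φ, ψ => wHorizonPlus K s φ ψ - Complex.I * sigmaHorizon K s φ ψ

/-- The push-forward along the time-`b` flow of `v_H = -κ₊ U ∂_U` on pairs of sections over the
horizon.  The flow is `U ↦ e^{-κ₊ b} U`; it maps the Kruskal frame `(𝔩, 𝔫, 𝔪)` to
`(e^{κ₊ b} 𝔩, e^{-κ₊ b} 𝔫, 𝔪)`, so components of boost weight `w` are multiplied by
`e^{-w κ₊ b}`. -/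
def flowHorizon (K : Kerr) (s : ℕ) (b : ℝ) (φ : Field × Field) : Field × Field :=
  (fun U R => (Real.exp (-(s * K.kappa * b)) : ℂ) * φ.1 (Real.exp (K.kappa * b) * U) R,
    fun U R => (Real.exp (s * K.kappa * b) : ℂ) * φ.2 (Real.exp (K.kappa * b) * U) R)

/-! ### Past null infinity

All sections over past null infinity are expressed in the conformally rescaled Kinnersley tetrad, as
functions of `t` and a frame of `S²_{θ,φ*}`. -/

/-- `F` vanishes for large `t` and `∂_t^n F = O(⟨t⟩^{-p-n+ε})`, for all `n` and all `ε > 0`. -/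
def ScriDecay (p : ℝ) (F : Field) : Prop :=
  (∃ t₀ : ℝ, ∀ t > t₀, ∀ R, F t R = 0) ∧
    ∀ (n : ℕ) (ε : ℝ), 0 < ε → ∃ C : ℝ, ∀ (t : ℝ) (R : Frame),
      ‖(dX^[n] F) t R‖ ≤ C * bracket t ^ (-p - n + ε)

/-- The space `S_s(I₋)`; the exponents `2 ± s + |s|` are `2 + 2 s` and `2`. -/
def scriSpace (s : ℕ) : Set (Field × Field) :=
  {ψ | IsSpinSection s ψ.1 ∧ IsSpinSection s ψ.2 ∧
    ScriDecay (2 + 2 * s) ψ.1 ∧ ScriDecay 2 ψ.2}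

/-- The operator þ at past null infinity, `2 ∂_t`. -/
def tho (F : Field) : Field := fun t R => 2 * dX F t R

/-- `χ` represents `A_s⁻¹ conj ψ_{-s}` for a pair with `ψ_s = þ^{2s} A_s⁻¹ conj ψ_{-s}`.  The operator
`A_s` is taken on the sections that satisfy the conditions on second components in `S_s(I₋)`. -/
structure IsPotential (K : Kerr) (s : ℕ) (ψ : Field × Field) (χ : Field) : Prop where
  isSection : IsSpinSection s χ
  decay : ScriDecay 2 χ
  A_eq : AScriEq K s χ ψ.2
  tho_eq : ψ.1 = tho^[2 * s] χ

/-- The physical boundary space `S_{s,p}(I₋)`: the pairs in `S_s(I₋)` such that `conj ψ_{-s}` is in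
the range of `A_s` and `ψ_s = þ^{2s} A_s⁻¹ conj ψ_{-s}`. -/
def physScriSpace (K : Kerr) (s : ℕ) : Set (Field × Field) :=
  {ψ | ψ ∈ scriSpace s ∧ ∃ χ, IsPotential K s ψ χ}

open Classical in
/-- The section `A_s⁻¹ conj ψ_{-s}`. -/
def AInv (K : Kerr) (s : ℕ) (ψ : Field × Field) : Field :=
  if h : ∃ χ, IsPotential K s ψ χ then h.choose else 0

/-- `W_s conj ψ_{-s} = þ^s conj ψ_{-s}`. -/
def opW (s : ℕ) (ψ : Field × Field) : Field := tho^[s] ψ.2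

/-- `W̃_s ψ_s = þ^s A_s⁻¹ conj ψ_{-s}`. -/
def opWTilde (K : Kerr) (s : ℕ) (ψ : Field × Field) : Field := tho^[s] (AInv K s ψ)

/-- The two-point function `w⁺_I`. -/
def wScriPlus (K : Kerr) (s : ℕ) (φ ψ : Field × Field) : ℂ :=
  2 * boundaryIntegral (fun t R =>
    (starRingEnd ℂ) (opWTilde K s φ t R) * posD (opW s ψ) t R
      + (starRingEnd ℂ) (opW s φ t R) * posD (opWTilde K s ψ) t R)

/-- The charged symplectic form `σ_I(φ, ψ) = 2 (-1)^s ∫ ⟨φ, ∂_t ψ⟩ dt d²ω`. -/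
def sigmaScri (s : ℕ) (φ ψ : Field × Field) : ℂ :=
  2 * (-1) ^ s * boundaryIntegral (fun t R =>
    (starRingEnd ℂ) (φ.1 t R) * dX ψ.2 t R + (starRingEnd ℂ) (φ.2 t R) * dX ψ.1 t R)

/-- The two-point functions `w^±_I`, with `w⁻_I = w⁺_I - i σ_I`. -/
def wScri (K : Kerr) (s : ℕ) : Sgn → Field × Field → Field × Field → ℂ
  | .plus, φ, ψ => wScriPlus K s φ ψ
  | .minus, φ, ψ => wScriPlus K s φ ψ - Complex.I * sigmaScri s φ ψ

/-- The push-forward along the time-`b` flow of `∂_t` on pairs of sections over past null infinity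
(the conformally rescaled Kinnersley tetrad is invariant under the flow). -/
def flowScri (b : ℝ) (ψ : Field × Field) : Field × Field :=
  (fun t R => ψ.1 (t - b) R, fun t R => ψ.2 (t - b) R)

/-! ### The section `A_s⁻¹ conj ψ_{-s}` is unique -/

lemma rotZ_zero : rotZ 0 = 1 := by
  ext i j
  fin_cases i <;> fin_cases j <;> simp [rotZ]

lemma rotY_zero : rotY 0 = 1 := by
  ext i j
  fin_cases i <;> fin_cases j <;> simp [rotY]

lemma IsSpinSection.contDiff {s : ℕ} {F : Field} (h : IsSpinSection s F) (R : Frame) :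
    ContDiff ℝ ∞ (fun x => F x R) := by
  have h1 := (h.smooth R).comp
    (f := fun x : ℝ => ((x, 0, 0, 0) : ℝ × ℝ × ℝ × ℝ)) (by fun_prop)
  simpa [Function.comp_def, rotZ_zero, rotY_zero] using h1

lemma tho_iterate (F : Field) (n : ℕ) (t : ℝ) (R : Frame) :
    (tho^[n] F) t R = 2 ^ n * iteratedDeriv n (fun x => F x R) t := by
  induction n generalizing t with
  | zero => simp
  | succ n ih =>
    rw [Function.iterate_succ_apply']
    have : (fun y => (tho^[n] F) y R) = fun y => 2 ^ n * iteratedDeriv n (fun x => F x R) y :=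
      funext ih
    simp only [tho, dX, this, iteratedDeriv_succ]
    rw [deriv_const_mul_field]
    ring

lemma eq_zero_of_iteratedDeriv_eq_zero (n : ℕ) (g : ℝ → ℂ) (hg : ContDiff ℝ ∞ g) (T : ℝ)
    (hT : ∀ t > T, g t = 0) (h : ∀ t, iteratedDeriv n g t = 0) (t : ℝ) : g t = 0 := by
  induction n generalizing g t with
  | zero => simpa using h t
  | succ n ih =>
    have hd : ∀ t, deriv g t = 0 := by
      refine ih (deriv g) ?_ ?_ ?_
      · exact (contDiff_infty_iff_deriv.1 hg).2
      · intro u hu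
        have : g =ᶠ[nhds u] fun _ => 0 := by
          filter_upwards [Ioi_mem_nhds hu] with v hv using hT v hv
        simpa using this.deriv_eq
      · intro u
        have := h u
        rwa [iteratedDeriv_succ'] at this
    have hc := is_const_of_deriv_eq_zero (hg.differentiable (by simp)) hd t (max t T + 1)
    rw [hc]
    exact hT _ (by linarith [le_max_right t T])

lemma IsPotential.unique {K : Kerr} {s : ℕ} {ψ : Field × Field} {χ₁ χ₂ : Field}
    (h₁ : IsPotential K s ψ χ₁) (h₂ : IsPotential K s ψ χ₂) : χ₁ = χ₂ := by
  funext t R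
  obtain ⟨T₁, hT₁⟩ := h₁.decay.1
  obtain ⟨T₂, hT₂⟩ := h₂.decay.1
  have c₁ := h₁.isSection.contDiff R
  have c₂ := h₂.isSection.contDiff R
  refine sub_eq_zero.1 (eq_zero_of_iteratedDeriv_eq_zero (2 * s)
    (fun x => χ₁ x R - χ₂ x R) (c₁.sub c₂) (max T₁ T₂) ?_ ?_ t)
  · intro u hu
    simp [hT₁ u (lt_of_le_of_lt (le_max_left _ _) hu) R,
      hT₂ u (lt_of_le_of_lt (le_max_right _ _) hu) R]
  · intro u
    have e : (tho^[2 * s] χ₁) u R = (tho^[2 * s] χ₂) u R := by rw [← h₁.tho_eq, ← h₂.tho_eq]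
    rw [tho_iterate, tho_iterate] at e
    have e2 := mul_left_cancel₀ (pow_ne_zero _ (two_ne_zero' ℂ)) e
    have := iteratedDeriv_sub (n := 2 * s) (x := u)
      (contDiff_infty.1 c₁ (2 * s)).contDiffAt (contDiff_infty.1 c₂ (2 * s)).contDiffAt
    simpa [e2, Pi.sub_def] using this

lemma isPotential_AInv {K : Kerr} {s : ℕ} {ψ : Field × Field} (hψ : ψ ∈ physScriSpace K s) :
    IsPotential K s ψ (AInv K s ψ) := by
  have h := hψ.2
  rw [AInv, dif_pos h]
  exact h.choose_spec

end KerrTeukolsky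

end

open KerrTeukolsky

/-!
Both boundary states are diagonalized by the Fourier transform along the flow, and the two
conditions are read off from the multipliers. If `w(φ, 𝔜_b φ') = ∫ e^{i c b k} m(k) ν(k) dk` with
`m ν` integrable, then boundedness is clear, and Fubini and Fourier inversion give `∫ f̂(b) w(φ,
𝔜_b φ') db = √(2π) ∫ f(-c k) m(k) ν(k) dk` for every test function `f`
(`integral_fourierT_mul_integral`).

At past null infinity the flow is the translation of `t`, and the multiplier is `k` on `k ≥ 0` for
`w⁺` and `-k` on `k < 0` for `w⁻` (`wScri_eq`). For the latter, the symplectic form has to be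
expressed by the same spectral density as `w⁺`. Since `ψ_s = þ^{2s} A⁻¹ ψ̄_{-s}`, this amounts to
distributing the `2s` derivatives evenly over the two factors (`I_mul_sigmaScri_eq`). The test
function then vanishes where the multiplier does not.

On the horizon the flow becomes the translation of `u = log (-U)`. Only the function `g = ∂_U^s
φ_s`, of boost weight zero, matters: up to constants, `U_s φ_s` and `Ũ_s φ̄_{-s}` are both equal to
`g` (`opU_eq`), and `φ̄_{-s}` is `∂_U^{2s} φ_s` (`opB_eq`). The estimates in the definition of
`S_s(H₋)` say that `g`, as a function of `u`, is integrable together with its derivatives, because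
`log ⟨U⟩` behaves like `|u|` and `d > 1` (`horizonFamily_polarFamily`,
`HorizonFamily.smoothL1Family_log`). The operator `1_{ℝ₊}(D_U) D_U`, pulled back to `u`, is the
function `k / (e^{2πk} - 1)` of `D_u` (`functionOfD_comp_neg_exp`). To see this, extend the
positive frequency part of `D_U g` to the lower half-plane, where it is a Cauchy integral
(`positiveFrequency_eq_cauchy`), and evaluate it at `U = -e^{u + iδ}` with `0 < δ < π`. After the
substitution `U' = -e^v` and an integration by parts, the Cauchy kernel becomes a function of `u -
v`, namely the Fourier transform of the Bose factor (`integral_planck_mul_cexp`, from the expansion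
of `1 / sin²` into partial fractions); then let `δ → 0`. The symplectic form `i σ_H` does not
depend on the coordinate, up to the orientation, so that it has the multiplier `-k`
(`I_mul_sigmaHorizon_eq`), and `w⁻_H` has the multiplier `k / (e^{2πk} - 1) + k = e^{2πk} k /
(e^{2πk} - 1)` (`wHorizon_eq`). The factor `e^{2πk}` by which the two multipliers differ is what
the shift of the argument of `f̂` by `iβ` produces, since `β κ₊ = 2π`
(`integral_fourierT_mul_wHorizon_eq_flip`).
-/

namespace KerrTeukolsky

open MeasureTheory Set Filter Topology Complex

/-! ### The Planck factor and its Fourier transform -/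

/-- The Planck factor `k / (e^{2πk} - 1)`; the junk value `0` at `k = 0` is harmless. -/
noncomputable def planck (k : ℝ) : ℝ := k / (Real.exp (2 * Real.pi * k) - 1)

lemma measurable_planck : Measurable planck := by unfold planck; fun_prop

lemma exp_two_pi_mul_sub_one_ne_zero {k : ℝ} (hk : k ≠ 0) :
    Real.exp (2 * Real.pi * k) - 1 ≠ 0 :=
  sub_ne_zero.2 (by rw [Ne, Real.exp_eq_one_iff]; positivity)

lemma planck_neg (k : ℝ) : planck (-k) = planck k + k := by
  unfold planck
  rcases eq_or_ne k 0 with rfl | hk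
  · simp
  have h1 := exp_two_pi_mul_sub_one_ne_zero hk
  have h3 := Real.exp_ne_zero (2 * Real.pi * k)
  rw [show 2 * Real.pi * -k = -(2 * Real.pi * k) by ring, Real.exp_neg]
  generalize Real.exp (2 * Real.pi * k) = e at *
  have h4 : 1 - e ≠ 0 := fun h => h1 (by linarith)
  have h5 : e⁻¹ - 1 = (1 - e) / e := by field_simp
  rw [h5]
  field_simp
  ring

/-- The relation between the two thermal factors that is responsible for the KMS condition. -/
lemma planck_add_self (k : ℝ) : planck k + k = Real.exp (2 * Real.pi * k) * planck k := by
  unfold planck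
  rcases eq_or_ne k 0 with rfl | hk
  · simp
  have h1 := exp_two_pi_mul_sub_one_ne_zero hk
  generalize Real.exp (2 * Real.pi * k) = e at *
  field_simp
  ring

lemma planck_nonneg (k : ℝ) : 0 ≤ planck k := by
  unfold planck
  rcases le_total 0 k with hk | hk
  · refine div_nonneg hk ?_
    have := Real.one_le_exp (x := 2 * Real.pi * k) (by positivity)
    linarith
  · refine div_nonneg_of_nonpos hk ?_
    have := Real.exp_le_one_iff.2 (show 2 * Real.pi * k ≤ 0 by
      have := Real.pi_pos; nlinarith)
    linarith

lemma planck_le_of_nonneg {k : ℝ} (hk : 0 ≤ k) : planck k ≤ Real.exp (-(Real.pi * k)) := by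
  unfold planck
  rcases hk.eq_or_lt with rfl | hk
  · simp
  set e := Real.exp (Real.pi * k) with he
  have e1 : Real.pi * k + 1 ≤ e := Real.add_one_le_exp _
  have h2 : Real.exp (2 * Real.pi * k) = e * e := by
    rw [he, ← Real.exp_add]; ring_nf
  have hpi := Real.pi_gt_three
  have he0 : 1 < e := by nlinarith
  rw [Real.exp_neg, ← he, h2, div_le_iff₀ (by nlinarith)]
  have : e⁻¹ * (e * e - 1) = e - e⁻¹ := by field_simp
  rw [this]
  have : e⁻¹ ≤ 1 := inv_le_one_of_one_le₀ he0.le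
  nlinarith

lemma planck_le_of_nonpos {k : ℝ} (hk : k ≤ 0) : planck k ≤ 1 - k := by
  have h := planck_le_of_nonneg (neg_nonneg.2 hk)
  have h2 := planck_neg k
  have h3 : Real.exp (-(Real.pi * -k)) ≤ 1 := Real.exp_le_one_iff.2 (by
    have := Real.pi_pos; nlinarith)
  linarith

/-- Uniform bound for the factor `e^{δ k}` that arises from moving `δ` into the strip. -/
lemma exp_mul_planck_le {δ : ℝ} (h0 : 0 ≤ δ) (h1 : δ ≤ Real.pi) (k : ℝ) :
    Real.exp (δ * k) * planck k ≤ 1 + |k| := by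
  rcases le_total 0 k with hk | hk
  · have := planck_le_of_nonneg hk
    calc Real.exp (δ * k) * planck k ≤ Real.exp (δ * k) * Real.exp (-(Real.pi * k)) := by gcongr
      _ = Real.exp ((δ - Real.pi) * k) := by rw [← Real.exp_add]; ring_nf
      _ ≤ 1 := Real.exp_le_one_iff.2 (by nlinarith)
      _ ≤ 1 + |k| := by simp
  · have h2 := planck_le_of_nonpos hk
    have h3 : Real.exp (δ * k) ≤ 1 := Real.exp_le_one_iff.2 (by nlinarith)
    rw [abs_of_nonpos hk]
    have := planck_nonneg k
    nlinarith

lemma planck_le (k : ℝ) : planck k ≤ 1 + |k| := by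
  simpa using exp_mul_planck_le le_rfl Real.pi_pos.le k

lemma norm_mul_cexp_neg_mul {a : ℂ} {k : ℝ} (hk : 0 ≤ k) :
    ‖(k : ℂ) * cexp (-(a * k))‖ = k * Real.exp (-(a.re * k)) := by
  rw [norm_mul, Complex.norm_real, Complex.norm_exp, Real.norm_of_nonneg hk]
  simp

lemma integral_mul_rexp_neg_mul_Ioi_zero {r : ℝ} (hr : 0 < r) :
    ∫ k in Ioi (0 : ℝ), k * Real.exp (-(r * k)) = 1 / r ^ 2 := by
  have h := Real.integral_rpow_mul_exp_neg_mul_Ioi (a := 2) two_pos hr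
  norm_num at h
  simpa using h

lemma integrableOn_mul_cexp_neg_mul_Ioi_zero {a : ℂ} (ha : 0 < a.re) :
    IntegrableOn (fun k : ℝ => (k : ℂ) * cexp (-(a * k))) (Ioi 0) := by
  have h : IntegrableOn (fun k : ℝ => k * Real.exp (-(a.re * k))) (Ioi 0) :=
    .of_integral_ne_zero (by rw [integral_mul_rexp_neg_mul_Ioi_zero ha]; positivity)
  refine Integrable.mono' h (by fun_prop) ?_
  filter_upwards [ae_restrict_mem measurableSet_Ioi] with k hk
  exact (norm_mul_cexp_neg_mul hk.le).le

lemma integral_mul_cexp_neg_mul_Ioi_zero {a : ℂ} (ha : 0 < a.re) :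
    ∫ k in Ioi (0 : ℝ), (k : ℂ) * cexp (-(a * k)) = 1 / a ^ 2 := by
  have ha0 : a ≠ 0 := by rintro rfl; simp at ha
  have hd : ∀ x ∈ Ici (0 : ℝ), HasDerivAt
      (fun k : ℝ => -((k : ℂ) / a + 1 / a ^ 2) * cexp (-(a * k)))
      ((x : ℂ) * cexp (-(a * x))) x := by
    intro x _
    have h1 : HasDerivAt (fun k : ℝ => (k : ℂ)) 1 x := Complex.ofRealCLM.hasDerivAt
    have h2 := (((h1.div_const a).add_const (1 / a ^ 2)).neg).mul ((h1.const_mul a).neg.cexp)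
    refine HasDerivAt.congr_deriv h2 ?_
    simp only [Pi.neg_apply]
    generalize cexp (-(a * x)) = e
    field_simp
    ring
  have ht : Tendsto (fun k : ℝ => -((k : ℂ) / a + 1 / a ^ 2) * cexp (-(a * k))) atTop (𝓝 0) := by
    have t1 := tendsto_rpow_mul_exp_neg_mul_atTop_nhds_zero 1 a.re ha
    have t0 := tendsto_rpow_mul_exp_neg_mul_atTop_nhds_zero 0 a.re ha
    have t := (t1.const_mul ‖a‖⁻¹).add (t0.const_mul (‖a‖ ^ 2)⁻¹)
    simp only [mul_zero, add_zero, Real.rpow_one, Real.rpow_zero, one_mul] at t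
    refine squeeze_zero_norm' ?_ t
    filter_upwards [eventually_ge_atTop (0 : ℝ)] with k hk
    rw [norm_mul, norm_neg, Complex.norm_exp]
    have : (-(a * (k : ℂ))).re = -a.re * k := by simp
    rw [this]
    have h2 : ‖(k : ℂ) / a + 1 / a ^ 2‖ ≤ ‖a‖⁻¹ * k + (‖a‖ ^ 2)⁻¹ := by
      refine (norm_add_le _ _).trans (le_of_eq ?_)
      simp [abs_of_nonneg hk]
      ring
    calc _ ≤ (‖a‖⁻¹ * k + (‖a‖ ^ 2)⁻¹) * Real.exp (-a.re * k) := by gcongr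
      _ = _ := by ring
  rw [integral_Ioi_of_hasDerivAt_of_tendsto' hd (integrableOn_mul_cexp_neg_mul_Ioi_zero ha) ht]
  simp

lemma tsum_bose_term {k : ℝ} (hk : 0 < k) (c : ℂ) :
    ∑' n : ℕ, (k : ℂ) * cexp (-((2 * Real.pi * n + c) * k))
      = (planck (-k) : ℂ) * cexp (-(c * k)) := by
  have hr : ‖cexp (-(2 * Real.pi * k))‖ < 1 := by
    rw [Complex.norm_exp]
    simp only [Real.exp_lt_one_iff]
    simp
    positivity
  have hg := (hasSum_geometric_of_norm_lt_one hr).mul_left ((k : ℂ) * cexp (-(c * k)))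
  have e : (fun n : ℕ => (k : ℂ) * cexp (-((2 * Real.pi * n + c) * k)))
      = fun n : ℕ => (k : ℂ) * cexp (-(c * k)) * cexp (-(2 * Real.pi * k)) ^ n := by
    funext n
    rw [← Complex.exp_nat_mul, mul_assoc (k : ℂ), ← Complex.exp_add]
    ring_nf
  simp only [e, hg.tsum_eq]
  unfold planck
  push_cast
  rw [show (2 * Real.pi * -k : ℂ) = -(2 * Real.pi * k) by ring]
  have h1 : 1 - cexp (-(2 * Real.pi * k)) ≠ 0 := by
    intro h0
    rw [sub_eq_zero] at h0
    rw [← h0] at hr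
    simp at hr
  generalize cexp (-(2 * Real.pi * k)) = q at *
  have h2 : q - 1 ≠ 0 := fun h => h1 (by rw [← neg_sub, h, neg_zero])
  rw [← neg_sub 1 q]
  field_simp

/-- Half of the kernel: expand the Bose factor into a geometric series and integrate termwise. -/
lemma hasSum_integral_bose {c : ℂ} (hc : 0 < c.re) :
    HasSum (fun n : ℕ => 1 / (2 * Real.pi * n + c) ^ 2)
      (∫ k in Ioi (0 : ℝ), (planck (-k) : ℂ) * cexp (-(c * k))) := by
  have hre : ∀ n : ℕ, (2 * Real.pi * n + c).re = 2 * Real.pi * n + c.re := by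
    intro n; simp
  have hpos : ∀ n : ℕ, 0 < (2 * Real.pi * n + c).re := by
    intro n; rw [hre]; have := Real.pi_pos; positivity
  have h := hasSum_integral_of_summable_integral_norm
    (F := fun (n : ℕ) (k : ℝ) => (k : ℂ) * cexp (-((2 * Real.pi * n + c) * k)))
    (μ := volume.restrict (Ioi 0)) (fun n => integrableOn_mul_cexp_neg_mul_Ioi_zero (hpos n)) ?_
  · simp only [integral_mul_cexp_neg_mul_Ioi_zero (hpos _)] at h
    have e0 : ∫ k in Ioi (0 : ℝ), (planck (-k) : ℂ) * cexp (-(c * k))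
        = ∫ k in Ioi (0 : ℝ), ∑' n : ℕ, (k : ℂ) * cexp (-((2 * Real.pi * n + c) * k)) := by
      refine setIntegral_congr_fun measurableSet_Ioi fun k (hk : (0 : ℝ) < k) => Eq.symm ?_
      exact tsum_bose_term hk c
    rw [e0]
    exact h
  · have e : ∀ n : ℕ, ∫ k in Ioi (0 : ℝ), ‖(k : ℂ) * cexp (-((2 * Real.pi * n + c) * k))‖
        = ((2 * Real.pi) ^ 2)⁻¹ * (1 / |n + c.re / (2 * Real.pi)| ^ (2 : ℝ)) := by
      intro n
      have e1 : EqOn (fun k : ℝ => ‖(k : ℂ) * cexp (-((2 * Real.pi * n + c) * k))‖)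
          (fun k => k * Real.exp (-((2 * Real.pi * n + c).re * k))) (Ioi 0) :=
        fun k (hk : (0 : ℝ) < k) => norm_mul_cexp_neg_mul hk.le
      rw [setIntegral_congr_fun measurableSet_Ioi e1, integral_mul_rexp_neg_mul_Ioi_zero (hpos n),
        hre]
      have := Real.pi_pos
      rw [abs_of_nonneg (by positivity)]
      norm_cast
      field_simp
    simp only [e]
    exact ((Real.summable_one_div_nat_add_rpow _ 2).2 one_lt_two).mul_left _

lemma integrableOn_bose {c : ℂ} (hc : 0 < c.re) :
    IntegrableOn (fun k : ℝ => (planck (-k) : ℂ) * cexp (-(c * k))) (Ioi 0) := by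
  have h1 := (integrableOn_mul_cexp_neg_mul_Ioi_zero hc).norm
  have h0 := (integrableOn_exp_mul_complex_Ioi (a := -c) (by simpa using hc) 0).norm
  refine Integrable.mono' (h1.add h0) ?_ ?_
  · have := measurable_planck
    exact (by fun_prop : Measurable _).aestronglyMeasurable
  · filter_upwards [ae_restrict_mem measurableSet_Ioi] with k hk
    have hk : 0 < k := hk
    have h := planck_le_of_nonpos (k := -k) (by linarith)
    simp only [Pi.add_apply, norm_mul, Complex.norm_real, Real.norm_of_nonneg (planck_nonneg _),
      Real.norm_of_nonneg hk.le, neg_mul]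
    have := norm_nonneg (cexp (-(c * k)))
    nlinarith

/-- This turns the integral over `k > 0` into one over `k < 0`, with `2π - p` in place of `p`. -/
lemma planck_mul_cexp_eq (p : ℂ) (k : ℝ) :
    (planck k : ℂ) * cexp (p * k) = (planck (-k) : ℂ) * cexp (-((2 * Real.pi - p) * k)) := by
  rw [planck_neg, planck_add_self]
  push_cast
  rw [mul_right_comm, ← Complex.exp_add]
  ring_nf

lemma integrable_planck_mul_cexp {p : ℂ} (h0 : 0 < p.re) (h1 : p.re < 2 * Real.pi) :
    Integrable (fun k : ℝ => (planck k : ℂ) * cexp (p * k)) := by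
  rw [← integrableOn_univ, ← Iic_union_Ioi (a := (0 : ℝ))]
  refine IntegrableOn.union ?_ ?_
  · have := integrableOn_bose h0
    rw [← neg_zero, ← integrableOn_Ici_iff_integrableOn_Ioi] at this
    have h := this.comp_neg_Iic
    simpa using h
  · simp only [planck_mul_cexp_eq]
    exact integrableOn_bose (by simpa using h1)

lemma hasSum_int_integral_planck_mul_cexp {p : ℂ} (h0 : 0 < p.re) (h1 : p.re < 2 * Real.pi) :
    HasSum (fun n : ℤ => 1 / (2 * Real.pi * n + p) ^ 2)
      (∫ k : ℝ, (planck k : ℂ) * cexp (p * k)) := by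
  have hi := integrable_planck_mul_cexp h0 h1
  rw [← intervalIntegral.integral_Iic_add_Ioi (b := 0) hi.integrableOn hi.integrableOn]
  refine HasSum.of_nat_of_neg_add_one ?_ ?_
  · have h := hasSum_integral_bose h0
    have e := integral_comp_neg_Ioi 0 (fun k : ℝ => (planck k : ℂ) * cexp (p * k))
    rw [neg_zero] at e
    rw [← e]
    simpa using h
  · have h := hasSum_integral_bose (c := 2 * Real.pi - p) (by simpa using h1)
    simp only [planck_mul_cexp_eq]
    convert h using 2 with n
    push_cast
    congr 1
    ring

/-- The sum over all residues is the classical expansion of `1 / sin²`. -/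
lemma tsum_int_one_div_sq {p : ℂ} (hp : 0 < p.im) :
    ∑' n : ℤ, 1 / (2 * Real.pi * n + p) ^ 2 = -cexp (I * p) / (1 - cexp (I * p)) ^ 2 := by
  have hpi : (Real.pi : ℂ) ≠ 0 := by exact_mod_cast Real.pi_ne_zero
  have hz : 0 < (p / (2 * Real.pi)).im := by
    rw [show (2 * Real.pi : ℂ) = ((2 * Real.pi : ℝ) : ℂ) by push_cast; ring, Complex.div_ofReal_im]
    have := Real.pi_pos
    positivity
  have h := EisensteinSeries.qExpansion_identity (k := 1) le_rfl ⟨p / (2 * Real.pi), hz⟩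
  have e : 2 * Real.pi * I * (p / (2 * Real.pi)) = I * p := by field_simp
  have hq : ‖cexp (I * p)‖ < 1 := by
    rw [Complex.norm_exp]
    simpa using hp
  have hs := tsum_coe_mul_geometric_of_norm_lt_one hq
  simp only [e, pow_one, hs] at h
  have e2 : ∀ n : ℤ, 1 / (2 * Real.pi * n + p) ^ 2
      = ((2 * Real.pi : ℂ) ^ 2)⁻¹ * (1 / (p / (2 * Real.pi) + n) ^ (1 + 1)) := by
    intro n
    rw [one_div, one_div, ← mul_inv, ← mul_pow]
    congr 2
    field_simp
    ring
  simp only [e2, tsum_mul_left, h]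
  simp only [Nat.factorial_one, Nat.cast_one, div_one]
  have hI : (-2 * Real.pi * I : ℂ) ^ 2 = -(2 * Real.pi) ^ 2 := by
    rw [mul_pow, I_sq]; ring
  have h2 : (2 * Real.pi : ℂ) ^ 2 ≠ 0 := pow_ne_zero 2 (mul_ne_zero two_ne_zero hpi)
  rw [show 1 + 1 = 2 from rfl, hI]
  field_simp

/-- The Fourier transform of the Planck factor is the Rindler kernel `-1 / (4 sinh² (w / 2))`. -/
lemma integral_planck_mul_cexp {w : ℂ} (h0 : w.im < 0) (h1 : -(2 * Real.pi) < w.im)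
    (hre : w.re ≠ 0) :
    ∫ k : ℝ, (planck k : ℂ) * cexp (I * w * k) = -cexp w / (1 - cexp w) ^ 2 := by
  have hs := (hasSum_int_integral_planck_mul_cexp (p := I * w) (by simpa using h0)
    (by simp; linarith)).tsum_eq
  rw [← hs]
  rcases hre.lt_or_gt with hre | hre
  · rw [← (Equiv.neg ℤ).tsum_eq]
    have h := tsum_int_one_div_sq (p := -(I * w)) (by simpa using hre)
    have e : I * -(I * w) = w := by
      rw [mul_neg, ← mul_assoc, I_mul_I]; ring
    rw [e] at h
    rw [← h]
    refine tsum_congr fun n => ?_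
    simp only [Equiv.neg_apply]
    push_cast
    congr 1
    ring
  · have h := tsum_int_one_div_sq (p := I * w) (by simpa using hre)
    have e : I * (I * w) = -w := by
      rw [← mul_assoc, I_mul_I]; ring
    rw [e] at h
    rw [h, Complex.exp_neg]
    have hw := Complex.exp_ne_zero w
    have h3 : cexp w ≠ 1 := by
      intro h
      have := congrArg norm h
      rw [Complex.norm_exp] at this
      simp at this
      linarith
    generalize cexp w = q at *
    have h4 : 1 - q ≠ 0 := sub_ne_zero.2 h3.symm
    have h5 : 1 - q⁻¹ = -(1 - q) / q := by field_simp; ring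
    rw [h5]
    field_simp

/-! ### The Fourier transform and functions of `D` -/

open FourierTransform in
lemma fourierT_eq_fourier (f : ℝ → ℂ) (k : ℝ) :
    fourierT f k = (√(2 * Real.pi) : ℂ)⁻¹ * 𝓕 f (-(k / (2 * Real.pi))) := by
  rw [fourierT, Real.fourier_eq']
  congr 2
  funext x
  rw [smul_eq_mul]
  congr 2
  have : (Real.pi : ℂ) ≠ 0 := by exact_mod_cast Real.pi_ne_zero
  simp
  field_simp

lemma sqrt_two_pi_ne_zero : (√(2 * Real.pi) : ℂ) ≠ 0 := by
  have := Real.pi_pos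
  exact_mod_cast (Real.sqrt_pos.2 (by positivity)).ne'

lemma sqrt_two_pi_mul_self : (√(2 * Real.pi) : ℂ) * √(2 * Real.pi) = 2 * Real.pi := by
  have := Real.pi_pos
  exact_mod_cast Real.mul_self_sqrt (show 0 ≤ 2 * Real.pi by positivity)

lemma norm_sqrt_two_pi_inv_le : ‖(√(2 * Real.pi) : ℂ)⁻¹‖ ≤ 1 := by
  rw [norm_inv, Complex.norm_real, Real.norm_of_nonneg (Real.sqrt_nonneg _)]
  refine inv_le_one_of_one_le₀ (Real.one_le_sqrt.2 ?_)
  have := Real.pi_gt_three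
  linarith

lemma norm_cexp_I_mul_mul (k x : ℝ) : ‖cexp (I * k * x)‖ = 1 := by
  rw [Complex.norm_exp]; simp

lemma norm_cexp_neg_I_mul_mul (k x : ℝ) : ‖cexp (-(I * k * x))‖ = 1 := by
  rw [Complex.norm_exp]; simp

lemma norm_fourierT_le (f : ℝ → ℂ) (k : ℝ) : ‖fourierT f k‖ ≤ ∫ x, ‖f x‖ := by
  rw [fourierT, norm_mul]
  have h : ‖∫ x : ℝ, cexp (I * k * x) * f x‖ ≤ ∫ x, ‖f x‖ := by
    refine (norm_integral_le_integral_norm _).trans (le_of_eq ?_)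
    simp [norm_cexp_I_mul_mul]
  calc _ ≤ 1 * ∫ x, ‖f x‖ := by
        gcongr
        exact norm_sqrt_two_pi_inv_le
    _ = _ := one_mul _

/-- A smooth function all of whose derivatives are integrable. -/
structure SmoothL1 (f : ℝ → ℂ) : Prop where
  smooth : ContDiff ℝ ∞ f
  integrable : ∀ n, Integrable (iteratedDeriv n f)

namespace SmoothL1

variable {f : ℝ → ℂ}

lemma integrable_self (h : SmoothL1 f) : Integrable f := by simpa using h.integrable 0

lemma deriv (h : SmoothL1 f) : SmoothL1 (deriv f) :=
  ⟨(contDiff_infty_iff_deriv.1 h.smooth).2, fun n => by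
    simpa [← iteratedDeriv_succ'] using h.integrable (n + 1)⟩

open FourierTransform in
lemma fourierT_iteratedDeriv (h : SmoothL1 f) (n : ℕ) (k : ℝ) :
    fourierT (iteratedDeriv n f) k = (-(I * k)) ^ n * fourierT f k := by
  rw [fourierT_eq_fourier, fourierT_eq_fourier,
    Real.fourier_iteratedDeriv (N := ⊤) h.smooth (fun n _ => h.integrable n) le_top]
  have : (Real.pi : ℂ) ≠ 0 := by exact_mod_cast Real.pi_ne_zero
  simp only [smul_eq_mul]
  push_cast
  rw [show (2 * Real.pi * I * -(k / (2 * Real.pi)) : ℂ) = -(I * k) by field_simp]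
  ring

lemma fourierT_deriv (h : SmoothL1 f) (k : ℝ) :
    fourierT (_root_.deriv f) k = -(I * k) * fourierT f k := by
  simpa using h.fourierT_iteratedDeriv 1 k

/-- Decay of fourth order: enough for products of two Fourier transforms, and for one of them with a
multiplier of linear growth, to be integrable. -/
lemma norm_fourierT_mul_le (h : SmoothL1 f) (k : ℝ) :
    ‖fourierT f k‖ * (1 + k ^ 2) ^ 2 ≤
      (∫ x, ‖f x‖) + 2 * (∫ x, ‖iteratedDeriv 2 f x‖) + ∫ x, ‖iteratedDeriv 4 f x‖ := by
  have h0 := norm_fourierT_le f k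
  have h2 := norm_fourierT_le (iteratedDeriv 2 f) k
  have h4 := norm_fourierT_le (iteratedDeriv 4 f) k
  rw [h.fourierT_iteratedDeriv] at h2 h4
  simp only [norm_mul, norm_pow, norm_neg, norm_I, one_mul, Complex.norm_real, Real.norm_eq_abs,
    sq_abs] at h2 h4
  rw [show |k| ^ 4 = (k ^ 2) ^ 2 by rw [← sq_abs k]; ring] at h4
  nlinarith

end SmoothL1

lemma integrable_inv_one_add_sq_sq_mul :
    Integrable (fun k : ℝ => ((1 + k ^ 2) ^ 2)⁻¹ * (1 + |k|)) := by
  refine Integrable.mono' (integrable_inv_one_add_sq.const_mul 2) (by fun_prop)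
    (Eventually.of_forall fun k => ?_)
  rw [Real.norm_of_nonneg (by positivity), ← div_eq_inv_mul, ← div_eq_mul_inv,
    div_le_div_iff₀ (by positivity) (by positivity)]
  have : |k| ≤ 1 + k ^ 2 := by
    rw [← sq_abs]; nlinarith [abs_nonneg k]
  have h2 : 0 ≤ k ^ 2 := sq_nonneg k
  nlinarith [mul_nonneg h2 (abs_nonneg k)]

lemma stronglyMeasurable_fourierT {f : ℝ → ℂ} (hf : StronglyMeasurable f) :
    StronglyMeasurable (fun k : ℝ => fourierT f k) := by
  unfold fourierT
  refine StronglyMeasurable.const_mul (StronglyMeasurable.integral_prod_right ?_) _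
  have := hf.measurable
  exact (by unfold Function.uncurry; fun_prop : Measurable _).stronglyMeasurable

/-- A multiplier of at most linear growth. -/
structure LinearGrowth (q : ℝ → ℂ) : Prop where
  measurable : Measurable q
  bound : ∃ C, ∀ k, ‖q k‖ ≤ C * (1 + |k|)

lemma SmoothL1.integrable_mul_fourierT {f : ℝ → ℂ} (h : SmoothL1 f) {q : ℝ → ℂ}
    (hq : LinearGrowth q) : Integrable (fun k : ℝ => q k * fourierT f k) := by
  obtain ⟨C, hC⟩ := hq.bound
  set A := (∫ x, ‖f x‖) + 2 * (∫ x, ‖iteratedDeriv 2 f x‖) + ∫ x, ‖iteratedDeriv 4 f x‖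
  refine Integrable.mono' (integrable_inv_one_add_sq_sq_mul.const_mul (C * A))
    (hq.measurable.aestronglyMeasurable.mul
      (stronglyMeasurable_fourierT h.smooth.continuous.stronglyMeasurable).aestronglyMeasurable)
    (Eventually.of_forall fun k => ?_)
  have h1 := h.norm_fourierT_mul_le k
  have h2 : ‖fourierT f k‖ ≤ A * ((1 + k ^ 2) ^ 2)⁻¹ := by
    rw [← div_eq_mul_inv, le_div_iff₀ (by positivity)]
    exact h1
  have h3 := hC k
  rw [norm_mul]
  calc _ ≤ (C * (1 + |k|)) * (A * ((1 + k ^ 2) ^ 2)⁻¹) := by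
        gcongr
        exact (norm_nonneg _).trans h3
    _ = _ := by ring

lemma linearGrowth_one : LinearGrowth 1 :=
  ⟨measurable_const, 1, fun k => by simp⟩

lemma linearGrowth_self : LinearGrowth (fun k => (k : ℂ)) :=
  ⟨by fun_prop, 1, fun k => by simp⟩

lemma LinearGrowth.add {q r : ℝ → ℂ} (hq : LinearGrowth q) (hr : LinearGrowth r) :
    LinearGrowth (fun k => q k + r k) := by
  obtain ⟨C, hC⟩ := hq.bound
  obtain ⟨D, hD⟩ := hr.bound
  refine ⟨hq.measurable.add hr.measurable, C + D, fun k => (norm_add_le _ _).trans ?_⟩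
  linarith [hC k, hD k]

lemma LinearGrowth.neg {q : ℝ → ℂ} (hq : LinearGrowth q) : LinearGrowth (fun k => -q k) := by
  obtain ⟨C, hC⟩ := hq.bound
  exact ⟨hq.measurable.neg, C, fun k => by simpa using hC k⟩

lemma LinearGrowth.indicator {q : ℝ → ℂ} (hq : LinearGrowth q) {S : Set ℝ}
    (hS : MeasurableSet S) : LinearGrowth (S.indicator q) := by
  obtain ⟨C, hC⟩ := hq.bound
  exact ⟨hq.measurable.indicator hS, C, fun k => (norm_indicator_le_norm_self _ _).trans (hC k)⟩

lemma linearGrowth_planck : LinearGrowth (fun k => (planck k : ℂ)) :=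
  ⟨by have := measurable_planck; fun_prop, 1, fun k => by
    rw [Complex.norm_real, Real.norm_of_nonneg (planck_nonneg k), one_mul]
    exact planck_le k⟩

open FourierTransform in
lemma SmoothL1.functionOfD_one {f : ℝ → ℂ} (h : SmoothL1 f) (x : ℝ) :
    functionOfD 1 f x = f x := by
  have hpi : (Real.pi : ℂ) ≠ 0 := by exact_mod_cast Real.pi_ne_zero
  have hpi' := Real.pi_pos
  have hi := h.integrable_mul_fourierT linearGrowth_one
  have hF : Integrable (𝓕 f) := by
    have h2 := (hi.const_mul (√(2 * Real.pi) : ℂ)).comp_mul_left' (R := -(2 * Real.pi))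
      (by simp [Real.pi_ne_zero])
    refine h2.congr (Eventually.of_forall fun k => ?_)
    simp only [Pi.one_apply, one_mul]
    rw [fourierT_eq_fourier, mul_inv_cancel_left₀ sqrt_two_pi_ne_zero]
    field_simp
  have h1 := congrFun (h.smooth.continuous.fourierInv_fourier_eq h.integrable_self hF) x
  rw [Real.fourierInv_eq'] at h1
  have h3 := Measure.integral_comp_mul_left
    (fun k : ℝ => cexp (-(I * k * x)) * ((1 : ℝ → ℂ) k * fourierT f k)) (-(2 * Real.pi))
  have h4 : |(-(2 * Real.pi))⁻¹| = (2 * Real.pi)⁻¹ := by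
    rw [inv_neg, abs_neg, abs_of_pos (by positivity)]
  rw [h4] at h3
  have h5 : (∫ k : ℝ, cexp (-(I * k * x)) * ((1 : ℝ → ℂ) k * fourierT f k))
      = (2 * Real.pi : ℂ) * ∫ k : ℝ, cexp (-(I * ((-(2 * Real.pi) * k : ℝ)) * x)) *
        ((1 : ℝ → ℂ) (-(2 * Real.pi) * k) * fourierT f (-(2 * Real.pi) * k : ℝ)) := by
    rw [h3, Complex.real_smul]
    push_cast
    rw [← mul_assoc, mul_inv_cancel₀ (mul_ne_zero two_ne_zero hpi), one_mul]
  rw [functionOfD, h5, ← h1, ← integral_const_mul, ← integral_const_mul]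
  refine integral_congr_ae (Eventually.of_forall fun k => ?_)
  simp only [Pi.one_apply, one_mul, fourierT_eq_fourier, smul_eq_mul]
  rw [show -(-(2 * Real.pi) * k / (2 * Real.pi)) = k by field_simp]
  have : cexp (-(I * ((-(2 * Real.pi) * k : ℝ)) * x))
      = cexp (↑(2 * Real.pi * inner ℝ k x) * I) := by
    congr 1
    simp
    ring
  rw [this]
  have hs := sqrt_two_pi_mul_self
  have hs0 := sqrt_two_pi_ne_zero
  rw [← hs]
  field_simp

/-- **Parseval's formula** for a multiplier; the left function only has to be integrable. -/
lemma integral_conj_mul_functionOfD {a b q : ℝ → ℂ} (ha : Integrable a)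
    (hq : Integrable (fun k : ℝ => q k * fourierT b k)) :
    ∫ x, (starRingEnd ℂ) (a x) * functionOfD q b x
      = ∫ k : ℝ, (starRingEnd ℂ) (fourierT a k) * (q k * fourierT b k) := by
  have hac : Integrable (fun x => (starRingEnd ℂ) (a x)) :=
    Complex.conjLIE.integrable_comp_iff.2 ha
  have hi : Integrable (Function.uncurry fun (x : ℝ) (k : ℝ) => (√(2 * Real.pi) : ℂ)⁻¹ *
      (cexp (-(I * k * x)) * ((starRingEnd ℂ) (a x) * (q k * fourierT b k))))
      (volume.prod volume) := by
    refine Integrable.const_mul ?_ _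
    refine (hac.mul_prod hq).bdd_mul (c := 1) ?_ ?_
    · exact (by fun_prop : Measurable _).aestronglyMeasurable
    · exact Eventually.of_forall fun p => (norm_cexp_neg_I_mul_mul _ _).le
  calc _ = ∫ x : ℝ, ∫ k : ℝ, (√(2 * Real.pi) : ℂ)⁻¹ *
      (cexp (-(I * k * x)) * ((starRingEnd ℂ) (a x) * (q k * fourierT b k))) := by
        refine integral_congr_ae (Eventually.of_forall fun x => ?_)
        simp only [functionOfD]
        rw [← integral_const_mul, ← integral_const_mul]
        refine integral_congr_ae (Eventually.of_forall fun k => ?_)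
        simp only
        ring
    _ = _ := by
        rw [integral_integral_swap hi]
        refine integral_congr_ae (Eventually.of_forall fun k => ?_)
        simp only [fourierT]
        rw [map_mul, ← integral_conj, integral_const_mul, mul_assoc]
        simp only [map_inv₀, Complex.conj_ofReal]
        congr 1
        rw [← integral_mul_const]
        refine integral_congr_ae (Eventually.of_forall fun x => ?_)
        simp only [map_mul, ← Complex.exp_conj, Complex.conj_ofReal, Complex.conj_I]
        ring_nf

lemma fourierT_comp_sub (f : ℝ → ℂ) (b : ℝ) (z : ℂ) :
    fourierT (fun x => f (x - b)) z = cexp (I * z * b) * fourierT f z := by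
  rw [fourierT, fourierT, ← integral_sub_right_eq_self (fun x : ℝ => cexp (I * z * x) * f x) b,
    mul_left_comm, ← integral_const_mul (cexp (I * z * b))]
  congr 2
  funext x
  rw [← mul_assoc, ← Complex.exp_add]
  push_cast
  ring_nf

lemma fourierT_const_mul (f : ℝ → ℂ) (c z : ℂ) :
    fourierT (fun x => c * f x) z = c * fourierT f z := by
  rw [fourierT, fourierT, mul_left_comm, ← integral_const_mul c]
  congr 2
  funext x
  ring

/-! ### Positive `U`-frequencies of functions on the half-line `U < 0` -/

lemma image_neg_exp : (fun u : ℝ => -Real.exp u) '' univ = Iio 0 := by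
  ext x
  simp only [image_univ, mem_range, mem_Iio]
  constructor
  · rintro ⟨u, rfl⟩
    have := Real.exp_pos u
    linarith
  · intro hx
    exact ⟨Real.log (-x), by rw [Real.exp_log (by linarith)]; ring⟩

lemma injOn_neg_exp : InjOn (fun u : ℝ => -Real.exp u) univ := fun _ _ _ _ h =>
  Real.exp_injective (neg_injective h)

lemma hasDerivWithinAt_neg_exp (u : ℝ) (S : Set ℝ) :
    HasDerivWithinAt (fun u : ℝ => -Real.exp u) (-Real.exp u) S u :=
  (Real.hasDerivAt_exp u).neg.hasDerivWithinAt

/-- Substitution `x = -e^u` for functions supported in `x < 0`. -/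
lemma integral_comp_neg_exp {E : Type*} [NormedAddCommGroup E] [NormedSpace ℝ E] {F : ℝ → E}
    (hF : ∀ x, 0 ≤ x → F x = 0) : ∫ x, F x = ∫ u : ℝ, Real.exp u • F (-Real.exp u) := by
  rw [← setIntegral_eq_integral_of_forall_compl_eq_zero (s := Iio 0)
    (fun x hx => hF x (by simpa using hx)), ← image_neg_exp,
    integral_image_eq_integral_abs_deriv_smul MeasurableSet.univ
      (fun u _ => hasDerivWithinAt_neg_exp u _) injOn_neg_exp]
  simp

lemma integrable_comp_neg_exp_iff {E : Type*} [NormedAddCommGroup E] [NormedSpace ℝ E] {F : ℝ → E}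
    (hF : ∀ x, 0 ≤ x → F x = 0) :
    Integrable F ↔ Integrable (fun u : ℝ => Real.exp u • F (-Real.exp u)) := by
  have h := integrableOn_image_iff_integrableOn_abs_deriv_smul MeasurableSet.univ
      (fun u _ => hasDerivWithinAt_neg_exp u _) injOn_neg_exp F
  rw [image_neg_exp, integrableOn_univ] at h
  simp only [abs_neg, Real.abs_exp] at h
  rw [← h]
  refine (integrableOn_iff_integrable_of_support_subset fun x hx => ?_).symm
  by_contra hx'
  exact hx (hF x (by simpa using hx'))

lemma linearGrowth_indicator_Ici : LinearGrowth (indicator (Ici 0) 1) :=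
  linearGrowth_one.indicator measurableSet_Ici

/-- The positive frequency part of `D h` extends to the lower half-plane, where it is a Cauchy
integral. -/
lemma positiveFrequency_eq_cauchy {h' : ℝ → ℂ} (hh : Integrable h') {z : ℂ}
    (hz : z.im < 0) :
    (√(2 * Real.pi) : ℂ)⁻¹ * ∫ k : ℝ, cexp (-(I * k * z)) *
        (indicator (Ici 0) (1 : ℝ → ℂ) k * fourierT (fun y => I * h' y) k)
      = -(2 * Real.pi : ℂ)⁻¹ * ∫ y : ℝ, h' y / (y - z) := by
  have hre : (-(I * z)).re < 0 := by simpa using hz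
  have hi : Integrable (Function.uncurry fun (k : ℝ) (y : ℝ) =>
      cexp (I * k * y) * (cexp (-(I * z) * k) * h' y))
      ((volume.restrict (Ioi 0)).prod volume) := by
    refine ((integrableOn_exp_mul_complex_Ioi hre 0).mul_prod hh).bdd_mul (c := 1) ?_ ?_
    · exact (by fun_prop : Measurable _).aestronglyMeasurable
    · exact Eventually.of_forall fun p => (norm_cexp_I_mul_mul _ _).le
  have e1 : ∫ k : ℝ, cexp (-(I * k * z)) *
        (indicator (Ici 0) (1 : ℝ → ℂ) k * fourierT (fun y => I * h' y) k)
      = ∫ k in Ioi (0 : ℝ), cexp (-(I * k * z)) * fourierT (fun y => I * h' y) k := by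
    rw [← integral_Ici_eq_integral_Ioi, ← integral_indicator measurableSet_Ici]
    congr 1
    funext k
    by_cases hk : k ∈ Ici (0 : ℝ) <;> simp [hk]
  have e2 : ∫ k in Ioi (0 : ℝ), cexp (-(I * k * z)) * fourierT (fun y => I * h' y) k
      = I * (√(2 * Real.pi) : ℂ)⁻¹ * ∫ k in Ioi (0 : ℝ), ∫ y : ℝ,
        cexp (I * k * y) * (cexp (-(I * z) * k) * h' y) := by
    rw [← integral_const_mul]
    congr 1
    funext k
    rw [fourierT_const_mul, fourierT, ← integral_const_mul, ← integral_const_mul,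
      ← integral_const_mul, ← integral_const_mul]
    congr 1
    funext y
    rw [show -(I * k * z) = -(I * z) * k by ring]
    ring
  have e3 : ∀ y : ℝ, ∫ k in Ioi (0 : ℝ), cexp (I * k * y) * (cexp (-(I * z) * k) * h' y)
      = I * (h' y / (y - z)) := by
    intro y
    have hne : (y : ℂ) - z ≠ 0 := by
      intro h0
      have := congrArg Complex.im h0
      simp at this
      exact hz.ne this
    have h1 := integral_exp_mul_complex_Ioi (a := I * (y - z)) (by simpa using hz) 0
    have h2 : ∀ k : ℝ, cexp (I * k * y) * (cexp (-(I * z) * k) * h' y)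
        = cexp (I * (y - z) * k) * h' y := by
      intro k
      rw [← mul_assoc, ← Complex.exp_add]
      ring_nf
    simp only [h2, integral_mul_const]
    rw [h1]
    simp only [ofReal_zero, mul_zero, Complex.exp_zero]
    have hI : (I : ℂ)⁻¹ = -I := Complex.inv_I
    rw [← div_div, neg_div, one_div, hI]
    ring
  rw [e1, e2, integral_integral_swap hi]
  simp only [e3, integral_const_mul]
  have hs := sqrt_two_pi_mul_self
  rw [← hs, mul_inv]
  linear_combination (√(2 * Real.pi) : ℂ)⁻¹ * (√(2 * Real.pi) : ℂ)⁻¹ *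
    (∫ y : ℝ, h' y / (y - z)) * I_mul_I

/-! #### The kernel `1 / (1 - e^w)` -/

lemma sin_le_norm_one_sub_cexp (w : ℂ) : |Real.sin w.im| ≤ ‖1 - cexp w‖ := by
  rw [← abs_of_nonneg (norm_nonneg (1 - cexp w)), ← sq_le_sq, Complex.sq_norm, Complex.normSq_apply]
  simp only [sub_re, one_re, sub_im, one_im, Complex.exp_re, Complex.exp_im]
  nlinarith [Real.sin_sq_add_cos_sq w.im, sq_nonneg (Real.exp w.re - Real.cos w.im)]

lemma sub_ofReal_im_sin {ζ : ℂ} (h0 : 0 < ζ.im) (h1 : ζ.im < Real.pi) (v : ℝ) :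
    0 < Real.sin ζ.im ∧ Real.sin ζ.im ≤ ‖1 - cexp (v - ζ)‖ := by
  have h := sin_le_norm_one_sub_cexp (v - ζ)
  have hs := Real.sin_pos_of_pos_of_lt_pi h0 h1
  simp only [sub_im, ofReal_im, zero_sub, Real.sin_neg, abs_neg, abs_of_pos hs] at h
  exact ⟨hs, h⟩

lemma norm_inv_one_sub_cexp_le {ζ : ℂ} (h0 : 0 < ζ.im) (h1 : ζ.im < Real.pi) (v : ℝ) :
    ‖(1 - cexp (v - ζ))⁻¹‖ ≤ (Real.sin ζ.im)⁻¹ := by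
  obtain ⟨hs, h⟩ := sub_ofReal_im_sin h0 h1 v
  rw [norm_inv]
  gcongr

lemma one_sub_cexp_ne_zero {ζ : ℂ} (h0 : 0 < ζ.im) (h1 : ζ.im < Real.pi) (v : ℝ) :
    1 - cexp (v - ζ) ≠ 0 := by
  obtain ⟨hs, h⟩ := sub_ofReal_im_sin h0 h1 v
  exact norm_pos_iff.1 (hs.trans_le h)

lemma norm_cexp_div_sq_le {ζ : ℂ} (h0 : 0 < ζ.im) (h1 : ζ.im < Real.pi) (v : ℝ) :
    ‖cexp (v - ζ) / (1 - cexp (v - ζ)) ^ 2‖ ≤ ((Real.sin ζ.im)⁻¹ + 1) * (Real.sin ζ.im)⁻¹ := by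
  have h := norm_inv_one_sub_cexp_le h0 h1 v
  have hne := one_sub_cexp_ne_zero h0 h1 v
  have e : cexp (v - ζ) / (1 - cexp (v - ζ)) ^ 2
      = ((1 - cexp (v - ζ))⁻¹ - 1) * (1 - cexp (v - ζ))⁻¹ := by
    generalize cexp (v - ζ) = q at *
    field_simp
    ring
  rw [e, norm_mul]
  have h2 : ‖(1 - cexp (v - ζ))⁻¹ - 1‖ ≤ (Real.sin ζ.im)⁻¹ + 1 :=
    (norm_sub_le _ _).trans (by simpa using h)
  have h3 := (norm_nonneg _).trans h2
  gcongr

lemma hasDerivAt_inv_one_sub_cexp {ζ : ℂ} (h0 : 0 < ζ.im) (h1 : ζ.im < Real.pi) (v : ℝ) :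
    HasDerivAt (fun v : ℝ => (1 - cexp (v - ζ))⁻¹)
      (cexp (v - ζ) / (1 - cexp (v - ζ)) ^ 2) v := by
  have hne := one_sub_cexp_ne_zero h0 h1 v
  have h1 : HasDerivAt (fun k : ℝ => (k : ℂ)) 1 v := Complex.ofRealCLM.hasDerivAt
  have h2 := (((h1.sub_const ζ).cexp).const_sub 1).inv hne
  refine HasDerivAt.congr_deriv h2 ?_
  simp

lemma integral_deriv_mul_kernel {H : ℝ → ℂ} (hH : SmoothL1 H) {ζ : ℂ} (h0 : 0 < ζ.im)
    (h1 : ζ.im < Real.pi) :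
    ∫ v : ℝ, deriv H v * (1 - cexp (v - ζ))⁻¹
      = ∫ v : ℝ, H v * (-cexp (v - ζ) / (1 - cexp (v - ζ)) ^ 2) := by
  have hm1 : AEStronglyMeasurable (fun v : ℝ => (1 - cexp (v - ζ))⁻¹) volume :=
    (by fun_prop : Measurable _).aestronglyMeasurable
  have hm2 : AEStronglyMeasurable
      (fun v : ℝ => cexp (v - ζ) / (1 - cexp (v - ζ)) ^ 2) volume :=
    (by fun_prop : Measurable _).aestronglyMeasurable
  have b1 := Eventually.of_forall (f := ae volume) (norm_inv_one_sub_cexp_le h0 h1)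
  have b2 := Eventually.of_forall (f := ae volume) (norm_cexp_div_sq_le h0 h1)
  have h := integral_mul_deriv_eq_deriv_mul_of_integrable
    (u := fun v : ℝ => (1 - cexp (v - ζ))⁻¹) (v := H)
    (fun v _ => hasDerivAt_inv_one_sub_cexp h0 h1 v)
    (fun v _ => (hH.smooth.differentiable (by simp)).differentiableAt.hasDerivAt)
    (hH.deriv.integrable_self.bdd_mul hm1 b1)
    (hH.integrable_self.bdd_mul hm2 b2) (hH.integrable_self.bdd_mul hm1 b1)
  simp only [mul_comm (deriv H _)]
  rw [h, ← integral_neg]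
  congr 1
  funext v
  ring

lemma integral_mul_kernel {H : ℝ → ℂ} (hH : SmoothL1 H) {ζ : ℂ} (h0 : 0 < ζ.im)
    (h1 : ζ.im < Real.pi) :
    ∫ v : ℝ, H v * (-cexp (v - ζ) / (1 - cexp (v - ζ)) ^ 2)
      = √(2 * Real.pi) * ∫ k : ℝ, cexp (-(I * k * ζ)) * (planck k * fourierT H k) := by
  have hpi := Real.pi_pos
  have hre : (-(I * ζ)).re = ζ.im := by simp
  have hi : Integrable (Function.uncurry fun (v : ℝ) (k : ℝ) =>
      cexp (I * k * v) * (H v * (planck k * cexp (-(I * ζ) * k))))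
      (volume.prod volume) := by
    refine (hH.integrable_self.mul_prod (integrable_planck_mul_cexp (p := -(I * ζ))
      (by rwa [hre]) (by rw [hre]; linarith))).bdd_mul (c := 1) ?_ ?_
    · exact (by fun_prop : Measurable _).aestronglyMeasurable
    · exact Eventually.of_forall fun p => (norm_cexp_I_mul_mul _ _).le
  calc _ = ∫ v : ℝ, ∫ k : ℝ, cexp (I * k * v) * (H v * (planck k * cexp (-(I * ζ) * k))) := by
        refine integral_congr_ae ?_
        have hne : ∀ᵐ v : ℝ, v ≠ ζ.re := by
          simp [ae_iff]
        filter_upwards [hne] with v hv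
        rw [← integral_planck_mul_cexp (w := v - ζ) (by simpa using h0) (by simp; linarith)
          (by simpa [sub_eq_zero] using hv), ← integral_const_mul]
        congr 1
        funext k
        rw [show I * (v - ζ) * k = I * k * v + -(I * ζ) * k by ring, Complex.exp_add]
        ring
    _ = _ := by
        rw [integral_integral_swap hi, ← integral_const_mul]
        congr 1
        funext k
        rw [fourierT, show -(I * k * ζ) = -(I * ζ) * k by ring]
        have e : ∀ v : ℝ, cexp (I * k * v) * (H v * (planck k * cexp (-(I * ζ) * k)))
            = (planck k * cexp (-(I * ζ) * k)) * (cexp (I * k * v) * H v) := fun v => by ring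
        simp only [e]
        rw [integral_const_mul]
        have := sqrt_two_pi_ne_zero
        field_simp

/-- The identity of `functionOfD_comp_neg_exp`, continued to complex `ζ` in place of `u`. In the
strip `0 < im ζ < π`, where `-e^ζ` is in the lower half-plane, all integrals converge absolutely. -/
lemma positiveFrequency_strip {h : ℝ → ℂ} (hd : Differentiable ℝ h) (hi : Integrable (deriv h))
    (hs : ∀ x, 0 ≤ x → deriv h x = 0) (hH : SmoothL1 (fun u => h (-Real.exp u))) {ζ : ℂ}
    (h0 : 0 < ζ.im) (h1 : ζ.im < Real.pi) :
    cexp ζ * ((√(2 * Real.pi) : ℂ)⁻¹ * ∫ k : ℝ, cexp (-(I * k * (-cexp ζ))) *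
        (indicator (Ici 0) (1 : ℝ → ℂ) k * fourierT (fun y => I * deriv h y) k))
      = (√(2 * Real.pi) : ℂ)⁻¹ * ∫ k : ℝ, cexp (-(I * k * ζ)) *
        (planck k * fourierT (fun u => h (-Real.exp u)) k) := by
  have hz : (-cexp ζ).im < 0 := by
    rw [neg_im, Complex.exp_im]
    have := Real.sin_pos_of_pos_of_lt_pi h0 h1
    have := Real.exp_pos ζ.re
    nlinarith [mul_pos ‹0 < Real.sin ζ.im› this]
  rw [positiveFrequency_eq_cauchy hi hz,
    integral_comp_neg_exp (F := fun y : ℝ => deriv h y / (y - -cexp ζ))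
      (fun x hx => by simp [hs x hx])]
  have hd' : ∀ v : ℝ, deriv (fun u => h (-Real.exp u)) v
      = -(Real.exp v : ℂ) * deriv h (-Real.exp v) := by
    intro v
    have h2 := HasDerivAt.scomp v (hd (-Real.exp v)).hasDerivAt ((Real.hasDerivAt_exp v).neg)
    rw [show (fun u => h (-Real.exp u)) = h ∘ (-Real.exp) from rfl, h2.deriv, Complex.real_smul]
    push_cast
    ring
  have e : ∀ v : ℝ, Real.exp v • (deriv h (-Real.exp v) / ((-Real.exp v : ℝ) - -cexp ζ))
      = -(cexp ζ)⁻¹ * (deriv (fun u => h (-Real.exp u)) v * (1 - cexp (v - ζ))⁻¹) := by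
    intro v
    have hne := one_sub_cexp_ne_zero h0 h1 v
    have hζ := Complex.exp_ne_zero ζ
    rw [hd', Complex.real_smul]
    push_cast
    rw [Complex.exp_sub] at hne ⊢
    have e2 : -cexp v - -cexp ζ = cexp ζ * (1 - cexp v / cexp ζ) := by
      field_simp
      ring
    rw [e2, div_eq_mul_inv, mul_inv]
    ring
  simp only [e]
  rw [integral_const_mul, integral_deriv_mul_kernel hH h0 h1, integral_mul_kernel hH h0 h1]
  have hs := sqrt_two_pi_mul_self
  have hs0 := sqrt_two_pi_ne_zero
  have hζ := Complex.exp_ne_zero ζ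
  rw [← hs]
  generalize ∫ k : ℝ, cexp (-(I * k * ζ)) * (planck k * fourierT (fun u => h (-Real.exp u)) k) = J
  field_simp

/-- The positive `U`-frequency part of `D h`, pulled back along `U = -e^u`, is the thermal
multiplier `planck (D_u)` applied to the pull-back of `h`. -/
theorem functionOfD_comp_neg_exp {h : ℝ → ℂ} (hd : Differentiable ℝ h) (hi : SmoothL1 (deriv h))
    (hs : ∀ x, 0 ≤ x → deriv h x = 0) (hH : SmoothL1 (fun u => h (-Real.exp u))) (u : ℝ) :
    (Real.exp u : ℂ) *
        functionOfD (indicator (Ici 0) 1) (fun y => I * deriv h y) (-Real.exp u)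
      = functionOfD (fun k => (planck k : ℂ)) (fun u => h (-Real.exp u)) u := by
  -- the boundary value of `positiveFrequency_strip` at `im ζ = 0`
  have hi1 : Integrable (fun k : ℝ =>
      indicator (Ici 0) (1 : ℝ → ℂ) k * fourierT (fun y => I * deriv h y) k) := by
    have := (hi.integrable_mul_fourierT linearGrowth_indicator_Ici).const_mul I
    refine this.congr (Eventually.of_forall fun k => ?_)
    simp only [fourierT_const_mul]
    ring
  have hi2 := hH.integrable_mul_fourierT (linearGrowth_one.add ⟨by fun_prop, 1, fun k => by
    rw [Complex.norm_real (|k|)]; simp⟩ : LinearGrowth (fun k => (1 : ℝ → ℂ) k + (|k| : ℝ)))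
  set l := 𝓝[Ioo 0 Real.pi] (0 : ℝ) with hl
  have hmem : ∀ᶠ δ in l, δ ∈ Ioo 0 Real.pi := self_mem_nhdsWithin
  have : l.NeBot := by
    rw [hl, ← mem_closure_iff_nhdsWithin_neBot, closure_Ioo Real.pi_pos.ne]
    exact ⟨le_rfl, Real.pi_pos.le⟩
  have him : ∀ δ : ℝ, ((u : ℂ) + δ * I).im = δ := by intro δ; simp
  have htend : Tendsto (fun δ : ℝ => (u : ℂ) + δ * I) l (𝓝 u) := by
    have : Continuous fun δ : ℝ => (u : ℂ) + δ * I := by fun_prop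
    simpa using (this.tendsto 0).mono_left nhdsWithin_le_nhds
  have t1 : Tendsto (fun δ : ℝ => cexp (u + δ * I) * ((√(2 * Real.pi) : ℂ)⁻¹ *
      ∫ k : ℝ, cexp (-(I * k * (-cexp (u + δ * I)))) *
        (indicator (Ici 0) (1 : ℝ → ℂ) k * fourierT (fun y => I * deriv h y) k))) l
      (𝓝 (cexp u * ((√(2 * Real.pi) : ℂ)⁻¹ * ∫ k : ℝ, cexp (-(I * k * (-cexp u))) *
        (indicator (Ici 0) (1 : ℝ → ℂ) k * fourierT (fun y => I * deriv h y) k)))) := by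
    refine ((Complex.continuous_exp.tendsto _).comp htend).mul (Tendsto.const_mul _ ?_)
    refine tendsto_integral_filter_of_dominated_convergence _ ?_ ?_ hi1.norm ?_
    · exact Eventually.of_forall fun δ =>
        ((by fun_prop : Measurable _).aestronglyMeasurable).mul hi1.aestronglyMeasurable
    · filter_upwards [hmem] with δ hδ
      refine Eventually.of_forall fun k => ?_
      by_cases hk : k ∈ Ici (0 : ℝ)
      · rw [norm_mul]
        refine mul_le_of_le_one_left (norm_nonneg _) ?_
        rw [Complex.norm_exp, Real.exp_le_one_iff]
        have hsin := Real.sin_pos_of_pos_of_lt_pi hδ.1 hδ.2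
        have : (-(I * k * (-cexp (u + δ * I)))).re = -(k * (Real.exp u * Real.sin δ)) := by
          simp [Complex.exp_im]
        rw [this, Left.neg_nonpos_iff]
        have : (0 : ℝ) ≤ k := hk
        positivity
      · simp [hk]
    · refine Eventually.of_forall fun k => Tendsto.mul_const _ ?_
      have : Continuous fun z : ℂ => cexp (-(I * k * (-cexp z))) := by fun_prop
      exact (this.tendsto _).comp htend
  have t2 : Tendsto (fun δ : ℝ => (√(2 * Real.pi) : ℂ)⁻¹ * ∫ k : ℝ, cexp (-(I * k * (u + δ * I))) *
        (planck k * fourierT (fun u => h (-Real.exp u)) k)) l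
      (𝓝 ((√(2 * Real.pi) : ℂ)⁻¹ * ∫ k : ℝ, cexp (-(I * k * u)) *
        (planck k * fourierT (fun u => h (-Real.exp u)) k))) := by
    refine Tendsto.const_mul _ ?_
    refine tendsto_integral_filter_of_dominated_convergence _ ?_ ?_ hi2.norm ?_
    · exact Eventually.of_forall fun δ => ((by fun_prop : Measurable _).aestronglyMeasurable).mul
        (hH.integrable_mul_fourierT linearGrowth_planck).aestronglyMeasurable
    · filter_upwards [hmem] with δ hδ
      refine Eventually.of_forall fun k => ?_
      rw [norm_mul, norm_mul, norm_mul, ← mul_assoc]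
      refine mul_le_mul_of_nonneg_right ?_ (norm_nonneg _)
      have hre : (-(I * k * (u + δ * I))).re = δ * k := by
        simp
        ring
      have hb := exp_mul_planck_le hδ.1.le hδ.2.le k
      have hr : ((1 : ℝ → ℂ) k + (|k| : ℝ)) = ((1 + |k| : ℝ) : ℂ) := by simp
      rw [Complex.norm_exp, hre, Complex.norm_real, Real.norm_of_nonneg (planck_nonneg _), hr,
        Complex.norm_real, Real.norm_of_nonneg (by positivity)]
      exact hb
    · refine Eventually.of_forall fun k => Tendsto.mul_const _ ?_
      have : Continuous fun z : ℂ => cexp (-(I * k * z)) := by fun_prop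
      exact (this.tendsto _).comp htend
  have heq := tendsto_nhds_unique t2 (t1.congr' ?_)
  · rw [functionOfD, functionOfD, heq]
    push_cast
    rfl
  · filter_upwards [hmem] with δ hδ
    exact positiveFrequency_strip hd hi.integrable_self hs hH (by rw [him]; exact hδ.1)
      (by rw [him]; exact hδ.2)

/-! ### Families of functions of one variable, parametrized by the polar angles -/

/-- Lebesgue measure on the range `(0, π) × (0, 2π)` of the polar coordinates. -/
noncomputable def angleMeasure : Measure (ℝ × ℝ) :=
  volume.restrict (Ioo 0 Real.pi ×ˢ Ioo 0 (2 * Real.pi))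

instance : IsFiniteMeasure angleMeasure := by
  refine ⟨?_⟩
  rw [angleMeasure, Measure.restrict_apply_univ]
  exact ((Metric.isBounded_Ioo _ _).prod (Metric.isBounded_Ioo _ _)).measure_lt_top

lemma contDiff_deriv_param {E : Type*} [NormedAddCommGroup E] [NormedSpace ℝ E]
    {Φ : ℝ → E → ℂ} (h : ContDiff ℝ ∞ (Function.uncurry Φ)) :
    ContDiff ℝ ∞ (Function.uncurry fun x w => deriv (fun y => Φ y w) x) := by
  have e : (Function.uncurry fun x w => deriv (fun y => Φ y w) x)
      = fun p : ℝ × E => fderiv ℝ (Function.uncurry Φ) p (1, 0) := by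
    funext p
    have h1 : HasFDerivAt (Function.uncurry Φ) (fderiv ℝ (Function.uncurry Φ) p) (p.1, p.2) :=
      (h.differentiable (by simp)).differentiableAt.hasFDerivAt
    have h2 : HasDerivAt (fun y : ℝ => (y, p.2)) ((1 : ℝ), (0 : E)) p.1 :=
      (hasDerivAt_id p.1).prodMk (hasDerivAt_const p.1 p.2)
    exact (h1.comp_hasDerivAt p.1 h2).deriv
  rw [e]
  exact (h.fderiv_right (m := ∞) (by simp)).clm_apply contDiff_const

lemma contDiff_iteratedDeriv_param {E : Type*} [NormedAddCommGroup E] [NormedSpace ℝ E]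
    {Φ : ℝ → E → ℂ} (h : ContDiff ℝ ∞ (Function.uncurry Φ)) (n : ℕ) :
    ContDiff ℝ ∞ (Function.uncurry fun x w => iteratedDeriv n (fun y => Φ y w) x) := by
  induction n with
  | zero => simpa using h
  | succ n ih =>
    simp only [iteratedDeriv_succ]
    exact contDiff_deriv_param ih

/-- A jointly smooth family all of whose derivatives in the first variable are dominated by
integrable functions, uniformly in the parameter. -/
structure SmoothL1Family (Φ : ℝ → ℝ × ℝ → ℂ) : Prop where
  smooth : ContDiff ℝ ∞ (Function.uncurry Φ)
  bound : ∀ n, ∃ g : ℝ → ℝ, Integrable g ∧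
    ∀ x w, ‖iteratedDeriv n (fun y => Φ y w) x‖ ≤ g x

lemma contDiff_slice {Φ : ℝ → ℝ × ℝ → ℂ} (h : ContDiff ℝ ∞ (Function.uncurry Φ)) (w : ℝ × ℝ) :
    ContDiff ℝ ∞ (fun y => Φ y w) :=
  h.comp (f := fun y : ℝ => (y, w)) (by fun_prop)

namespace SmoothL1Family

variable {Φ : ℝ → ℝ × ℝ → ℂ}

lemma slice (h : SmoothL1Family Φ) (w : ℝ × ℝ) : SmoothL1 (fun y => Φ y w) := by
  refine ⟨contDiff_slice h.smooth w, fun n => ?_⟩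
  obtain ⟨g, hg, hb⟩ := h.bound n
  exact hg.mono' ((contDiff_infty.1 (contDiff_slice h.smooth w) n).continuous_iteratedDeriv n
    le_rfl).aestronglyMeasurable (Eventually.of_forall fun x => hb x w)

lemma deriv (h : SmoothL1Family Φ) : SmoothL1Family (fun x w => deriv (fun y => Φ y w) x) :=
  ⟨contDiff_deriv_param h.smooth, fun n => by simpa [← iteratedDeriv_succ'] using h.bound (n + 1)⟩

lemma iteratedDeriv (h : SmoothL1Family Φ) (n : ℕ) :
    SmoothL1Family (fun x w => iteratedDeriv n (fun y => Φ y w) x) := by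
  induction n with
  | zero => simpa using h
  | succ n ih =>
    simp only [iteratedDeriv_succ]
    exact ih.deriv

lemma const_mul (h : SmoothL1Family Φ) (c : ℂ) : SmoothL1Family (fun x w => c * Φ x w) := by
  refine ⟨contDiff_const.mul h.smooth, fun n => ?_⟩
  obtain ⟨g, hg, hb⟩ := h.bound n
  refine ⟨fun x => ‖c‖ * g x, hg.const_mul _, fun x w => ?_⟩
  rw [iteratedDeriv_const_mul_field, norm_mul]
  exact mul_le_mul_of_nonneg_left (hb x w) (norm_nonneg c)

lemma exists_fourierT_bound (h : SmoothL1Family Φ) :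
    ∃ A : ℝ, 0 ≤ A ∧ ∀ (k : ℝ) w, ‖fourierT (fun y => Φ y w) k‖ ≤ A * ((1 + k ^ 2) ^ 2)⁻¹ := by
  choose g hg hb using h.bound
  have hle : ∀ n w, ∫ x, ‖_root_.iteratedDeriv n (fun y => Φ y w) x‖ ≤ ∫ x, g n x := fun n w =>
    integral_mono ((h.slice w).integrable n).norm (hg n) (fun x => hb n x w)
  have h0 : ∀ n, 0 ≤ ∫ x, g n x := fun n =>
    (integral_nonneg fun x => norm_nonneg _).trans (hle n 0)
  refine ⟨(∫ x, g 0 x) + 2 * (∫ x, g 2 x) + ∫ x, g 4 x, by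
    have := h0 0; have := h0 2; have := h0 4; positivity, fun k w => ?_⟩
  rw [← div_eq_mul_inv, le_div_iff₀ (by positivity)]
  refine ((h.slice w).norm_fourierT_mul_le k).trans ?_
  have e0 := hle 0 w
  simp only [iteratedDeriv_zero] at e0
  have := hle 2 w
  have := hle 4 w
  linarith

lemma stronglyMeasurable_fourierT (h : SmoothL1Family Φ) :
    StronglyMeasurable (fun p : ℝ × ℝ × ℝ => fourierT (fun y => Φ y p.2) p.1) := by
  unfold fourierT
  refine StronglyMeasurable.const_mul (StronglyMeasurable.integral_prod_right ?_) _
  have h1 : Continuous (fun q : (ℝ × ℝ × ℝ) × ℝ => Φ q.2 q.1.2) :=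
    h.smooth.continuous.comp (f := fun q : (ℝ × ℝ × ℝ) × ℝ => (q.2, q.1.2)) (by fun_prop)
  have h2 : Continuous (fun q : (ℝ × ℝ × ℝ) × ℝ => cexp (I * q.1.1 * q.2)) := by fun_prop
  exact (h2.mul h1).stronglyMeasurable

lemma stronglyMeasurable_functionOfD (h : SmoothL1Family Φ) {q : ℝ → ℂ} (hq : Measurable q) :
    StronglyMeasurable (fun p : ℝ × ℝ × ℝ => functionOfD q (fun y => Φ y p.2) p.1) := by
  unfold functionOfD
  refine StronglyMeasurable.const_mul (StronglyMeasurable.integral_prod_right ?_) _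
  have h1 : Measurable (fun r : (ℝ × ℝ × ℝ) × ℝ => fourierT (fun y => Φ y r.1.2) r.2) :=
    h.stronglyMeasurable_fourierT.measurable.comp
      (g := fun p : ℝ × ℝ × ℝ => fourierT (fun y => Φ y p.2) p.1)
      (f := fun r : (ℝ × ℝ × ℝ) × ℝ => (r.2, r.1.2)) (by fun_prop)
  exact (by unfold Function.uncurry; fun_prop : Measurable _).stronglyMeasurable

lemma exists_functionOfD_bound (h : SmoothL1Family Φ) {q : ℝ → ℂ} (hq : LinearGrowth q) :
    ∃ A : ℝ, ∀ (x : ℝ) w, ‖functionOfD q (fun y => Φ y w) x‖ ≤ A := by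
  obtain ⟨A, hA0, hA⟩ := h.exists_fourierT_bound
  obtain ⟨C, hC⟩ := hq.bound
  refine ⟨∫ k : ℝ, C * A * (((1 + k ^ 2) ^ 2)⁻¹ * (1 + |k|)), fun x w => ?_⟩
  rw [functionOfD, norm_mul]
  refine (mul_le_of_le_one_left (norm_nonneg _) norm_sqrt_two_pi_inv_le).trans ?_
  refine norm_integral_le_of_norm_le (integrable_inv_one_add_sq_sq_mul.const_mul _)
    (Eventually.of_forall fun k => ?_)
  rw [norm_mul, norm_cexp_neg_I_mul_mul, one_mul, norm_mul]
  calc _ ≤ (C * (1 + |k|)) * (A * ((1 + k ^ 2) ^ 2)⁻¹) := by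
        have := hC k
        have := hA k w
        gcongr
        exact (norm_nonneg _).trans ‹‖q k‖ ≤ _›
    _ = _ := by ring

end SmoothL1Family

lemma integrable_prod_of_le {F : ℝ × ℝ × ℝ → ℂ} (hF : StronglyMeasurable F) {g : ℝ → ℝ}
    (hg : Integrable g) (h : ∀ x w, ‖F (x, w)‖ ≤ g x) :
    Integrable F (volume.prod angleMeasure) :=
  (hg.comp_fst angleMeasure).mono' hF.aestronglyMeasurable (Eventually.of_forall fun p => h p.1 p.2)

/-- **Fubini** for integrals over `ℝ × S²`: the `ℝ`-integral is the inner one. -/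
lemma boundaryIntegral_eq {G : Field}
    (h : Integrable (fun p : ℝ × ℝ × ℝ => G p.1 (frame p.2.1 p.2.2)) (volume.prod angleMeasure)) :
    boundaryIntegral G
      = ∫ w, Real.sin w.1 * (∫ x, G x (frame w.1 w.2)) ∂angleMeasure := by
  have hi : Integrable (fun p : ℝ × ℝ × ℝ => (Real.sin p.2.1 : ℂ) * G p.1 (frame p.2.1 p.2.2))
      (volume.prod angleMeasure) := by
    refine h.bdd_mul (c := 1) (by fun_prop : Continuous _).aestronglyMeasurable ?_
    refine Eventually.of_forall fun p => ?_
    rw [Complex.norm_real]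
    exact Real.abs_sin_le_one _
  rw [boundaryIntegral, Measure.volume_eq_prod, ← Measure.prod_restrict, Measure.restrict_univ]
  simp only [component, mul_comm _ (Complex.ofReal _)]
  rw [← angleMeasure, integral_prod_symm _ hi]
  simp only [integral_const_mul]

/-- The spectral density `∫ sin θ  conj (â_w(k)) b̂_w(k) dθ dφ` of a pair of families. -/
noncomputable def spectralDensity (a b : ℝ → ℝ × ℝ → ℂ) (k : ℝ) : ℂ :=
  ∫ w, Real.sin w.1 * ((starRingEnd ℂ) (fourierT (fun y => a y w) k) * fourierT (fun y => b y w) k)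
    ∂angleMeasure

lemma integrable_spectral {a b : ℝ → ℝ × ℝ → ℂ} (ha : SmoothL1Family a) (hb : SmoothL1Family b)
    {q : ℝ → ℂ} (hq : LinearGrowth q) :
    Integrable (fun p : ℝ × ℝ × ℝ => q p.1 * (Real.sin p.2.1 *
      ((starRingEnd ℂ) (fourierT (fun y => a y p.2) p.1) * fourierT (fun y => b y p.2) p.1)))
      (volume.prod angleMeasure) := by
  obtain ⟨A, hA0, hA⟩ := ha.exists_fourierT_bound
  obtain ⟨B, hB0, hB⟩ := hb.exists_fourierT_bound
  obtain ⟨C, hC⟩ := hq.bound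
  refine integrable_prod_of_le (g := fun k => C * A * B * (((1 + k ^ 2) ^ 2)⁻¹ * (1 + |k|)))
    ?_ (integrable_inv_one_add_sq_sq_mul.const_mul _) ?_
  · have h1 := ha.stronglyMeasurable_fourierT.measurable
    have h2 := hb.stronglyMeasurable_fourierT.measurable
    have h3 := hq.measurable
    have h4 : Measurable (starRingEnd ℂ) := Complex.continuous_conj.measurable
    exact (by fun_prop : Measurable _).stronglyMeasurable
  · intro k w
    simp only [norm_mul, RCLike.norm_conj]
    have h1 := hC k
    have h2 := hA k w
    have h3 := hB k w
    have h4 : ‖(Real.sin w.1 : ℂ)‖ ≤ 1 := by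
      rw [Complex.norm_real]
      exact Real.abs_sin_le_one _
    have h5 : ((1 + k ^ 2) ^ 2 : ℝ)⁻¹ ≤ 1 := inv_le_one_of_one_le₀ (by nlinarith [sq_nonneg k])
    have hC0 := (norm_nonneg _).trans h1
    have h6 : ‖fourierT (fun y => b y w) k‖ ≤ B * 1 := h3.trans (by gcongr)
    calc _ ≤ (C * (1 + |k|)) * (1 * ((A * ((1 + k ^ 2) ^ 2)⁻¹) * (B * 1))) := by gcongr
      _ = _ := by ring

lemma integrable_mul_spectralDensity {a b : ℝ → ℝ × ℝ → ℂ} (ha : SmoothL1Family a)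
    (hb : SmoothL1Family b) {q : ℝ → ℂ} (hq : LinearGrowth q) :
    Integrable (fun k => q k * spectralDensity a b k) := by
  have h := (integrable_spectral ha hb hq).integral_prod_left
  simp only [integral_const_mul] at h
  exact h

/-- Parseval's formula, integrated over the sphere. -/
lemma integral_sin_mul_functionOfD {a b : ℝ → ℝ × ℝ → ℂ} (ha : SmoothL1Family a)
    (hb : SmoothL1Family b) {q : ℝ → ℂ} (hq : LinearGrowth q) :
    ∫ w, Real.sin w.1 * (∫ x, (starRingEnd ℂ) (a x w) * functionOfD q (fun y => b y w) x)
        ∂angleMeasure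
      = ∫ k, q k * spectralDensity a b k := by
  have h := integral_integral_swap (f := fun (k : ℝ) (w : ℝ × ℝ) => q k * (Real.sin w.1 *
    ((starRingEnd ℂ) (fourierT (fun y => a y w) k) * fourierT (fun y => b y w) k)))
    (integrable_spectral ha hb hq)
  simp only [integral_const_mul] at h
  refine Eq.trans ?_ h.symm
  congr 1
  funext w
  rw [integral_conj_mul_functionOfD (ha.slice w).integrable_self
    ((hb.slice w).integrable_mul_fourierT hq), ← integral_const_mul]
  congr 1
  funext k
  ring

lemma spectralDensity_comp_sub (a b : ℝ → ℝ × ℝ → ℂ) (c d k : ℝ) :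
    spectralDensity (fun x w => a (x - c) w) (fun x w => b (x - d) w) k
      = cexp (I * (d - c) * k) * spectralDensity a b k := by
  rw [spectralDensity, spectralDensity, ← integral_const_mul]
  congr 1
  funext w
  rw [fourierT_comp_sub (fun y => a y w), fourierT_comp_sub (fun y => b y w), map_mul,
    ← Complex.exp_conj, show I * (d - c) * k = -(I * k * c) + I * k * d by ring, Complex.exp_add]
  simp only [map_mul, Complex.conj_I, Complex.conj_ofReal]
  rw [show -I * (k : ℂ) * c = -(I * k * c) by ring]
  ring

/-! ### Functions of time with a given spectral density -/

lemma norm_integral_phase_mul_le {μ : ℝ → ℂ} (c b : ℝ) :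
    ‖∫ k : ℝ, cexp (I * (c * b) * k) * μ k‖ ≤ ∫ k, ‖μ k‖ := by
  refine (norm_integral_le_integral_norm _).trans (le_of_eq ?_)
  have : ∀ k : ℝ, ‖cexp (I * (c * b) * k)‖ = 1 := fun k => by
    rw [Complex.norm_exp]; simp
  simp [this]

lemma integrable_fourierT_mul_phase {f : ℝ → ℂ} (hf : SmoothL1 f) {μ : ℝ → ℂ}
    (hμ : Integrable μ) (c : ℝ) :
    Integrable (fun p : ℝ × ℝ => cexp (I * (c * p.1) * p.2) * (fourierT f p.1 * μ p.2))
      (volume.prod volume) := by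
  have h := hf.integrable_mul_fourierT linearGrowth_one
  simp only [Pi.one_apply, one_mul] at h
  refine (h.mul_prod hμ).bdd_mul (c := 1) (by fun_prop : Continuous _).aestronglyMeasurable ?_
  refine Eventually.of_forall fun p => le_of_eq ?_
  rw [Complex.norm_exp]; simp

lemma integrable_fourierT_mul_integral {f : ℝ → ℂ} (hf : SmoothL1 f) {μ : ℝ → ℂ}
    (hμ : Integrable μ) (c : ℝ) :
    Integrable (fun b : ℝ => fourierT f b * ∫ k : ℝ, cexp (I * (c * b) * k) * μ k) := by
  refine (integrable_fourierT_mul_phase hf hμ c).integral_prod_left.congr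
    (Eventually.of_forall fun b => ?_)
  simp only
  rw [← integral_const_mul]
  congr 1
  funext k
  ring

lemma integral_fourierT_mul_integral {f : ℝ → ℂ} (hf : SmoothL1 f) {μ : ℝ → ℂ}
    (hμ : Integrable μ) (c : ℝ) :
    ∫ b : ℝ, fourierT f b * ∫ k : ℝ, cexp (I * (c * b) * k) * μ k
      = √(2 * Real.pi) * ∫ k : ℝ, f (-(c * k)) * μ k := by
  have e : ∀ b : ℝ, fourierT f b * ∫ k : ℝ, cexp (I * (c * b) * k) * μ k
      = ∫ k : ℝ, cexp (I * (c * b) * k) * (fourierT f b * μ k) := by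
    intro b
    rw [← integral_const_mul]
    congr 1
    funext k
    ring
  simp only [e]
  rw [integral_integral_swap (f := fun b k : ℝ => cexp (I * (c * b) * k) * (fourierT f b * μ k))
    (integrable_fourierT_mul_phase hf hμ c), ← integral_const_mul]
  congr 1
  funext k
  rw [← hf.functionOfD_one (-(c * k)), functionOfD]
  have hs := sqrt_two_pi_ne_zero
  rw [← mul_assoc, mul_inv_cancel_left₀ hs, ← integral_mul_const]
  congr 1
  funext b
  simp only [Pi.one_apply, one_mul]
  push_cast
  rw [show -(I * b * -(c * k)) = I * (c * b) * k by ring]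
  ring

/-! ### Sections as families -/

/-- A function on `ℝ × SO(3)`, evaluated at the frames of the polar coordinates. -/
noncomputable def polarFamily (F : Field) : ℝ → ℝ × ℝ → ℂ := fun x w => F x (frame w.1 w.2)

lemma IsSpinSection.contDiff_polarFamily {s : ℕ} {F : Field} (h : IsSpinSection s F) :
    ContDiff ℝ ∞ (Function.uncurry (polarFamily F)) := by
  have h1 := (h.smooth 1).comp
    (f := fun p : ℝ × ℝ × ℝ => ((p.1, p.2.2, p.2.1, 0) : ℝ × ℝ × ℝ × ℝ)) (by fun_prop)
  have e : Function.uncurry (polarFamily F) = fun p : ℝ × ℝ × ℝ =>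
      F p.1 (1 * rotZ p.2.2 * rotY p.2.1 * rotZ 0) := by
    funext p
    simp [Function.uncurry, polarFamily, frame, rotZ_zero]
  rw [e]
  exact h1

lemma dX_iterate (F : Field) (n : ℕ) (x : ℝ) (R : Frame) :
    (dX^[n] F) x R = iteratedDeriv n (fun y => F y R) x := by
  induction n generalizing x with
  | zero => simp
  | succ n ih =>
    rw [Function.iterate_succ_apply', iteratedDeriv_succ]
    simp only [dX, funext ih]

lemma polarFamily_tho_iterate (F : Field) (n : ℕ) :
    polarFamily (tho^[n] F)
      = fun x w => 2 ^ n * iteratedDeriv n (fun y => polarFamily F y w) x := by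
  funext x w
  exact tho_iterate F n x _

lemma fourierT_I_mul_deriv {f : ℝ → ℂ} (h : SmoothL1 f) (k : ℝ) :
    fourierT (fun y => I * deriv f y) k = k * fourierT f k := by
  rw [fourierT_const_mul, h.fourierT_deriv]
  linear_combination (-k * fourierT f k) * I_mul_I

lemma functionOfD_I_mul_deriv {f : ℝ → ℂ} (h : SmoothL1 f) (q : ℝ → ℂ) (x : ℝ) :
    functionOfD q (fun y => I * deriv f y) x = functionOfD (fun k => q k * k) f x := by
  simp only [functionOfD, fourierT_I_mul_deriv h, mul_assoc]

lemma I_mul_deriv_eq_functionOfD {f : ℝ → ℂ} (h : SmoothL1 f) (x : ℝ) :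
    I * deriv f x = functionOfD (fun k => (k : ℂ)) f x := by
  have h1 : SmoothL1 (fun y => I * deriv f y) := by
    refine ⟨contDiff_const.mul h.deriv.smooth, fun n => ?_⟩
    have := (h.deriv.integrable n).const_mul I
    refine this.congr (Eventually.of_forall fun y => ?_)
    simp only [iteratedDeriv_const_mul_field]
  rw [← h1.functionOfD_one x, functionOfD_I_mul_deriv h]
  simp

lemma integrable_conj_mul_functionOfD {a b : ℝ → ℝ × ℝ → ℂ} (ha : SmoothL1Family a)
    (hb : SmoothL1Family b) {q : ℝ → ℂ} (hq : LinearGrowth q) :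
    Integrable (fun p : ℝ × ℝ × ℝ => (starRingEnd ℂ) (a p.1 p.2) *
      functionOfD q (fun y => b y p.2) p.1) (volume.prod angleMeasure) := by
  obtain ⟨g, hg, hga⟩ := ha.bound 0
  obtain ⟨A, hA⟩ := hb.exists_functionOfD_bound hq
  refine integrable_prod_of_le (g := fun x => g x * A) ?_ (hg.mul_const A) fun x w => ?_
  · refine StronglyMeasurable.mul ?_ (hb.stronglyMeasurable_functionOfD hq.measurable)
    exact (Complex.continuous_conj.comp ha.smooth.continuous).stronglyMeasurable
  · rw [norm_mul, RCLike.norm_conj]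
    have h1 := hga x w
    rw [iteratedDeriv_zero] at h1
    exact mul_le_mul h1 (hA x w) (norm_nonneg _) ((norm_nonneg _).trans h1)

/-- A sum of two sesquilinear expressions in the spectral representation. -/
lemma boundaryIntegral_conj_mul_functionOfD {a b a' b' : ℝ → ℝ × ℝ → ℂ}
    (ha : SmoothL1Family a) (hb : SmoothL1Family b) (ha' : SmoothL1Family a')
    (hb' : SmoothL1Family b') {q : ℝ → ℂ} (hq : LinearGrowth q) {G : Field}
    (hG : ∀ x w, polarFamily G x w = (starRingEnd ℂ) (a x w) * functionOfD q (fun y => b y w) x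
      + (starRingEnd ℂ) (a' x w) * functionOfD q (fun y => b' y w) x) :
    boundaryIntegral G
      = ∫ k, q k * (spectralDensity a b k + spectralDensity a' b' k) := by
  have i1 := integrable_conj_mul_functionOfD ha hb hq
  have i2 := integrable_conj_mul_functionOfD ha' hb' hq
  have hG' : (fun p : ℝ × ℝ × ℝ => G p.1 (frame p.2.1 p.2.2)) = fun p : ℝ × ℝ × ℝ =>
      (starRingEnd ℂ) (a p.1 p.2) * functionOfD q (fun y => b y p.2) p.1
      + (starRingEnd ℂ) (a' p.1 p.2) * functionOfD q (fun y => b' y p.2) p.1 := by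
    funext p
    exact hG p.1 p.2
  rw [boundaryIntegral_eq (by rw [hG']; exact i1.add i2)]
  simp only [mul_add]
  rw [integral_add (integrable_mul_spectralDensity ha hb hq)
    (integrable_mul_spectralDensity ha' hb' hq), ← integral_sin_mul_functionOfD ha hb hq,
    ← integral_sin_mul_functionOfD ha' hb' hq]
  have j : ∀ {a b : ℝ → ℝ × ℝ → ℂ}, SmoothL1Family a → SmoothL1Family b →
      Integrable (fun w : ℝ × ℝ => Real.sin w.1 * (∫ x, (starRingEnd ℂ) (a x w) *
        functionOfD q (fun y => b y w) x)) angleMeasure := by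
    intro a b ha hb
    refine (integrable_conj_mul_functionOfD ha hb hq).integral_prod_right.bdd_mul (c := 1)
      (by fun_prop : Continuous _).aestronglyMeasurable (Eventually.of_forall fun w => ?_)
    rw [Complex.norm_real]
    exact Real.abs_sin_le_one _
  rw [← integral_add (j ha hb) (j ha' hb')]
  congr 1
  funext w
  rw [← mul_add]
  congr 1
  have k : ∀ {a b : ℝ → ℝ × ℝ → ℂ}, SmoothL1Family a → SmoothL1Family b →
      Integrable (fun x => (starRingEnd ℂ) (a x w) * functionOfD q (fun y => b y w) x) := by
    intro a b ha hb
    have h1 : Integrable (fun x => (starRingEnd ℂ) (a x w)) :=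
      Complex.conjLIE.integrable_comp_iff.2 (ha.slice w).integrable_self
    obtain ⟨A, hA⟩ := hb.exists_functionOfD_bound hq
    exact h1.mul_bdd (c := A) ((hb.stronglyMeasurable_functionOfD hq.measurable).comp_measurable
      (g := fun x : ℝ => (x, w)) (by fun_prop)).aestronglyMeasurable
      (Eventually.of_forall fun x => hA x w)
  rw [← integral_add (k ha hb) (k ha' hb')]
  congr 1
  funext x
  exact hG x w

lemma spectralDensity_eq_mul {a b a' b' : ℝ → ℝ × ℝ → ℂ} {k : ℝ} {c d : ℂ}
    (ha : ∀ w, fourierT (fun y => a' y w) k = c * fourierT (fun y => a y w) k)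
    (hb : ∀ w, fourierT (fun y => b' y w) k = d * fourierT (fun y => b y w) k) :
    spectralDensity a' b' k = (starRingEnd ℂ) c * d * spectralDensity a b k := by
  rw [spectralDensity, spectralDensity, ← integral_const_mul]
  congr 1
  funext w
  rw [ha, hb, map_mul]
  ring

/-! ### Past null infinity -/

lemma bracket_pos (x : ℝ) : 0 < bracket x := Real.sqrt_pos.2 (by positivity)

lemma integrable_bracket_rpow {p : ℝ} (hp : p < -1) : Integrable (fun x => bracket x ^ p) := by
  have h := integrable_rpow_neg_one_add_norm_sq (E := ℝ) (r := -p) (μ := volume)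
    (by simp; linarith)
  refine h.congr (Eventually.of_forall fun x => ?_)
  simp only [neg_neg, Real.norm_eq_abs, sq_abs]
  rw [bracket, Real.sqrt_eq_rpow, ← Real.rpow_mul (by positivity)]
  ring_nf

/-- Peetre's inequality. -/
lemma bracket_le (x b : ℝ) : bracket x ≤ √2 * bracket b * bracket (x - b) := by
  unfold bracket
  rw [← Real.sqrt_mul (by positivity), ← Real.sqrt_mul (by positivity)]
  refine Real.sqrt_le_sqrt ?_
  nlinarith [sq_nonneg (x - 2 * b), sq_nonneg (b * (x - b))]

lemma exists_bracket_sub_rpow_le (b p : ℝ) :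
    ∃ C, 0 ≤ C ∧ ∀ x, bracket (x - b) ^ p ≤ C * bracket x ^ p := by
  have h0 : 0 < √2 * bracket b := mul_pos (Real.sqrt_pos.2 two_pos) (bracket_pos b)
  rcases le_total 0 p with hp | hp
  · refine ⟨(√2 * bracket b) ^ p, by positivity, fun x => ?_⟩
    rw [← Real.mul_rpow h0.le (bracket_pos x).le]
    refine Real.rpow_le_rpow (bracket_pos _).le ?_ hp
    have h := bracket_le (x - b) (-b)
    have e : bracket (-b) = bracket b := by simp [bracket]
    rw [e, sub_neg_eq_add, sub_add_cancel] at h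
    exact h
  · refine ⟨(√2 * bracket b) ^ (-p), by positivity, fun x => ?_⟩
    have h := Real.rpow_le_rpow_of_nonpos (bracket_pos x) (bracket_le x b) hp
    rw [Real.mul_rpow h0.le (bracket_pos _).le] at h
    rw [Real.rpow_neg h0.le, inv_mul_eq_div, le_div_iff₀' (by positivity)]
    exact h

lemma ScriDecay.smoothL1Family {s : ℕ} {F : Field} (hF : IsSpinSection s F) (h : ScriDecay 2 F) :
    SmoothL1Family (polarFamily F) := by
  refine ⟨hF.contDiff_polarFamily, fun n => ?_⟩
  obtain ⟨C, hC⟩ := h.2 n (1 / 2) (by norm_num)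
  refine ⟨fun x => C * bracket x ^ (-2 - n + 1 / 2 : ℝ),
    (integrable_bracket_rpow ?_).const_mul C, fun x w => ?_⟩
  · have : (0 : ℝ) ≤ n := n.cast_nonneg
    linarith
  · have h1 := hC x (frame w.1 w.2)
    rw [dX_iterate] at h1
    exact h1

/-- Translation in the `ℝ`-factor. -/
def translate (b : ℝ) (F : Field) : Field := fun t R => F (t - b) R

lemma IsSpinSection.translate {s : ℕ} {F : Field} (h : IsSpinSection s F) (b : ℝ) :
    IsSpinSection s (translate b F) :=
  ⟨fun x R α => h.equivariant (x - b) R α, fun R => (h.smooth R).comp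
    (f := fun p : ℝ × ℝ × ℝ × ℝ => (p.1 - b, p.2)) (by fun_prop)⟩

lemma iterate_dX_translate (b : ℝ) (F : Field) (n : ℕ) :
    dX^[n] (translate b F) = translate b (dX^[n] F) := by
  funext t R
  rw [translate, dX_iterate, dX_iterate]
  exact congrFun (iteratedDeriv_comp_sub_const n (fun y => F y R) b) t

lemma iterate_tho_translate (b : ℝ) (F : Field) (n : ℕ) :
    tho^[n] (translate b F) = translate b (tho^[n] F) := by
  funext t R
  rw [translate, tho_iterate, tho_iterate]
  exact congrArg _ (congrFun (iteratedDeriv_comp_sub_const n (fun y => F y R) b) t)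

lemma ScriDecay.translate {p : ℝ} {F : Field} (h : ScriDecay p F) (b : ℝ) :
    ScriDecay p (translate b F) := by
  obtain ⟨⟨t₀, ht⟩, hd⟩ := h
  refine ⟨⟨t₀ + b, fun t h R => ht _ (by linarith) R⟩, fun n ε hε => ?_⟩
  obtain ⟨C, hC⟩ := hd n ε hε
  obtain ⟨D, hD0, hD⟩ := exists_bracket_sub_rpow_le b (-p - n + ε)
  have hC0 : 0 ≤ C := by
    have h1 := (norm_nonneg _).trans (hC 0 1)
    exact nonneg_of_mul_nonneg_left h1 (Real.rpow_pos_of_pos (bracket_pos 0) _)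
  refine ⟨C * D, fun t R => ?_⟩
  rw [iterate_dX_translate]
  calc _ ≤ C * bracket (t - b) ^ (-p - n + ε) := hC (t - b) R
    _ ≤ C * (D * bracket t ^ (-p - n + ε)) := mul_le_mul_of_nonneg_left (hD t) hC0
    _ = _ := by ring

lemma opL_killingScri_sub (K : Kerr) (σ : Sgn) (n b : ℝ) (f : ℝ → ℝ → ℝ → ℂ) :
    opL K killingScri σ n (fun t => f (t - b)) = fun t => opL K killingScri σ n f (t - b) := by
  funext t θ φ
  simp only [opL, killingScri]
  rw [deriv_comp_sub_const (fun t₁ => f t₁ θ φ)]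

lemma opLChain_killingScri_sub (K : Kerr) (σ : Sgn) (s j : ℕ) (b : ℝ) (f : ℝ → ℝ → ℝ → ℂ) :
    opLChain K killingScri σ s j (fun t => f (t - b))
      = fun t => opLChain K killingScri σ s j f (t - b) := by
  induction j with
  | zero => rfl
  | succ j ih => rw [opLChain, ih, opL_killingScri_sub, opLChain]

lemma killingScri_sub (b : ℝ) (f : ℝ → ℝ → ℝ → ℂ) :
    killingScri (fun t => f (t - b)) = fun t => killingScri f (t - b) := by
  funext t θ φ
  exact deriv_comp_sub_const (fun t₁ => f t₁ θ φ) b t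

/-- The coefficients of `A_s` do not depend on `t`. -/
lemma AScriEq.translate {K : Kerr} {s : ℕ} {χ ψ : Field} (h : AScriEq K s χ ψ) (b : ℝ) :
    AScriEq K s (translate b χ) (translate b ψ) := by
  intro t θ φ h0 h1
  have h2 := h (t - b) θ φ h0 h1
  have e : component (KerrTeukolsky.translate b χ) = fun t => component χ (t - b) := rfl
  rw [e, opA, opLChain_killingScri_sub, opLChain_killingScri_sub, killingScri_sub, killingScri_sub]
  exact h2

lemma IsPotential.translate {K : Kerr} {s : ℕ} {ψ : Field × Field} {χ : Field}
    (h : IsPotential K s ψ χ) (b : ℝ) : IsPotential K s (flowScri b ψ) (translate b χ) :=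
  ⟨h.isSection.translate b, h.decay.translate b, h.A_eq.translate b, by
    rw [iterate_tho_translate, ← h.tho_eq]
    rfl⟩

lemma flowScri_mem {K : Kerr} {s : ℕ} {ψ : Field × Field} (h : ψ ∈ physScriSpace K s) (b : ℝ) :
    flowScri b ψ ∈ physScriSpace K s :=
  ⟨⟨h.1.1.translate b, h.1.2.1.translate b, h.1.2.2.1.translate b, h.1.2.2.2.translate b⟩,
    translate b (AInv K s ψ), (isPotential_AInv h).translate b⟩

lemma AInv_flowScri {K : Kerr} {s : ℕ} {ψ : Field × Field} (h : ψ ∈ physScriSpace K s) (b : ℝ) :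
    AInv K s (flowScri b ψ) = translate b (AInv K s ψ) :=
  (isPotential_AInv (flowScri_mem h b)).unique ((isPotential_AInv h).translate b)

lemma opW_flowScri (s : ℕ) (ψ : Field × Field) (b : ℝ) :
    opW s (flowScri b ψ) = translate b (opW s ψ) :=
  iterate_tho_translate b ψ.2 s

lemma opWTilde_flowScri {K : Kerr} {s : ℕ} {ψ : Field × Field} (h : ψ ∈ physScriSpace K s)
    (b : ℝ) : opWTilde K s (flowScri b ψ) = translate b (opWTilde K s ψ) := by
  rw [opWTilde, AInv_flowScri h, iterate_tho_translate, opWTilde]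

lemma SmoothL1Family.tho_iterate {F : Field} (h : SmoothL1Family (polarFamily F)) (n : ℕ) :
    SmoothL1Family (polarFamily (tho^[n] F)) := by
  rw [polarFamily_tho_iterate]
  exact (h.iteratedDeriv n).const_mul _

section

variable {K : Kerr} {s : ℕ} {φ ψ : Field × Field}

lemma smoothL1Family_snd (h : ψ ∈ physScriSpace K s) : SmoothL1Family (polarFamily ψ.2) :=
  h.1.2.2.2.smoothL1Family h.1.2.1

lemma smoothL1Family_AInv (h : ψ ∈ physScriSpace K s) :
    SmoothL1Family (polarFamily (AInv K s ψ)) :=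
  (isPotential_AInv h).decay.smoothL1Family (isPotential_AInv h).isSection

lemma smoothL1Family_fst (h : ψ ∈ physScriSpace K s) : SmoothL1Family (polarFamily ψ.1) := by
  rw [(isPotential_AInv h).tho_eq]
  exact (smoothL1Family_AInv h).tho_iterate _

lemma smoothL1Family_opW (h : ψ ∈ physScriSpace K s) : SmoothL1Family (polarFamily (opW s ψ)) :=
  (smoothL1Family_snd h).tho_iterate s

lemma smoothL1Family_opWTilde (h : ψ ∈ physScriSpace K s) :
    SmoothL1Family (polarFamily (opWTilde K s ψ)) :=
  (smoothL1Family_AInv h).tho_iterate s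

end

/-- The spectral density of the two-point functions at past null infinity. -/
noncomputable def scriDensity (K : Kerr) (s : ℕ) (φ ψ : Field × Field) (k : ℝ) : ℂ :=
  spectralDensity (polarFamily (opWTilde K s φ)) (polarFamily (opW s ψ)) k
    + spectralDensity (polarFamily (opW s φ)) (polarFamily (opWTilde K s ψ)) k

/-- The multipliers of `w^±_I`: `k` on `k ≥ 0`, and `-k` on `k < 0`. -/
noncomputable def scriMultiplier : Sgn → ℝ → ℂ
  | .plus, k => indicator (Ici 0) (1 : ℝ → ℂ) k * k
  | .minus, k => indicator (Ici 0) (1 : ℝ → ℂ) k * k - k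

lemma linearGrowth_indicator_mul_self :
    LinearGrowth (fun k => indicator (Ici 0) (1 : ℝ → ℂ) k * k) := by
  have h := linearGrowth_self.indicator (measurableSet_Ici (a := (0 : ℝ)))
  have e : (fun k : ℝ => indicator (Ici 0) (1 : ℝ → ℂ) k * k)
      = indicator (Ici 0) (fun k : ℝ => (k : ℂ)) := by
    funext k
    by_cases hk : k ∈ Ici (0 : ℝ) <;> simp [hk]
  rw [e]
  exact h

lemma linearGrowth_scriMultiplier (σ : Sgn) : LinearGrowth (scriMultiplier σ) := by
  cases σ
  · exact linearGrowth_indicator_mul_self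
  · have h := linearGrowth_indicator_mul_self.add linearGrowth_self.neg
    simp only [← sub_eq_add_neg] at h
    exact h

lemma posD_eq_functionOfD {F : Field} (h : SmoothL1Family (polarFamily F)) (x : ℝ) (w : ℝ × ℝ) :
    posD F x (frame w.1 w.2) = functionOfD (fun k => indicator (Ici 0) (1 : ℝ → ℂ) k * k)
      (fun y => polarFamily F y w) x :=
  functionOfD_I_mul_deriv (h.slice w) _ x

lemma wScriPlus_eq {K : Kerr} {s : ℕ} {φ ψ : Field × Field} (hφ : φ ∈ physScriSpace K s)
    (hψ : ψ ∈ physScriSpace K s) :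
    wScriPlus K s φ ψ = 2 * ∫ k, scriMultiplier .plus k * scriDensity K s φ ψ k := by
  rw [wScriPlus, boundaryIntegral_conj_mul_functionOfD (smoothL1Family_opWTilde hφ)
    (smoothL1Family_opW hψ) (smoothL1Family_opW hφ) (smoothL1Family_opWTilde hψ)
    linearGrowth_indicator_mul_self]
  · rfl
  · intro x w
    rw [← posD_eq_functionOfD (smoothL1Family_opW hψ),
      ← posD_eq_functionOfD (smoothL1Family_opWTilde hψ)]
    rfl

lemma fourierT_tho_iterate {F : Field} (h : SmoothL1Family (polarFamily F)) (n : ℕ) (k : ℝ)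
    (w : ℝ × ℝ) : fourierT (fun y => polarFamily (tho^[n] F) y w) k
      = (2 * -(I * k)) ^ n * fourierT (fun y => polarFamily F y w) k := by
  rw [polarFamily_tho_iterate]
  simp only
  rw [fourierT_const_mul (fun y => iteratedDeriv n (fun y => polarFamily F y w) y),
    (h.slice w).fourierT_iteratedDeriv, mul_pow, mul_assoc]

lemma boundaryIntegral_const_mul (c : ℂ) (G : Field) :
    boundaryIntegral (fun x R => c * G x R) = c * boundaryIntegral G := by
  rw [boundaryIntegral, boundaryIntegral, ← integral_const_mul]
  congr 1
  funext p
  simp only [component]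
  ring

/-- On physical pairs, `i σ_I` is given by the multiplier `k`: the `2s` derivatives that are
concentrated on one factor are distributed evenly, at the cost of the sign `(-1)^s`. -/
lemma I_mul_sigmaScri_eq {K : Kerr} {s : ℕ} {φ ψ : Field × Field} (hφ : φ ∈ physScriSpace K s)
    (hψ : ψ ∈ physScriSpace K s) :
    I * sigmaScri s φ ψ = 2 * ∫ k : ℝ, (k : ℂ) * scriDensity K s φ ψ k := by
  have e1 : I * sigmaScri s φ ψ = 2 * (-1) ^ s * boundaryIntegral (fun t R => I *
      ((starRingEnd ℂ) (φ.1 t R) * dX ψ.2 t R + (starRingEnd ℂ) (φ.2 t R) * dX ψ.1 t R)) := by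
    rw [sigmaScri, boundaryIntegral_const_mul]
    ring
  rw [e1, boundaryIntegral_conj_mul_functionOfD (smoothL1Family_fst hφ) (smoothL1Family_snd hψ)
    (smoothL1Family_snd hφ) (smoothL1Family_fst hψ) linearGrowth_self]
  · rw [mul_assoc, ← integral_const_mul]
    congr 2
    funext k
    have hs : (starRingEnd ℂ) ((2 * -(I * k)) ^ s) * (2 * -(I * k)) ^ s
        = (-1) ^ s * (2 * -(I * k)) ^ (2 * s) ∧
        (starRingEnd ℂ) ((2 * -(I * k)) ^ (2 * s)) = (2 * -(I * k)) ^ (2 * s) := by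
      have h2 : (starRingEnd ℂ) (2 * -(I * k)) = -(2 * -(I * k)) := by
        rw [map_mul, map_neg, map_mul, Complex.conj_I, Complex.conj_ofReal, Complex.conj_ofNat]
        ring
      rw [map_pow, map_pow, h2]
      generalize (2 * -(I * k) : ℂ) = z
      refine ⟨?_, (even_two_mul s).neg_pow z⟩
      rw [neg_pow z, two_mul s, pow_add]
      ring
    obtain ⟨s1, s2⟩ := hs
    have hχφ := smoothL1Family_AInv hφ
    have hχψ := smoothL1Family_AInv hψ
    have f1 : ∀ w, fourierT (fun y => polarFamily φ.1 y w) k = (2 * -(I * k)) ^ (2 * s) *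
        fourierT (fun y => polarFamily (AInv K s φ) y w) k := fun w => by
      rw [← fourierT_tho_iterate hχφ, ← (isPotential_AInv hφ).tho_eq]
    have f2 : ∀ w, fourierT (fun y => polarFamily ψ.1 y w) k = (2 * -(I * k)) ^ (2 * s) *
        fourierT (fun y => polarFamily (AInv K s ψ) y w) k := fun w => by
      rw [← fourierT_tho_iterate hχψ, ← (isPotential_AInv hψ).tho_eq]
    rw [scriDensity, opWTilde, opWTilde, opW, opW,
      spectralDensity_eq_mul (d := 1) f1 (fun w => (one_mul _).symm),
      spectralDensity_eq_mul (c := 1) (fun w => (one_mul _).symm) f2,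
      spectralDensity_eq_mul (fourierT_tho_iterate hχφ s k)
        (fourierT_tho_iterate (smoothL1Family_snd hψ) s k),
      spectralDensity_eq_mul (fourierT_tho_iterate (smoothL1Family_snd hφ) s k)
        (fourierT_tho_iterate hχψ s k), s1, s2]
    simp only [map_one]
    ring
  · intro x w
    rw [← I_mul_deriv_eq_functionOfD ((smoothL1Family_snd hψ).slice w),
      ← I_mul_deriv_eq_functionOfD ((smoothL1Family_fst hψ).slice w)]
    simp only [polarFamily, dX]
    ring

lemma integrable_mul_scriDensity {K : Kerr} {s : ℕ} {φ ψ : Field × Field}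
    (hφ : φ ∈ physScriSpace K s) (hψ : ψ ∈ physScriSpace K s) {q : ℝ → ℂ} (hq : LinearGrowth q) :
    Integrable (fun k => q k * scriDensity K s φ ψ k) := by
  simp only [scriDensity, mul_add]
  exact (integrable_mul_spectralDensity (smoothL1Family_opWTilde hφ) (smoothL1Family_opW hψ) hq).add
    (integrable_mul_spectralDensity (smoothL1Family_opW hφ) (smoothL1Family_opWTilde hψ) hq)

lemma wScri_eq {K : Kerr} {s : ℕ} {φ ψ : Field × Field} (hφ : φ ∈ physScriSpace K s)
    (hψ : ψ ∈ physScriSpace K s) (σ : Sgn) :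
    wScri K s σ φ ψ = 2 * ∫ k, scriMultiplier σ k * scriDensity K s φ ψ k := by
  cases σ
  · exact wScriPlus_eq hφ hψ
  · rw [wScri, wScriPlus_eq hφ hψ, I_mul_sigmaScri_eq hφ hψ, ← mul_sub,
      ← integral_sub (integrable_mul_scriDensity hφ hψ (linearGrowth_scriMultiplier .plus))
        (integrable_mul_scriDensity hφ hψ linearGrowth_self)]
    simp only [scriMultiplier, sub_mul]

/-- Spectral representation of the flowed two-point functions at past null infinity. -/
lemma wScri_flowScri_eq {K : Kerr} {s : ℕ} {φ ψ : Field × Field} (hφ : φ ∈ physScriSpace K s)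
    (hψ : ψ ∈ physScriSpace K s) (σ : Sgn) (c d : ℝ) :
    wScri K s σ (flowScri c φ) (flowScri d ψ)
      = 2 * ∫ k : ℝ, cexp (I * (d - c) * k) * (scriMultiplier σ k * scriDensity K s φ ψ k) := by
  rw [wScri_eq (flowScri_mem hφ c) (flowScri_mem hψ d)]
  congr 2
  funext k
  rw [scriDensity, opWTilde_flowScri hφ, opWTilde_flowScri hψ, opW_flowScri, opW_flowScri]
  have e : ∀ (F : Field) (b : ℝ), polarFamily (translate b F)
      = fun x w => polarFamily F (x - b) w := fun _ _ => rfl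
  simp only [e, spectralDensity_comp_sub]
  rw [scriDensity]
  ring

/-! ### The operators on the horizon -/

namespace Kerr

variable (K : Kerr)

lemma sq_sub_sq_pos : 0 < K.M ^ 2 - K.a ^ 2 := by
  have h := sq_lt_sq.2 (K.abs_a_lt.trans_le (le_abs_self K.M))
  linarith

lemma rPlus_sub_M_pos : 0 < K.rPlus - K.M := by
  have := Real.sqrt_pos.2 K.sq_sub_sq_pos
  rw [rPlus]
  linarith

lemma rPlus_pos : 0 < K.rPlus := by
  have := K.rPlus_sub_M_pos
  have := K.M_pos
  linarith

lemma area_pos : 0 < K.area := by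
  have := K.rPlus_pos
  rw [area]
  positivity

lemma kappa_pos : 0 < K.kappa := by
  have := Real.sqrt_pos.2 K.sq_sub_sq_pos
  have := K.area_pos
  rw [kappa, rPlus, rMinus]
  apply div_pos <;> linarith

end Kerr

lemma rhoSq_pos (K : Kerr) (R : Frame) : 0 < rhoSq K R := by
  have := K.rPlus_pos
  rw [rhoSq]
  positivity

lemma thoPrime_iterate (K : Kerr) (F : Field) (n : ℕ) (U : ℝ) (R : Frame) :
    ((thoPrime K)^[n] F) U R
      = (((K.rPlus - K.M) / rhoSq K R : ℝ) : ℂ) ^ n * iteratedDeriv n (fun V => F V R) U := by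
  induction n generalizing U with
  | zero => simp
  | succ n ih =>
    rw [Function.iterate_succ_apply']
    simp only [thoPrime, dX, funext ih, iteratedDeriv_succ]
    rw [deriv_const_mul_field]
    ring

lemma opU_eq (K : Kerr) (s : ℕ) (F : Field) : opU K s F = dX^[s] F := by
  funext U R
  have h1 : ((K.rPlus - K.M : ℝ) : ℂ) ≠ 0 := by exact_mod_cast K.rPlus_sub_M_pos.ne'
  have h2 : (rhoSq K R : ℂ) ≠ 0 := by exact_mod_cast (rhoSq_pos K R).ne'
  rw [opU, thoPrime_iterate, dX_iterate, ← mul_assoc]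
  rw [Complex.ofReal_div, Complex.ofReal_div, Complex.ofReal_pow, Complex.ofReal_pow, div_pow]
  generalize ((K.rPlus - K.M : ℝ) : ℂ) = p at *
  generalize (rhoSq K R : ℂ) = r at *
  field_simp

lemma conj_zeta_mul_zeta (K : Kerr) (R : Frame) :
    (starRingEnd ℂ) (zeta K R) * zeta K R = rhoSq K R := by
  simp only [zeta, rhoSq, map_sub, map_mul, Complex.conj_ofReal, Complex.conj_I]
  push_cast
  linear_combination (-(K.a : ℂ) ^ 2 * (cosTheta R : ℂ) ^ 2) * I_mul_I

lemma opB_eq (K : Kerr) (s : ℕ) (F : Field) (U : ℝ) (R : Frame) :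
    opB K s F U R = ((K.rPlus - K.M) ^ (2 * s) : ℝ) * (dX^[2 * s] F) U R := by
  have h2 : (rhoSq K R : ℂ) ≠ 0 := by exact_mod_cast (rhoSq_pos K R).ne'
  rw [opB, thoPrime_iterate, iteratedDeriv_const_mul_field, dX_iterate]
  have e : (starRingEnd ℂ) (zeta K R) ^ (2 * s) * zeta K R ^ (2 * s) = rhoSq K R ^ (2 * s) := by
    rw [← mul_pow, conj_zeta_mul_zeta]
  rw [Complex.ofReal_div, div_pow, Complex.ofReal_pow]
  generalize iteratedDeriv (2 * s) (fun y => F y R) U = D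
  calc _ = (starRingEnd ℂ) (zeta K R) ^ (2 * s) * zeta K R ^ (2 * s) / rhoSq K R ^ (2 * s)
        * ((K.rPlus - K.M : ℝ) : ℂ) ^ (2 * s) * D := by ring
    _ = _ := by rw [e, div_self (pow_ne_zero _ h2), one_mul]

/-! ### Families over the horizon in the coordinate `u = log (-U)` -/

/-- The function on `x < 0` that corresponds to the density `B(u) du` under `x = -e^u`. -/
noncomputable def pushNegExp (B : ℝ → ℝ) (x : ℝ) : ℝ :=
  if x < 0 then (-x)⁻¹ * B (Real.log (-x)) else 0

lemma integrable_pushNegExp {B : ℝ → ℝ} (hB : Integrable B) : Integrable (pushNegExp B) := by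
  rw [integrable_comp_neg_exp_iff (fun x hx => by simp [pushNegExp, hx.not_gt])]
  refine hB.congr (Eventually.of_forall fun u => ?_)
  have := Real.exp_pos u
  simp [pushNegExp, this]

lemma norm_le_pushNegExp {B : ℝ → ℝ} {F : ℝ → ℂ} (h0 : ∀ x, 0 ≤ x → F x = 0)
    (h : ∀ u, ‖F (-Real.exp u)‖ ≤ Real.exp (-u) * B u) (x : ℝ) : ‖F x‖ ≤ pushNegExp B x := by
  unfold pushNegExp
  split_ifs with hx
  · have h1 := h (Real.log (-x))
    rw [Real.exp_neg, Real.exp_log (by linarith), neg_neg] at h1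
    exact h1
  · simp [h0 x (by linarith)]

/-- The families of functions on `U < 0` that arise from the components of boost weight `s` of
elements of `S_s(H₋)`, with the estimates expressed in the coordinate `u = log (-U)`: in this form
they are manifestly invariant under dilations of `U`. -/
structure HorizonFamily (s : ℕ) (f : ℝ → ℝ × ℝ → ℂ) : Prop where
  smooth : ContDiff ℝ ∞ (Function.uncurry f)
  support : ∃ U₀ < (0 : ℝ), ∀ U ≥ U₀, ∀ w, f U w = 0
  bound : ∀ n : ℕ, ∃ B : ℝ → ℝ, Integrable B ∧ (∃ C, ∀ u, B u ≤ C) ∧ Tendsto B atTop (𝓝 0) ∧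
    ∀ u w, ‖iteratedDeriv n (fun U => f U w) (-Real.exp u)‖ ≤ Real.exp ((s - n) * u) * B u

namespace HorizonFamily

variable {s : ℕ} {f : ℝ → ℝ × ℝ → ℂ}

lemma exists_iteratedDeriv_eq_zero (h : HorizonFamily s f) :
    ∃ U₀ < (0 : ℝ), ∀ n, ∀ U > U₀, ∀ w, iteratedDeriv n (fun V => f V w) U = 0 := by
  obtain ⟨U₀, h0, hU⟩ := h.support
  refine ⟨U₀, h0, fun n U hlt w => ?_⟩
  have : (fun V => f V w) =ᶠ[𝓝 U] fun _ => 0 := by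
    filter_upwards [Ioi_mem_nhds hlt] with V hV using hU V (le_of_lt hV) w
  rw [this.iteratedDeriv_eq n]
  simp [iteratedDeriv_fun_const_zero]

lemma iteratedDeriv_eq_zero (h : HorizonFamily s f) (n : ℕ) {x : ℝ} (hx : 0 ≤ x) (w : ℝ × ℝ) :
    iteratedDeriv n (fun V => f V w) x = 0 := by
  obtain ⟨U₀, h0, hU⟩ := h.exists_iteratedDeriv_eq_zero
  exact hU n x (by linarith) w

lemma slice_hasDerivAt (h : HorizonFamily s f) (n : ℕ) (w : ℝ × ℝ) (x : ℝ) :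
    HasDerivAt (iteratedDeriv n (fun V => f V w)) (iteratedDeriv (n + 1) (fun V => f V w) x) x := by
  rw [iteratedDeriv_succ]
  exact ((contDiff_slice h.smooth w).differentiable_iteratedDeriv n
    (by exact_mod_cast ENat.natCast_lt_top n)).differentiableAt.hasDerivAt

/-- The `u`-derivatives of `e^{ju} (∂_U^{s+j} f)(-e^u)` are integrable, uniformly in the parameter:
the factor `e^{ju}` compensates the boost weight `-j` of `∂_U^{s+j} f`, and `∂_u` maps this function to
`j` times itself minus the one for `j + 1`. -/
lemma exists_bound_iteratedDeriv_exp_mul (h : HorizonFamily s f) (n : ℕ) :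
    ∀ j : ℕ, ∃ g : ℝ → ℝ, Integrable g ∧ ∀ u w,
    ‖iteratedDeriv n (fun v => (Real.exp (j * v) : ℂ) *
      iteratedDeriv (s + j) (fun U => f U w) (-Real.exp v)) u‖ ≤ g u := by
  have hs : ∀ (j : ℕ) w, ContDiff ℝ ∞ (fun v : ℝ => (Real.exp (j * v) : ℂ) *
      iteratedDeriv (s + j) (fun U => f U w) (-Real.exp v)) := by
    intro j w
    refine ContDiff.mul (Complex.ofRealCLM.contDiff.comp
      (f := fun v : ℝ => Real.exp (j * v)) (by fun_prop)) ?_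
    exact (contDiff_slice (contDiff_iteratedDeriv_param h.smooth (s + j)) w).comp
      (f := fun v : ℝ => -Real.exp v) (by fun_prop)
  induction n with
  | zero =>
    intro j
    obtain ⟨B, hB, -, -, hb⟩ := h.bound (s + j)
    refine ⟨B, hB, fun u w => ?_⟩
    rw [iteratedDeriv_zero, norm_mul, Complex.norm_real, Real.norm_of_nonneg (Real.exp_pos _).le]
    calc _ ≤ Real.exp (j * u) * (Real.exp ((s - (s + j : ℕ)) * u) * B u) := by
          gcongr
          exact hb u w
      _ = B u := by
          rw [← mul_assoc, ← Real.exp_add]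
          push_cast
          ring_nf
          simp
  | succ n ih =>
    intro j
    obtain ⟨g1, hg1, b1⟩ := ih j
    obtain ⟨g2, hg2, b2⟩ := ih (j + 1)
    refine ⟨fun u => j * g1 u + g2 u, (hg1.const_mul _).add hg2, fun u w => ?_⟩
    have hd : deriv (fun v : ℝ => (Real.exp (j * v) : ℂ) *
        iteratedDeriv (s + j) (fun U => f U w) (-Real.exp v))
        = fun v : ℝ => (j : ℂ) * ((Real.exp (j * v) : ℂ) *
          iteratedDeriv (s + j) (fun U => f U w) (-Real.exp v)) -
          (Real.exp ((j + 1 : ℕ) * v) : ℂ) *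
          iteratedDeriv (s + (j + 1)) (fun U => f U w) (-Real.exp v) := by
      funext v
      have d1 : HasDerivAt (fun v : ℝ => Real.exp (j * v)) (Real.exp (j * v) * (j * 1)) v :=
        ((hasDerivAt_id v).const_mul (j : ℝ)).exp
      have d2 := HasDerivAt.scomp v (h.slice_hasDerivAt (s + j) w (-Real.exp v))
        ((Real.hasDerivAt_exp v).neg)
      refine (d1.ofReal_comp.mul d2).deriv.trans ?_
      have e : Real.exp ((j + 1 : ℕ) * v) = Real.exp (j * v) * Real.exp v := by
        rw [← Real.exp_add]
        push_cast
        ring_nf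
      rw [Complex.real_smul, e]
      simp only [Function.comp_apply, Pi.neg_apply]
      push_cast
      rw [add_assoc]
      ring
    rw [iteratedDeriv_succ', hd, iteratedDeriv_fun_sub, iteratedDeriv_const_mul_field]
    · refine (norm_sub_le _ _).trans (add_le_add ?_ (b2 u w))
      rw [norm_mul]
      simpa using mul_le_mul_of_nonneg_left (b1 u w) (Nat.cast_nonneg j)
    · exact (contDiff_infty.1 (contDiff_const.mul (hs j w)) n).contDiffAt
    · exact (contDiff_infty.1 (hs (j + 1) w) n).contDiffAt

/-- In the coordinate `u`, the derivative `∂_U^s f` is a smooth integrable family. -/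
lemma smoothL1Family_log (h : HorizonFamily s f) :
    SmoothL1Family (fun u w => iteratedDeriv s (fun U => f U w) (-Real.exp u)) := by
  refine ⟨(contDiff_iteratedDeriv_param h.smooth s).comp
    (f := fun p : ℝ × ℝ × ℝ => (-Real.exp p.1, p.2)) (by fun_prop), fun n => ?_⟩
  simpa using h.exists_bound_iteratedDeriv_exp_mul n 0

/-- In the coordinate `U`, only the derivative of `∂_U^s f` is integrable. -/
lemma smoothL1Family_deriv (h : HorizonFamily s f) :
    SmoothL1Family (fun x w => deriv (iteratedDeriv s (fun U => f U w)) x) := by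
  obtain ⟨U₀, h0, hU⟩ := h.exists_iteratedDeriv_eq_zero
  refine ⟨contDiff_deriv_param (contDiff_iteratedDeriv_param h.smooth s), fun n => ?_⟩
  obtain ⟨B, hB, -, -, hb⟩ := h.bound (s + 1 + n)
  refine ⟨pushNegExp fun u => Real.exp (-(n * Real.log (-U₀))) * B u,
    integrable_pushNegExp (hB.const_mul _), fun x w => ?_⟩
  have e : iteratedDeriv n (fun y => deriv (iteratedDeriv s (fun U => f U w)) y)
      = iteratedDeriv (s + 1 + n) (fun U => f U w) := by
    rw [← iteratedDeriv_succ, iteratedDeriv_eq_iterate, iteratedDeriv_eq_iterate,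
      iteratedDeriv_eq_iterate, ← Function.iterate_add_apply, add_comm]
  rw [e]
  refine norm_le_pushNegExp (F := iteratedDeriv (s + 1 + n) (fun U => f U w))
    (fun x hx => h.iteratedDeriv_eq_zero _ hx w) (fun u => ?_) x
  have hB0 : 0 ≤ B u := by
    have := (norm_nonneg _).trans (hb u w)
    exact nonneg_of_mul_nonneg_right this (Real.exp_pos _)
  rcases lt_or_ge u (Real.log (-U₀)) with hu | hu
  · have : -Real.exp u > U₀ := by
      have := (Real.lt_log_iff_exp_lt (by linarith)).1 hu
      linarith
    rw [hU _ _ this, norm_zero]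
    positivity
  · refine (hb u w).trans ?_
    have : ((s : ℝ) - (s + 1 + n : ℕ)) * u = -u + -(n * u) := by
      push_cast
      ring
    rw [this, Real.exp_add, mul_assoc]
    gcongr

end HorizonFamily

/-! ### The two-point functions on the horizon in the thermal representation -/

namespace HorizonFamily

variable {s : ℕ} {f f' : ℝ → ℝ × ℝ → ℂ}

lemma functionOfD_log (h : HorizonFamily s f) (u : ℝ) (w : ℝ × ℝ) :
    (Real.exp u : ℂ) * functionOfD (indicator (Ici 0) 1)
        (fun y => I * deriv (iteratedDeriv s (fun U => f U w)) y) (-Real.exp u)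
      = functionOfD (fun k => (planck k : ℂ))
        (fun u => iteratedDeriv s (fun U => f U w) (-Real.exp u)) u :=
  functionOfD_comp_neg_exp (fun x => (h.slice_hasDerivAt s w x).differentiableAt)
    (h.smoothL1Family_deriv.slice w)
    (fun x hx => by rw [← iteratedDeriv_succ]; exact h.iteratedDeriv_eq_zero _ hx w)
    (h.smoothL1Family_log.slice w) u

/-- The integrand of `w⁺_H`. -/
lemma integrable_positiveFrequency (h : HorizonFamily s f) (h' : HorizonFamily s f') :
    Integrable (fun p : ℝ × ℝ × ℝ => (starRingEnd ℂ) (iteratedDeriv s (fun U => f U p.2) p.1) *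
      functionOfD (indicator (Ici 0) 1)
        (fun y => I * deriv (iteratedDeriv s (fun U => f' U p.2)) y) p.1)
      (volume.prod angleMeasure) := by
  obtain ⟨B, hB, -, -, hb⟩ := h.bound s
  obtain ⟨A, hA⟩ := h'.smoothL1Family_log.exists_functionOfD_bound linearGrowth_planck
  refine integrable_prod_of_le ?_ (integrable_pushNegExp (hB.mul_const A)) fun x w => ?_
  · refine StronglyMeasurable.mul ?_ ((h'.smoothL1Family_deriv.const_mul I)
      |>.stronglyMeasurable_functionOfD linearGrowth_indicator_Ici.measurable)
    exact (Complex.continuous_conj.comp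
      (contDiff_iteratedDeriv_param h.smooth s).continuous).stronglyMeasurable
  · refine norm_le_pushNegExp (F := fun x => (starRingEnd ℂ) (iteratedDeriv s (fun U => f U w) x) *
      functionOfD (indicator (Ici 0) 1)
        (fun y => I * deriv (iteratedDeriv s (fun U => f' U w)) y) x)
      (fun x hx => by simp [h.iteratedDeriv_eq_zero s hx w]) (fun u => ?_) x
    have h1 := hA u w
    rw [← h'.functionOfD_log, norm_mul, Complex.norm_real,
      Real.norm_of_nonneg (Real.exp_pos u).le] at h1
    have h2 := hb u w
    rw [sub_self, zero_mul, Real.exp_zero, one_mul] at h2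
    rw [norm_mul, RCLike.norm_conj, Real.exp_neg, inv_mul_eq_div, le_div_iff₀' (Real.exp_pos u)]
    calc _ = ‖iteratedDeriv s (fun U => f U w) (-Real.exp u)‖ * (Real.exp u *
        ‖functionOfD (indicator (Ici 0) 1)
          (fun y => I * deriv (iteratedDeriv s (fun U => f' U w)) y) (-Real.exp u)‖) := by ring
      _ ≤ B u * A := mul_le_mul h2 h1 (by positivity) ((norm_nonneg _).trans h2)

lemma boundaryIntegral_positiveFrequency (h : HorizonFamily s f) (h' : HorizonFamily s f')
    {G : Field} (hG : ∀ x w, polarFamily G x w =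
      (starRingEnd ℂ) (iteratedDeriv s (fun U => f U w) x) * functionOfD (indicator (Ici 0) 1)
        (fun y => I * deriv (iteratedDeriv s (fun U => f' U w)) y) x) :
    boundaryIntegral G = ∫ k, planck k * spectralDensity
      (fun u w => iteratedDeriv s (fun U => f U w) (-Real.exp u))
      (fun u w => iteratedDeriv s (fun U => f' U w) (-Real.exp u)) k := by
  have hG' : (fun p : ℝ × ℝ × ℝ => G p.1 (frame p.2.1 p.2.2)) = _ :=
    funext fun p : ℝ × ℝ × ℝ => hG p.1 p.2
  rw [boundaryIntegral_eq (by rw [hG']; exact h.integrable_positiveFrequency h'),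
    ← integral_sin_mul_functionOfD h.smoothL1Family_log h'.smoothL1Family_log linearGrowth_planck]
  congr 1
  funext w
  congr 1
  rw [integral_comp_neg_exp (F := fun x => G x (frame w.1 w.2)) fun x hx => by
    refine (hG x w).trans ?_
    simp [h.iteratedDeriv_eq_zero s hx w]]
  congr 1
  funext u
  refine (congrArg _ (hG (-Real.exp u) w)).trans ?_
  rw [← h'.functionOfD_log, Complex.real_smul]
  ring

lemma norm_conj_mul_le (h : HorizonFamily s f) (h' : HorizonFamily s f') (i j : ℕ) :
    ∃ B : ℝ → ℝ, Integrable B ∧ Tendsto B atTop (𝓝 0) ∧ ∀ u w,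
      ‖(starRingEnd ℂ) (iteratedDeriv i (fun U => f U w) (-Real.exp u)) *
        iteratedDeriv j (fun U => f' U w) (-Real.exp u)‖
        ≤ Real.exp ((2 * s - (i + j : ℕ)) * u) * B u := by
  obtain ⟨B, hB, -, hB0, hb⟩ := h.bound i
  obtain ⟨B', -, ⟨C, hC⟩, -, hb'⟩ := h'.bound j
  refine ⟨fun u => B u * C, hB.mul_const C, by simpa using hB0.mul_const C, fun u w => ?_⟩
  rw [norm_mul, RCLike.norm_conj]
  have h1 := hb u w
  have h2 : ‖iteratedDeriv j (fun U => f' U w) (-Real.exp u)‖ ≤ Real.exp ((s - j) * u) * C :=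
    (hb' u w).trans (mul_le_mul_of_nonneg_left (hC u) (Real.exp_pos _).le)
  have e : Real.exp ((2 * s - (i + j : ℕ)) * u)
      = Real.exp ((s - i) * u) * Real.exp ((s - j) * u) := by
    rw [← Real.exp_add]
    push_cast
    ring_nf
  rw [e]
  calc _ ≤ (Real.exp ((s - i) * u) * B u) * (Real.exp ((s - j) * u) * C) :=
        mul_le_mul h1 h2 (norm_nonneg _) ((norm_nonneg _).trans h1)
    _ = _ := by ring

lemma exists_pushNegExp_bound (h : HorizonFamily s f) (h' : HorizonFamily s f') {i j : ℕ}
    (hij : i + j = 2 * s + 1) : ∃ g : ℝ → ℝ, Integrable g ∧ ∀ x w,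
      ‖(starRingEnd ℂ) (iteratedDeriv i (fun U => f U w) x) *
        iteratedDeriv j (fun U => f' U w) x‖ ≤ g x := by
  obtain ⟨B, hB, -, hb⟩ := h.norm_conj_mul_le h' i j
  refine ⟨pushNegExp B, integrable_pushNegExp hB, fun x w => ?_⟩
  refine norm_le_pushNegExp (F := fun x => (starRingEnd ℂ) (iteratedDeriv i (fun U => f U w) x) *
        iteratedDeriv j (fun U => f' U w) x)
    (fun x hx => by simp [h.iteratedDeriv_eq_zero i hx w]) (fun u => ?_) x
  refine (hb u w).trans (le_of_eq ?_)
  rw [hij]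
  push_cast
  ring_nf

lemma continuous_conj_mul (h : HorizonFamily s f) (h' : HorizonFamily s f') (i j : ℕ) :
    Continuous (fun p : ℝ × ℝ × ℝ => (starRingEnd ℂ) (iteratedDeriv i (fun U => f U p.2) p.1) *
        iteratedDeriv j (fun U => f' U p.2) p.1) :=
  (Complex.continuous_conj.comp (contDiff_iteratedDeriv_param h.smooth i).continuous).mul
    (contDiff_iteratedDeriv_param h'.smooth j).continuous

lemma integrable_prod_conj_mul (h : HorizonFamily s f) (h' : HorizonFamily s f') {i j : ℕ}
    (hij : i + j = 2 * s + 1) :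
    Integrable (fun p : ℝ × ℝ × ℝ => (starRingEnd ℂ) (iteratedDeriv i (fun U => f U p.2) p.1) *
        iteratedDeriv j (fun U => f' U p.2) p.1) (volume.prod angleMeasure) := by
  obtain ⟨g, hg, hb⟩ := h.exists_pushNegExp_bound h' hij
  exact integrable_prod_of_le (h.continuous_conj_mul h' i j).stronglyMeasurable hg hb

lemma integrable_conj_mul (h : HorizonFamily s f) (h' : HorizonFamily s f') {i j : ℕ}
    (hij : i + j = 2 * s + 1) (w : ℝ × ℝ) :
    Integrable (fun x => (starRingEnd ℂ) (iteratedDeriv i (fun U => f U w) x) *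
        iteratedDeriv j (fun U => f' U w) x) := by
  obtain ⟨g, hg, hb⟩ := h.exists_pushNegExp_bound h' hij
  exact hg.mono' ((h.continuous_conj_mul h' i j).comp
    (f := fun x : ℝ => (x, w)) (by fun_prop)).aestronglyMeasurable
    (Eventually.of_forall fun x => hb x w)

lemma tendsto_conj_mul_atTop (h : HorizonFamily s f) (f' : ℝ → ℝ × ℝ → ℂ) (i j : ℕ) (w : ℝ × ℝ) :
    Tendsto (fun x => (starRingEnd ℂ) (iteratedDeriv i (fun U => f U w) x) *
        iteratedDeriv j (fun U => f' U w) x) atTop (𝓝 0) := by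
  refine tendsto_const_nhds.congr' ?_
  filter_upwards [eventually_ge_atTop 0] with x hx
  simp [h.iteratedDeriv_eq_zero i hx w]

lemma tendsto_conj_mul_atBot (h : HorizonFamily s f) (h' : HorizonFamily s f') {i j : ℕ}
    (hij : i + j = 2 * s) (w : ℝ × ℝ) :
    Tendsto (fun x => (starRingEnd ℂ) (iteratedDeriv i (fun U => f U w) x) *
        iteratedDeriv j (fun U => f' U w) x) atBot (𝓝 0) := by
  obtain ⟨B, -, hB, hb⟩ := h.norm_conj_mul_le h' i j
  refine squeeze_zero_norm' (a := fun x => B (Real.log (-x))) ?_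
    (hB.comp (Real.tendsto_log_atTop.comp tendsto_neg_atBot_atTop))
  filter_upwards [eventually_lt_atBot 0] with x hx
  have h1 := hb (Real.log (-x)) w
  rw [Real.exp_log (by linarith), neg_neg, hij] at h1
  simpa using h1

/-- Integration by parts: derivatives are moved from one factor to the other. -/
lemma integral_conj_mul_shift (h : HorizonFamily s f) (h' : HorizonFamily s f') (w : ℝ × ℝ)
    {i j : ℕ} (n : ℕ) (hij : i + n + j = 2 * s + 1) :
    ∫ x, (starRingEnd ℂ) (iteratedDeriv (i + n) (fun U => f U w) x) *
        iteratedDeriv j (fun U => f' U w) x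
      = (-1) ^ n * ∫ x, (starRingEnd ℂ) (iteratedDeriv i (fun U => f U w) x) *
        iteratedDeriv (j + n) (fun U => f' U w) x := by
  induction n generalizing j with
  | zero => simp
  | succ n ih =>
    have hd : ∀ x, HasDerivAt (fun x => (starRingEnd ℂ) (iteratedDeriv (i + n) (fun U => f U w) x))
        ((starRingEnd ℂ) (iteratedDeriv (i + n + 1) (fun U => f U w) x)) x := fun x =>
      (h.slice_hasDerivAt (i + n) w x).star
    have hp := integral_mul_deriv_eq_deriv_mul (fun x _ => hd x)
      (fun x _ => h'.slice_hasDerivAt j w x)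
      (h.integrable_conj_mul h' (by omega) w) (h.integrable_conj_mul h' (by omega) w)
      (h.tendsto_conj_mul_atBot h' (by omega) w) (h.tendsto_conj_mul_atTop f' _ _ w)
    rw [sub_zero, zero_sub] at hp
    rw [← add_assoc, ← neg_eq_iff_eq_neg.2 hp,
      ih (j := j + 1) (by omega), pow_succ, add_right_comm j 1 n, add_assoc j n 1]
    ring

/-- The charged symplectic form of weight-zero functions does not depend on the coordinate, up to
the orientation: `∫ conj g D_U g' dU = -∫ conj G D_u G' du`. -/
lemma integral_conj_mul_deriv_log (h' : HorizonFamily s f') (h : HorizonFamily s f) (w : ℝ × ℝ) :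
    I * ∫ x, (starRingEnd ℂ) (iteratedDeriv s (fun U => f U w) x) *
        iteratedDeriv (s + 1) (fun U => f' U w) x
      = -∫ u, (starRingEnd ℂ) (iteratedDeriv s (fun U => f U w) (-Real.exp u)) *
        functionOfD (fun k => (k : ℂ)) (fun u => iteratedDeriv s (fun U => f' U w) (-Real.exp u))
          u := by
  rw [integral_comp_neg_exp (fun x hx => by simp [h.iteratedDeriv_eq_zero s hx w]),
    ← integral_const_mul, ← integral_neg]
  congr 1
  funext u
  rw [← I_mul_deriv_eq_functionOfD (h'.smoothL1Family_log.slice w)]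
  have d2 := HasDerivAt.scomp u (h'.slice_hasDerivAt s w (-Real.exp u))
    ((Real.hasDerivAt_exp u).neg)
  rw [show deriv (fun u => iteratedDeriv s (fun U => f' U w) (-Real.exp u)) u = _ from d2.deriv]
  rw [Complex.real_smul, Complex.real_smul]
  push_cast
  ring

end HorizonFamily

/-- The properties of a pair over the horizon on which the two-point functions depend. -/
structure HorizonPair (K : Kerr) (s : ℕ) (φ : Field × Field) : Prop where
  family : HorizonFamily s (polarFamily φ.1)
  relation : ∀ U R, φ.2 U R = ((K.rPlus - K.M) ^ (2 * s) : ℝ) * (dX^[2 * s] φ.1) U R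

/-- The weight-zero function `∂_U^s φ_s` in the coordinate `u = log (-U)`. -/
noncomputable def logFamily (s : ℕ) (φ : Field × Field) : ℝ → ℝ × ℝ → ℂ := fun u w =>
  iteratedDeriv s (fun U => polarFamily φ.1 U w) (-Real.exp u)

lemma HorizonPair.smoothL1Family_logFamily {K : Kerr} {s : ℕ} {φ : Field × Field}
    (h : HorizonPair K s φ) : SmoothL1Family (logFamily s φ) := h.family.smoothL1Family_log

/-- The multipliers of `w^±_H`: the Bose factors `k / (e^{2πk} - 1)` and `k / (1 - e^{-2πk})`. -/
noncomputable def horizonMultiplier : Sgn → ℝ → ℂ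
  | .plus, k => planck k
  | .minus, k => planck k + k

lemma linearGrowth_horizonMultiplier (σ : Sgn) : LinearGrowth (horizonMultiplier σ) := by
  cases σ
  · exact linearGrowth_planck
  · exact linearGrowth_planck.add linearGrowth_self

lemma functionOfD_const_mul (q : ℝ → ℂ) (c : ℂ) (f : ℝ → ℂ) (x : ℝ) :
    functionOfD q (fun y => c * f y) x = c * functionOfD q f x := by
  simp only [functionOfD, fourierT_const_mul]
  rw [mul_left_comm, ← integral_const_mul c]
  congr 2
  funext k
  ring

lemma posD_const_mul (c : ℂ) (F : Field) (x : ℝ) (R : Frame) :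
    posD (fun U Q => c * F U Q) x R = c * posD F x R := by
  unfold posD
  rw [← functionOfD_const_mul]
  congr 1
  funext y
  simp only [dX]
  rw [deriv_const_mul_field]
  ring

lemma polarFamily_dX_iterate (F : Field) (n : ℕ) (x : ℝ) (w : ℝ × ℝ) :
    (dX^[n] F) x (frame w.1 w.2) = iteratedDeriv n (fun U => polarFamily F U w) x :=
  dX_iterate F n x _

lemma wHorizonPlus_eq {K : Kerr} {s : ℕ} {φ ψ : Field × Field} (hφ : HorizonPair K s φ)
    (hψ : HorizonPair K s ψ) :
    wHorizonPlus K s φ ψ = 4 * ((K.rPlus - K.M) ^ (2 * s) : ℝ) * K.area *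
      ∫ k, horizonMultiplier .plus k * spectralDensity (logFamily s φ) (logFamily s ψ) k := by
  have e : (fun (U : ℝ) (R : Frame) =>
    ((starRingEnd ℂ) (opU K s φ.1 U R) * posD (opUTilde K s ψ) U R
      + (starRingEnd ℂ) (opUTilde K s φ U R) * posD (opU K s ψ.1) U R) * (K.area : ℂ))
      = fun U R => (2 * ((K.rPlus - K.M) ^ (2 * s) : ℝ) * K.area) *
        ((starRingEnd ℂ) ((dX^[s] φ.1) U R) * posD (dX^[s] ψ.1) U R) := by
    funext U R
    unfold opUTilde
    rw [posD_const_mul, map_mul, Complex.conj_ofReal, opU_eq, opU_eq]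
    ring
  rw [wHorizonPlus, e, boundaryIntegral_const_mul,
    hφ.family.boundaryIntegral_positiveFrequency hψ.family]
  · simp only [horizonMultiplier]
    unfold logFamily
    ring
  · intro x w
    simp only [polarFamily, posD, polarFamily_dX_iterate]
    have : ∀ y, dX (dX^[s] ψ.1) y (frame w.1 w.2)
        = deriv (iteratedDeriv s fun U => ψ.1 U (frame w.1 w.2)) y := by
      intro y
      simp only [dX, dX_iterate]
    simp only [this]

lemma I_mul_sigmaHorizon_eq {K : Kerr} {s : ℕ} {φ ψ : Field × Field} (hφ : HorizonPair K s φ)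
    (hψ : HorizonPair K s ψ) :
    I * sigmaHorizon K s φ ψ = -(4 * ((K.rPlus - K.M) ^ (2 * s) : ℝ) * K.area *
      ∫ k : ℝ, (k : ℂ) * spectralDensity (logFamily s φ) (logFamily s ψ) k) := by
  set c : ℝ := (K.rPlus - K.M) ^ (2 * s) with hc
  set P : Field := fun U R => (starRingEnd ℂ) (φ.1 U R) * (dX^[2 * s + 1] ψ.1) U R
    + (starRingEnd ℂ) ((dX^[2 * s] φ.1) U R) * (dX^[1] ψ.1) U R with hP
  have e : (fun (U : ℝ) (R : Frame) => ((starRingEnd ℂ) (φ.1 U R) * dX ψ.2 U R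
      + (starRingEnd ℂ) (φ.2 U R) * dX ψ.1 U R) * (K.area : ℂ))
      = fun U R => (c * K.area : ℂ) * P U R := by
    funext U R
    have e1 : dX ψ.2 U R = c * (dX^[2 * s + 1] ψ.1) U R := by
      rw [Function.iterate_succ_apply']
      simp only [dX]
      rw [← deriv_const_mul_field]
      congr 1
      funext y
      exact hψ.relation y R
    rw [e1, hφ.relation, map_mul, Complex.conj_ofReal, hP]
    simp only [Function.iterate_one]
    ring
  have hPp : ∀ x (w : ℝ × ℝ), P x (frame w.1 w.2)
      = (starRingEnd ℂ) (iteratedDeriv 0 (fun U => polarFamily φ.1 U w) x) *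
          iteratedDeriv (2 * s + 1) (fun U => polarFamily ψ.1 U w) x
        + (starRingEnd ℂ) (iteratedDeriv (2 * s) (fun U => polarFamily φ.1 U w) x) *
          iteratedDeriv 1 (fun U => polarFamily ψ.1 U w) x := by
    intro x w
    simp only [hP, polarFamily_dX_iterate, iteratedDeriv_zero, polarFamily]
  have hi : Integrable (fun p : ℝ × ℝ × ℝ => P p.1 (frame p.2.1 p.2.2))
      (volume.prod angleMeasure) := by
    simp only [hPp]
    exact (hφ.family.integrable_prod_conj_mul hψ.family (by omega)).add
      (hφ.family.integrable_prod_conj_mul hψ.family (by omega))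
  have hin : ∀ w : ℝ × ℝ, I * ∫ x, P x (frame w.1 w.2)
      = -(2 * (-1) ^ s) * ∫ u, (starRingEnd ℂ) (logFamily s φ u w) *
        functionOfD (fun k => (k : ℂ)) (fun u => logFamily s ψ u w) u := by
    intro w
    simp only [hPp]
    rw [integral_add (hφ.family.integrable_conj_mul hψ.family (by omega) w)
      (hφ.family.integrable_conj_mul hψ.family (by omega) w)]
    have s1 := hφ.family.integral_conj_mul_shift hψ.family w (i := 0) (j := s + 1) s (by omega)
    have s2 := hφ.family.integral_conj_mul_shift hψ.family w (i := s) (j := 1) s (by omega)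
    have hlog := HorizonFamily.integral_conj_mul_deriv_log hψ.family hφ.family w
    rw [zero_add, show s + 1 + s = 2 * s + 1 by ring] at s1
    rw [← two_mul, add_comm 1 s] at s2
    have s1' : ∫ x, (starRingEnd ℂ) (iteratedDeriv 0 (fun U => polarFamily φ.1 U w) x) *
          iteratedDeriv (2 * s + 1) (fun U => polarFamily ψ.1 U w) x
        = (-1) ^ s * ∫ x, (starRingEnd ℂ) (iteratedDeriv s (fun U => polarFamily φ.1 U w) x) *
          iteratedDeriv (s + 1) (fun U => polarFamily ψ.1 U w) x := by
      rw [s1, ← mul_assoc, ← mul_pow]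
      simp
    unfold logFamily
    rw [s1', s2]
    linear_combination (2 * (-1) ^ s) * hlog
  have h1 : I * sigmaHorizon K s φ ψ = 2 * (-1) ^ s * (c * K.area) * (I * boundaryIntegral P) := by
    rw [sigmaHorizon, e, boundaryIntegral_const_mul]
    ring
  have h2 : I * boundaryIntegral P = -(2 * (-1) ^ s) *
      ∫ k : ℝ, (k : ℂ) * spectralDensity (logFamily s φ) (logFamily s ψ) k := by
    rw [boundaryIntegral_eq hi, ← integral_sin_mul_functionOfD hφ.smoothL1Family_logFamily
      hψ.smoothL1Family_logFamily linearGrowth_self, ← integral_const_mul, ← integral_const_mul]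
    congr 1
    funext w
    rw [mul_left_comm, hin]
    ring
  have hsq : ((-1 : ℂ) ^ s) * (-1) ^ s = 1 := by rw [← mul_pow]; simp
  rw [h1, h2]
  linear_combination (-4 * (c * K.area : ℂ) *
    ∫ k : ℝ, (k : ℂ) * spectralDensity (logFamily s φ) (logFamily s ψ) k) * hsq

lemma wHorizon_eq {K : Kerr} {s : ℕ} {φ ψ : Field × Field} (hφ : HorizonPair K s φ)
    (hψ : HorizonPair K s ψ) (σ : Sgn) :
    wHorizon K s σ φ ψ = 4 * ((K.rPlus - K.M) ^ (2 * s) : ℝ) * K.area *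
      ∫ k, horizonMultiplier σ k * spectralDensity (logFamily s φ) (logFamily s ψ) k := by
  cases σ
  · exact wHorizonPlus_eq hφ hψ
  · have hi : ∀ {q : ℝ → ℂ}, LinearGrowth q →
        Integrable fun k => q k * spectralDensity (logFamily s φ) (logFamily s ψ) k :=
      fun hq => integrable_mul_spectralDensity hφ.smoothL1Family_logFamily
        hψ.smoothL1Family_logFamily hq
    rw [wHorizon, wHorizonPlus_eq hφ hψ, I_mul_sigmaHorizon_eq hφ hψ, sub_neg_eq_add, ← mul_add,
      ← integral_add (hi (linearGrowth_horizonMultiplier .plus)) (hi linearGrowth_self)]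
    simp only [horizonMultiplier, add_mul]

/-! ### The decay of sections over the horizon in the coordinate `u = log (-U)` -/

lemma exp_le_bracket_neg_exp (u : ℝ) : Real.exp u ≤ bracket (-Real.exp u) := by
  rw [bracket]
  exact Real.le_sqrt_of_sq_le (by rw [neg_sq]; linarith)

lemma bracket_neg_exp_le {U₀ u : ℝ} (h0 : U₀ < 0) (hu : -Real.exp u ≤ U₀) :
    bracket (-Real.exp u) ≤ (1 + (-U₀)⁻¹) * Real.exp u := by
  have h1 : 1 ≤ (-U₀)⁻¹ * Real.exp u := by
    rw [inv_mul_eq_div, le_div_iff₀ (by linarith)]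
    linarith
  have := Real.exp_pos u
  rw [add_mul, one_mul, bracket, Real.sqrt_le_left (by linarith), neg_sq]
  nlinarith

lemma bracket_neg_exp_rpow_le {U₀ u : ℝ} (h0 : U₀ < 0) (hu : -Real.exp u ≤ U₀) (p : ℝ) :
    bracket (-Real.exp u) ^ p ≤ (1 + (-U₀)⁻¹) ^ |p| * Real.exp (p * u) := by
  have hU : 0 < (-U₀)⁻¹ := inv_pos.2 (by linarith)
  rw [mul_comm p u, Real.exp_mul]
  rcases le_total 0 p with hp | hp
  · rw [abs_of_nonneg hp, ← Real.mul_rpow (by positivity) (Real.exp_pos u).le]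
    exact Real.rpow_le_rpow (bracket_pos _).le (bracket_neg_exp_le h0 hu) hp
  · refine (Real.rpow_le_rpow_of_nonpos (Real.exp_pos u) (exp_le_bracket_neg_exp u) hp).trans ?_
    exact le_mul_of_one_le_left (by positivity)
      (Real.one_le_rpow (by linarith) (abs_nonneg p))

/-- Away from `U = 0`, the factor `log ⟨U⟩` dominates `1 + |u|`. -/
lemma exists_mul_one_add_abs_le_log_bracket {U₀ : ℝ} (h0 : U₀ < 0) :
    ∃ c > (0 : ℝ), ∀ u, -Real.exp u ≤ U₀ →
      c * (1 + |u|) ≤ Real.log (bracket (-Real.exp u)) := by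
  have hb : 1 < bracket U₀ := by
    rw [bracket, Real.lt_sqrt zero_le_one]
    nlinarith
  have hl := Real.log_pos hb
  set u₀ := Real.log (-U₀)
  refine ⟨min (1 / 2) (Real.log (bracket U₀) / (2 + |u₀|)), by positivity, fun u hu => ?_⟩
  have hu₀ : u₀ ≤ u := (Real.log_le_iff_le_exp (by linarith)).2 (by linarith)
  rcases le_total 1 u with h1 | h1
  · calc _ ≤ 1 / 2 * (1 + |u|) := by
          gcongr
          exact min_le_left _ _
      _ ≤ u := by
          rw [abs_of_nonneg (zero_le_one.trans h1)]
          linarith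
      _ ≤ _ := (Real.le_log_iff_exp_le (bracket_pos _)).2 (exp_le_bracket_neg_exp u)
  · have h2 : |u| ≤ 1 + |u₀| := by
      rw [abs_le]
      constructor <;> linarith [neg_abs_le u₀, abs_nonneg u₀]
    calc _ ≤ Real.log (bracket U₀) / (2 + |u₀|) * (2 + |u₀|) := by
          exact mul_le_mul (min_le_right _ _) (by linarith) (by positivity) (by positivity)
      _ = Real.log (bracket U₀) := by field_simp
      _ ≤ _ := by
          refine Real.log_le_log (by linarith) (Real.sqrt_le_sqrt ?_)
          nlinarith

/-- The weight `(log ⟨U⟩)^{-d}`, which is integrable in `u` for `d > 1`, turns into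
`(1 + |u|)^{-d}`. -/
lemma horizonFamily_polarFamily {s : ℕ} {φ : Field × Field} (h : φ ∈ leftHorizonSpace s) :
    HorizonFamily s (polarFamily φ.1) := by
  obtain ⟨⟨hs, -, d, hd, -, hb⟩, U₀, h0, hU⟩ := h
  refine ⟨hs.contDiff_polarFamily, ⟨U₀, h0, fun U hlt w => (hU U hlt _).1⟩, fun n => ?_⟩
  obtain ⟨C, hC⟩ := hb n
  obtain ⟨c, hc, hlog⟩ := exists_mul_one_add_abs_le_log_bracket h0
  have hU0 : 0 < (-U₀)⁻¹ := inv_pos.2 (by linarith)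
  set A : ℝ := |C| * (1 + (-U₀)⁻¹) ^ |(s : ℝ) - n| * (c ^ (d + n))⁻¹ with hA
  have hA0 : 0 ≤ A := by positivity
  refine ⟨fun u => A * (1 + |u|) ^ (-d), ?_, ⟨A, fun u => ?_⟩, ?_, fun u w => ?_⟩
  · have := integrable_one_add_norm (E := ℝ) (μ := volume) (r := d) (by simpa using hd)
    exact this.const_mul A
  · refine mul_le_of_le_one_right hA0 (Real.rpow_le_one_of_one_le_of_nonpos ?_ (by linarith))
    linarith [abs_nonneg u]
  · have h1 := (tendsto_rpow_neg_atTop (y := d) (by linarith)).comp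
      (tendsto_atTop_add_const_left atTop 1 tendsto_abs_atTop_atTop)
    simpa using h1.const_mul A
  · rcases lt_or_ge U₀ (-Real.exp u) with hu | hu
    · have : (fun V => polarFamily φ.1 V w) =ᶠ[𝓝 (-Real.exp u)] fun _ => 0 := by
        filter_upwards [Ioi_mem_nhds hu] with V hV using (hU V (le_of_lt hV) _).1
      rw [this.iteratedDeriv_eq n]
      simp only [iteratedDeriv_fun_const_zero, norm_zero]
      positivity
    · have h1 := (hC (-Real.exp u) (frame w.1 w.2)).1
      rw [dX_iterate] at h1
      set D := ‖iteratedDeriv n (fun V => polarFamily φ.1 V w) (-Real.exp u)‖ with hD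
      have hone : 1 ≤ 1 + |u| := by linarith [abs_nonneg u]
      have h2 : D * (c ^ (d + n) * (1 + |u|) ^ d)
          ≤ |C| * ((1 + (-U₀)⁻¹) ^ |(s : ℝ) - n| * Real.exp ((s - n) * u)) := by
        calc D * (c ^ (d + n) * (1 + |u|) ^ d)
            ≤ D * (c ^ (d + n) * (1 + |u|) ^ (d + n)) := by
              have : d ≤ d + n := le_add_of_nonneg_right n.cast_nonneg
              gcongr
          _ = D * (c * (1 + |u|)) ^ (d + n) := by rw [Real.mul_rpow hc.le (by linarith)]
          _ ≤ D * Real.log (bracket (-Real.exp u)) ^ (d + n) := by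
              have := hlog u hu
              have : 0 ≤ (n : ℝ) := n.cast_nonneg
              gcongr
          _ ≤ C * bracket (-Real.exp u) ^ ((s : ℝ) - n) := h1
          _ ≤ |C| * bracket (-Real.exp u) ^ ((s : ℝ) - n) :=
              mul_le_mul_of_nonneg_right (le_abs_self C)
                (Real.rpow_nonneg (bracket_pos _).le _)
          _ ≤ _ := mul_le_mul_of_nonneg_left (bracket_neg_exp_rpow_le h0 hu _) (abs_nonneg C)
      rw [← le_div_iff₀ (by positivity)] at h2
      refine h2.trans (le_of_eq ?_)
      simp only [hA]
      rw [Real.rpow_neg (zero_le_one.trans hone)]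
      field_simp

lemma horizonPair_of_mem {K : Kerr} {s : ℕ} {φ : Field × Field}
    (h : φ ∈ physHorizonSpace K s ∩ leftHorizonSpace s) : HorizonPair K s φ :=
  ⟨horizonFamily_polarFamily h.2, fun U R => by rw [h.1.2.2, opB_eq]⟩

/-! ### The flow on the horizon -/

lemma iteratedDeriv_dilation {g : ℝ → ℂ} (hg : ContDiff ℝ ∞ g) (a : ℂ) (c : ℝ) (n : ℕ) (x : ℝ) :
    iteratedDeriv n (fun y => a * g (c * y)) x = a * ((c : ℂ) ^ n * iteratedDeriv n g (c * x)) := by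
  rw [iteratedDeriv_const_mul_field, iteratedDeriv_comp_const_smul (contDiff_infty.1 hg n) c]
  simp

lemma HorizonFamily.flow {s : ℕ} {f : ℝ → ℝ × ℝ → ℂ} (h : HorizonFamily s f) (t : ℝ) :
    HorizonFamily s (fun U w => (Real.exp (-(s * t)) : ℂ) * f (Real.exp t * U) w) := by
  refine ⟨contDiff_const.mul (h.smooth.comp
    (f := fun p : ℝ × ℝ × ℝ => (Real.exp t * p.1, p.2)) (by fun_prop)), ?_, fun n => ?_⟩
  · obtain ⟨U₀, h0, hU⟩ := h.support
    refine ⟨Real.exp (-t) * U₀, mul_neg_of_pos_of_neg (Real.exp_pos _) h0, fun U hlt w => ?_⟩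
    have h1 := mul_le_mul_of_nonneg_left hlt (Real.exp_pos t).le
    rw [← mul_assoc, ← Real.exp_add, add_neg_cancel, Real.exp_zero, one_mul] at h1
    rw [hU _ h1, mul_zero]
  · obtain ⟨B, hB, ⟨C, hC⟩, hB0, hb⟩ := h.bound n
    refine ⟨fun u => B (u + t), hB.comp_add_right t, ⟨C, fun u => hC _⟩,
      hB0.comp (tendsto_atTop_add_const_right _ t tendsto_id), fun u w => ?_⟩
    rw [iteratedDeriv_dilation (contDiff_slice h.smooth w), mul_neg, ← Real.exp_add, norm_mul,
      norm_mul, norm_pow, Complex.norm_real, Complex.norm_real,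
      Real.norm_of_nonneg (Real.exp_pos _).le, Real.norm_of_nonneg (Real.exp_pos _).le,
      ← Real.exp_nat_mul, add_comm t u]
    calc _ ≤ Real.exp (-(s * t)) * (Real.exp (n * t) *
          (Real.exp ((s - n) * (u + t)) * B (u + t))) := by
          gcongr
          exact hb (u + t) w
      _ = _ := by
          rw [← mul_assoc, ← mul_assoc, ← Real.exp_add, ← Real.exp_add]
          ring_nf

section

variable {K : Kerr} {s : ℕ} {φ ψ : Field × Field}

lemma polarFamily_flowHorizon (K : Kerr) (s : ℕ) (φ : Field × Field) (b : ℝ) :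
    polarFamily (flowHorizon K s b φ).1 = fun U w => (Real.exp (-(s * (K.kappa * b))) : ℂ) *
      polarFamily φ.1 (Real.exp (K.kappa * b) * U) w := by
  funext U w
  simp only [polarFamily, flowHorizon, mul_assoc]

lemma horizonPair_flowHorizon (h : φ ∈ physHorizonSpace K s ∩ leftHorizonSpace s) (b : ℝ) :
    HorizonPair K s (flowHorizon K s b φ) := by
  refine ⟨?_, fun U R => ?_⟩
  · rw [polarFamily_flowHorizon]
    exact (horizonPair_of_mem h).family.flow _
  · rw [dX_iterate]
    simp only [flowHorizon]
    rw [(horizonPair_of_mem h).relation, dX_iterate,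
      iteratedDeriv_dilation (h.1.1.1.contDiff R)]
    have e : Real.exp (s * K.kappa * b)
        = Real.exp (-(s * K.kappa * b)) * Real.exp (K.kappa * b) ^ (2 * s) := by
      rw [← Real.exp_nat_mul, ← Real.exp_add]
      push_cast
      ring_nf
    rw [e]
    push_cast
    ring

/-- The flow acts on `∂_U^s φ_s` by translations of `u = log (-U)`. -/
lemma logFamily_flowHorizon (h : φ ∈ physHorizonSpace K s ∩ leftHorizonSpace s) (b : ℝ) :
    logFamily s (flowHorizon K s b φ) = fun u w => logFamily s φ (u - -(K.kappa * b)) w := by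
  funext u w
  simp only [logFamily]
  rw [polarFamily_flowHorizon, iteratedDeriv_dilation
    (contDiff_slice (horizonPair_of_mem h).family.smooth w), ← mul_assoc, ← Complex.ofReal_pow,
    ← Complex.ofReal_mul, ← Real.exp_nat_mul, ← Real.exp_add, neg_add_cancel, Real.exp_zero,
    Complex.ofReal_one, one_mul, mul_neg, ← Real.exp_add, sub_neg_eq_add, add_comm u]

lemma flowHorizon_zero (K : Kerr) (s : ℕ) (φ : Field × Field) : flowHorizon K s 0 φ = φ := by
  simp [flowHorizon]

/-- Spectral representation of the flowed two-point functions on the horizon. -/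
lemma wHorizon_flowHorizon_eq (hφ : φ ∈ physHorizonSpace K s ∩ leftHorizonSpace s)
    (hψ : ψ ∈ physHorizonSpace K s ∩ leftHorizonSpace s) (σ : Sgn) (c d : ℝ) :
    wHorizon K s σ (flowHorizon K s c φ) (flowHorizon K s d ψ)
      = 4 * ((K.rPlus - K.M) ^ (2 * s) : ℝ) * K.area *
        ∫ k : ℝ, cexp (I * ((-K.kappa : ℝ) * (d - c : ℝ)) * k) *
          (horizonMultiplier σ k * spectralDensity (logFamily s φ) (logFamily s ψ) k) := by
  rw [wHorizon_eq (horizonPair_flowHorizon hφ c) (horizonPair_flowHorizon hψ d)]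
  congr 2
  funext k
  rw [logFamily_flowHorizon hφ, logFamily_flowHorizon hψ, spectralDensity_comp_sub, mul_left_comm]
  congr 3
  push_cast
  ring

end

/-! ### The Fourier transform of test functions -/

lemma hasCompactSupport_iteratedDeriv {g : ℝ → ℂ} (hc : HasCompactSupport g) (n : ℕ) :
    HasCompactSupport (iteratedDeriv n g) := by
  induction n with
  | zero => simpa
  | succ n ih =>
    rw [iteratedDeriv_succ]
    exact ih.deriv

lemma smoothL1_of_hasCompactSupport {g : ℝ → ℂ} (hg : ContDiff ℝ ∞ g) (hc : HasCompactSupport g) :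
    SmoothL1 g :=
  ⟨hg, fun n => ((contDiff_infty.1 hg n).continuous_iteratedDeriv n le_rfl
    ).integrable_of_hasCompactSupport (hasCompactSupport_iteratedDeriv hc n)⟩

lemma smoothL1_ofReal_comp {f : ℝ → ℝ} (hf : ContDiff ℝ ∞ f) (hc : HasCompactSupport f) :
    SmoothL1 (fun x => (f x : ℂ)) :=
  smoothL1_of_hasCompactSupport (Complex.ofRealCLM.contDiff.comp hf)
    (hc.comp_left (g := ((↑) : ℝ → ℂ)) rfl)

lemma smoothL1_cexp_mul {f : ℝ → ℝ} (hf : ContDiff ℝ ∞ f) (hc : HasCompactSupport f) (c : ℝ) :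
    SmoothL1 (fun x => cexp (-(c * x)) * f x) := by
  refine smoothL1_of_hasCompactSupport (ContDiff.mul ?_ (Complex.ofRealCLM.contDiff.comp hf)) ?_
  · have : ContDiff ℝ ∞ fun x : ℝ => (x : ℂ) := Complex.ofRealCLM.contDiff
    exact (contDiff_const.mul this).neg.cexp
  · exact (hc.comp_left (g := ((↑) : ℝ → ℂ)) rfl).mul_left

/-- A shift of the argument into the complex plane. -/
lemma fourierT_add_mul_I (g : ℝ → ℂ) (z : ℂ) (c : ℝ) :
    fourierT g (z + c * I) = fourierT (fun x => cexp (-(c * x)) * g x) z := by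
  simp only [fourierT]
  congr 2
  funext x
  rw [← mul_assoc, ← Complex.exp_add]
  congr 2
  linear_combination (c * x : ℂ) * I_mul_I

/-- **Detailed balance**: the multipliers of the two signs differ by the Boltzmann factor. -/
lemma horizonMultiplier_eq (σ : Sgn) (k : ℝ) :
    horizonMultiplier σ k = cexp (-(σ.val * (2 * Real.pi * k))) * horizonMultiplier σ.flip k := by
  have h : (planck k + k : ℂ) = cexp (2 * Real.pi * k) * planck k := by
    exact_mod_cast planck_add_self k
  cases σ
  · simp only [horizonMultiplier, Sgn.val, Sgn.flip]
    rw [h, ← mul_assoc, ← Complex.exp_add]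
    simp
  · simp only [horizonMultiplier, Sgn.val, Sgn.flip, h]
    simp

lemma beta_mul_kappa (K : Kerr) : K.beta * K.kappa = 2 * Real.pi := by
  rw [Kerr.beta, div_mul_cancel₀ _ K.kappa_pos.ne']

lemma scriMultiplier_eq_zero {σ : Sgn} {k : ℝ} (h : σ.val * k < 0) : scriMultiplier σ k = 0 := by
  cases σ
  · simp only [Sgn.val, one_mul] at h
    simp [scriMultiplier, h]
  · simp only [Sgn.val] at h
    have : 0 ≤ k := by linarith
    simp [scriMultiplier, this]

/-! ### The KMS and the ground state condition -/

section

variable {K : Kerr} {s : ℕ} {φ ψ : Field × Field}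

lemma wHorizon_flowHorizon_right_eq (hφ : φ ∈ physHorizonSpace K s ∩ leftHorizonSpace s)
    (hψ : ψ ∈ physHorizonSpace K s ∩ leftHorizonSpace s) (σ : Sgn) (b : ℝ) :
    wHorizon K s σ φ (flowHorizon K s b ψ) = 4 * ((K.rPlus - K.M) ^ (2 * s) : ℝ) * K.area *
        ∫ k : ℝ, cexp (I * ((-K.kappa : ℝ) * b) * k) *
          (horizonMultiplier σ k * spectralDensity (logFamily s φ) (logFamily s ψ) k) := by
  have h := wHorizon_flowHorizon_eq hφ hψ σ 0 b
  rwa [flowHorizon_zero, sub_zero] at h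

lemma integrable_horizonMultiplier_mul (hφ : φ ∈ physHorizonSpace K s ∩ leftHorizonSpace s)
    (hψ : ψ ∈ physHorizonSpace K s ∩ leftHorizonSpace s) (σ : Sgn) :
    Integrable (fun k =>
      horizonMultiplier σ k * spectralDensity (logFamily s φ) (logFamily s ψ) k) :=
  integrable_mul_spectralDensity (horizonPair_of_mem hφ).smoothL1Family_logFamily
    (horizonPair_of_mem hψ).smoothL1Family_logFamily (linearGrowth_horizonMultiplier σ)

lemma integrable_fourierT_mul_wHorizon (hφ : φ ∈ physHorizonSpace K s ∩ leftHorizonSpace s)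
    (hψ : ψ ∈ physHorizonSpace K s ∩ leftHorizonSpace s) (σ : Sgn) {g : ℝ → ℂ} (hg : SmoothL1 g) :
    Integrable (fun b : ℝ => fourierT g b * wHorizon K s σ φ (flowHorizon K s b ψ)) := by
  simp only [wHorizon_flowHorizon_right_eq hφ hψ, mul_left_comm (fourierT g _)]
  exact (integrable_fourierT_mul_integral hg (integrable_horizonMultiplier_mul hφ hψ σ)
    (-K.kappa)).const_mul _

lemma integral_fourierT_mul_wHorizon (hφ : φ ∈ physHorizonSpace K s ∩ leftHorizonSpace s)
    (hψ : ψ ∈ physHorizonSpace K s ∩ leftHorizonSpace s) (σ : Sgn) {g : ℝ → ℂ} (hg : SmoothL1 g) :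
    ∫ b : ℝ, fourierT g b * wHorizon K s σ φ (flowHorizon K s b ψ)
      = 4 * ((K.rPlus - K.M) ^ (2 * s) : ℝ) * K.area * (√(2 * Real.pi) * ∫ k : ℝ, g (K.kappa * k) *
        (horizonMultiplier σ k * spectralDensity (logFamily s φ) (logFamily s ψ) k)) := by
  simp only [wHorizon_flowHorizon_right_eq hφ hψ, mul_left_comm (fourierT g _)]
  rw [integral_const_mul, integral_fourierT_mul_integral hg
    (integrable_horizonMultiplier_mul hφ hψ σ)]
  simp only [neg_mul, neg_neg]

/-- The KMS condition: the Boltzmann factor in the multiplier is the effect of shifting the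
argument of `f̂` by `± i β`. -/
lemma integral_fourierT_mul_wHorizon_eq_flip
    (hφ : φ ∈ physHorizonSpace K s ∩ leftHorizonSpace s)
    (hψ : ψ ∈ physHorizonSpace K s ∩ leftHorizonSpace s) (σ : Sgn) {f : ℝ → ℝ}
    (hf : ContDiff ℝ ∞ f) (hc : HasCompactSupport f) :
    ∫ b : ℝ, fourierT (fun x => (f x : ℂ)) b * wHorizon K s σ φ (flowHorizon K s b ψ)
      = ∫ b : ℝ, fourierT (fun x => cexp (-((σ.val * K.beta : ℝ) * x)) * (f x : ℂ)) b *
        wHorizon K s σ.flip φ (flowHorizon K s b ψ) := by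
  rw [integral_fourierT_mul_wHorizon hφ hψ σ (smoothL1_ofReal_comp hf hc),
    integral_fourierT_mul_wHorizon hφ hψ σ.flip (smoothL1_cexp_mul hf hc _)]
  congr 3
  funext k
  have e : (((σ.val * K.beta : ℝ) : ℂ) * (K.kappa * k : ℝ)) = σ.val * (2 * Real.pi * k) := by
    rw [← Complex.ofReal_mul, mul_assoc σ.val, ← mul_assoc K.beta, beta_mul_kappa]
    push_cast
    ring
  rw [horizonMultiplier_eq σ, e]
  ring

lemma wScri_flowScri_right_eq (hφ : φ ∈ physScriSpace K s) (hψ : ψ ∈ physScriSpace K s) (σ : Sgn)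
    (b : ℝ) : wScri K s σ φ (flowScri b ψ)
      = 2 * ∫ k : ℝ, cexp (I * ((1 : ℝ) * b) * k) *
        (scriMultiplier σ k * scriDensity K s φ ψ k) := by
  have h := wScri_flowScri_eq hφ hψ σ 0 b
  have e : flowScri 0 φ = φ := by simp [flowScri]
  rw [e] at h
  simpa using h

lemma integrable_scriMultiplier_mul (hφ : φ ∈ physScriSpace K s) (hψ : ψ ∈ physScriSpace K s)
    (σ : Sgn) : Integrable (fun k => scriMultiplier σ k * scriDensity K s φ ψ k) :=
  integrable_mul_scriDensity hφ hψ (linearGrowth_scriMultiplier σ)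

lemma integrable_fourierT_mul_wScri (hφ : φ ∈ physScriSpace K s) (hψ : ψ ∈ physScriSpace K s)
    (σ : Sgn) {g : ℝ → ℂ} (hg : SmoothL1 g) :
    Integrable (fun b : ℝ => fourierT g b * wScri K s σ φ (flowScri b ψ)) := by
  simp only [wScri_flowScri_right_eq hφ hψ, mul_left_comm (fourierT g _)]
  exact (integrable_fourierT_mul_integral hg (integrable_scriMultiplier_mul hφ hψ σ) 1).const_mul _

/-- The ground state condition: the support of `f(-k)` does not meet that of the multiplier. -/
lemma integral_fourierT_mul_wScri_eq_zero (hφ : φ ∈ physScriSpace K s)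
    (hψ : ψ ∈ physScriSpace K s) (σ : Sgn) {f : ℝ → ℝ} (hf : ContDiff ℝ ∞ f)
    (hc : HasCompactSupport f) (hs : tsupport f ⊆ {x : ℝ | 0 < σ.val * x}) :
    ∫ b : ℝ, fourierT (fun x => (f x : ℂ)) b * wScri K s σ φ (flowScri b ψ) = 0 := by
  simp only [wScri_flowScri_right_eq hφ hψ, mul_left_comm (fourierT _ _)]
  rw [integral_const_mul, integral_fourierT_mul_integral (smoothL1_ofReal_comp hf hc)
    (integrable_scriMultiplier_mul hφ hψ σ)]
  have h0 : ∀ k : ℝ, (f (-(1 * k)) : ℂ) * (scriMultiplier σ k * scriDensity K s φ ψ k) = 0 := by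
    intro k
    by_cases h : -(1 * k) ∈ tsupport f
    · have h1 : 0 < σ.val * -(1 * k) := hs h
      rw [scriMultiplier_eq_zero (by linarith), zero_mul, mul_zero]
    · rw [image_eq_zero_of_notMem_tsupport h, Complex.ofReal_zero, zero_mul]
  simp only [h0, integral_zero, mul_zero]

end

end KerrTeukolsky

theorem mainTheorem7 (K : KerrTeukolsky.Kerr) (s : ℕ) (hs : s ≤ 2) :
    (∀ φ ∈ physHorizonSpace K s ∩ leftHorizonSpace s,
      ∀ φ' ∈ physHorizonSpace K s ∩ leftHorizonSpace s, ∀ σ : Sgn,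
        (∀ b : ℝ, wHorizon K s σ (flowHorizon K s b φ) (flowHorizon K s b φ')
          = wHorizon K s σ φ φ') ∧
        (∃ C : ℝ, ∀ b : ℝ, ‖wHorizon K s σ φ (flowHorizon K s b φ')‖ ≤ C) ∧
        (∀ f : ℝ → ℝ, ContDiff ℝ ∞ f → HasCompactSupport f →
          MeasureTheory.Integrable (fun b : ℝ =>
            fourierT (fun x => (f x : ℂ)) b * wHorizon K s σ φ (flowHorizon K s b φ')) ∧
          MeasureTheory.Integrable (fun b : ℝ =>
            fourierT (fun x => (f x : ℂ)) (b + σ.val * Complex.I * K.beta)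
              * wHorizon K s σ.flip φ (flowHorizon K s b φ')) ∧
          ∫ b : ℝ, fourierT (fun x => (f x : ℂ)) b * wHorizon K s σ φ (flowHorizon K s b φ')
            = ∫ b : ℝ, fourierT (fun x => (f x : ℂ)) (b + σ.val * Complex.I * K.beta)
              * wHorizon K s σ.flip φ (flowHorizon K s b φ'))) ∧
    (∀ ψ ∈ physScriSpace K s, ∀ ψ' ∈ physScriSpace K s, ∀ σ : Sgn,
        (∀ b : ℝ, wScri K s σ (flowScri b ψ) (flowScri b ψ') = wScri K s σ ψ ψ') ∧
        (∃ C : ℝ, ∀ b : ℝ, ‖wScri K s σ ψ (flowScri b ψ')‖ ≤ C) ∧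
        (∀ f : ℝ → ℝ, ContDiff ℝ ∞ f → HasCompactSupport f →
          tsupport f ⊆ {x : ℝ | 0 < σ.val * x} →
          MeasureTheory.Integrable (fun b : ℝ =>
            fourierT (fun x => (f x : ℂ)) b * wScri K s σ ψ (flowScri b ψ')) ∧
          ∫ b : ℝ, fourierT (fun x => (f x : ℂ)) b * wScri K s σ ψ (flowScri b ψ') = 0)) := by
  refine ⟨fun φ hφ φ' hφ' σ => ⟨fun b => ?_, ?_, fun f hf hc => ?_⟩,
    fun ψ hψ ψ' hψ' σ => ⟨fun b => ?_, ?_, fun f hf hc hs => ⟨?_, ?_⟩⟩⟩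
  · have h0 := wHorizon_flowHorizon_eq hφ hφ' σ 0 0
    rw [flowHorizon_zero, flowHorizon_zero] at h0
    rw [wHorizon_flowHorizon_eq hφ hφ', h0, sub_self, sub_self]
  · exact ⟨_, fun b => (congrArg norm (wHorizon_flowHorizon_right_eq hφ hφ' σ b)).le.trans
      ((norm_mul_le _ _).trans
        (mul_le_mul_of_nonneg_left (norm_integral_phase_mul_le _ b) (norm_nonneg _)))⟩
  · have e : ∀ b : ℝ, fourierT (fun x => (f x : ℂ)) (b + σ.val * Complex.I * K.beta)
        = fourierT (fun x => Complex.exp (-((σ.val * K.beta : ℝ) * x)) * (f x : ℂ)) b := by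
      intro b
      rw [← fourierT_add_mul_I]
      congr 2
      push_cast
      ring
    simp only [e]
    exact ⟨integrable_fourierT_mul_wHorizon hφ hφ' σ (smoothL1_ofReal_comp hf hc),
      integrable_fourierT_mul_wHorizon hφ hφ' σ.flip (smoothL1_cexp_mul hf hc _),
      integral_fourierT_mul_wHorizon_eq_flip hφ hφ' σ hf hc⟩
  · rw [wScri_flowScri_eq hψ hψ', wScri_eq hψ hψ']
    simp
  · exact ⟨_, fun b => (congrArg norm (wScri_flowScri_right_eq hψ hψ' σ b)).le.trans
      ((norm_mul_le _ _).trans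
        (mul_le_mul_of_nonneg_left (norm_integral_phase_mul_le _ b) (norm_nonneg _)))⟩
  · exact integrable_fourierT_mul_wScri hψ hψ' σ (smoothL1_ofReal_comp hf hc)
  · exact integral_fourierT_mul_wScri_eq_zero hψ hψ' σ hf hc hs
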